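/- Let $g\ge 2$, $n=8g-4$, and let $\Gamma$ be a discrete group of orientation-preserving isometries of the hyperbolic unit disk $\mathbb D$ (a discrete subgroup of $SU(1,1)$, acting through its image in the group of Möbius transformations) acting freely on $\mathbb D$. Let $\mathcal F\subset\mathbb D$ be a closed fundamental $n$-gon for $\Gamma$ with the following structure, all indices being taken mod $n$. Side $i$ joins the vertices $V_i$ and $V_{i+1}$ and lies on the oriented geodesic $P_iQ_{i+1}$ from $P_i$ to $Q_{i+1}$; $\mathcal F$ is the intersection of the half-planes to the left of these geodesics; the points lie on $\mathbb S=\partial\mathbb D$ in the counterclockwise order $P_1,Q_1,P_2,Q_2,\dots,P_n,Q_n$. The translates of $\mathcal F$ cover $\mathbb D$ and have pairwise disjoint interiors, and no geodesic $P_iQ_{i+1}$ meets the interior of a translate $\gamma\mathcal F$, $\gamma\in\Gamma$. There are $T_i\in\Gamma$ with $T_i(V_i)=V_{\rho(i)}$, $T_{\sigma(i)}T_i=\mathrm{Id}$ and $T_{\rho^3(i)}T_{\rho^2(i)}T_{\rho(i)}T_i=\mathrm{Id}$, where $\sigma(i)=4g-i$ for odd $i$, $\sigma(i)=2-i$ for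 even $i$, and $\rho(i)=\sigma(i)+1$. (So $M=\Gamma\backslash\mathbb D$ is a closed surface of genus $g$.) Let $\pi:S\mathbb D\to SM=\Gamma\backslash S\mathbb D$ be the projection of unit tangent bundles, and let $\varphi^t$ be the geodesic flow on $SM$. Write $[x,y]$ for the closed counterclockwise arc of $\mathbb S$ from $x$ to $y$, put $\tau(i)=i+4g-2$ and $U_i=T_{\sigma(i)}T_{\tau(i)-1}$, and write $uw$ for the oriented geodesic from $u$ to $w$. Let $\bar A=(A_i)$ be extremal, that is, $A_i\in\{P_i,Q_i\}$ for every $i$. Then there are unique points $G_i\in[P_i,P_{i+1}]$ such that, for all $i$, $G_{\sigma(i)}=T_iG_{i-2}$ if $A_i=P_i$ and $G_{\sigma(i)}=T_{\tau(i)+1}G_{\tau(i)}$ if $A_i=Q_i$. With these put $H_i=U_iG_{\tau(i)-1}$ and $$\Omega_{\bar A}=\bigcup_{i=1}^{n}\Bigl([H_{i+1},G_{i-2}]\times[P_i,Q_i]\ \cup\ [H_{i+1},G_{i-1}]\times[Q_i,P_{i+1}]\Bigr).$$ For $K=\mathcal F$ or $K=\operatorname{int}\mathcal F$ (the two readings of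 "meets the polygon", which differ only for geodesics that meet the boundary of $\mathcal F$ but not its interior), let $\Omega_{\rm geo}$ be the set of $(u,w)$ such that $uw$ meets $K$. The geodesic $uw$ *enters* a set at the point at the infimum of the times at which it lies in the set. * The geometric cross-section $C_{\rm geo}\subset SM$ is the image under $\pi$ of the set of vectors tangent to $uw$ at the point where $uw$ enters $K$, for $(u,w)\in\Omega_{\rm geo}$. * For $(u,w)\in\Omega_{\bar A}$ let $\varphi(u,w)\in S\mathbb D$ be the vector tangent to $uw$ at the point where $uw$ enters $K$ or, if $uw$ does not meet $K$, at the point where it enters $U_jK$, with $j=i$ if $(u,w)\in[P_{i-1},P_i]\times[Q_i,Q_{i+1}]$ and $j=i+1$ if $(u,w)\in[Q_{i+1},Q_{i+2}]\times[P_i,P_{i+1}]$. The arithmetic cross-section is $C_{\bar A}=\pi(\varphi(\Omega_{\bar A}))$. (For $K=\operatorname{int}\mathcal F$, geodesics for which there is no such entrance point are left out.) The following hold. For $K=\mathcal F$ there is exactly one vector $\varphi(u,w)$ for each $(u,w)\in\Omega_{\bar A}$. For $K=\operatorname{int}\mathcal F$, $C_{\rm geo}$ is the image under $\pi$ of the set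 of unit tangent vectors based on $\partial\mathcal F$ and pointing into the interior of $\mathcal F$. For both choices of $K$, $$C_{\bar A}=C_{\rm geo},$$ and for every $x\in C_{\rm geo}$ the first return of $x$ to $C_{\rm geo}$ exists and is also its first return to $C_{\bar A}$: there is $t>0$ that is the least positive time with $\varphi^t(x)\in C_{\rm geo}$ and also the least positive time with $\varphi^t(x)\in C_{\bar A}$. -/

import Mathlib

open Filter Topology

open scoped ComplexConjugate

noncomputable section

/-! ### The group `SU(1,1)` and its action on the disk, on the circle and on unit tangent vectors -/

/-- The group `SU(1,1)` of matrices with rows `(a, b)` and `(conj b, conj a)`, `|a|² - |b|² = 1`. -/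
@[ext]
structure SU11 where
  a : ℂ
  b : ℂ
  det : Complex.normSq a - Complex.normSq b = 1

namespace SU11

instance : TopologicalSpace SU11 :=
  TopologicalSpace.induced (fun M : SU11 => (M.a, M.b)) inferInstance

theorem det' (M : SU11) : M.a * conj M.a - M.b * conj M.b = 1 := by
  have h := M.det
  rw [Complex.mul_conj, Complex.mul_conj]
  exact_mod_cast h

theorem det_of {a b : ℂ} (h : a * conj a - b * conj b = 1) :
    Complex.normSq a - Complex.normSq b = 1 := by
  rw [Complex.mul_conj, Complex.mul_conj] at h
  exact_mod_cast h

/-- Matrix multiplication. -/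
instance : Mul SU11 where
  mul M N := ⟨M.a * N.a + M.b * conj N.b, M.a * N.b + M.b * conj N.a, det_of (by
    simp only [map_add, map_mul, Complex.conj_conj]
    linear_combination M.det' + (M.a * conj M.a - M.b * conj M.b) * N.det')⟩

/-- The identity matrix. -/
instance : One SU11 where
  one := ⟨1, 0, by simp⟩

/-- The inverse matrix. -/
instance : Inv SU11 where
  inv M := ⟨conj M.a, -M.b, by simpa using M.det⟩

theorem mul_a (M N : SU11) : (M * N).a = M.a * N.a + M.b * conj N.b := rfl
theorem mul_b (M N : SU11) : (M * N).b = M.a * N.b + M.b * conj N.a := rfl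
theorem one_a : (1 : SU11).a = 1 := rfl
theorem one_b : (1 : SU11).b = 0 := rfl
theorem inv_a (M : SU11) : (M⁻¹).a = conj M.a := rfl
theorem inv_b (M : SU11) : (M⁻¹).b = -M.b := rfl

instance : Group SU11 :=
  Group.ofLeftAxioms
    (by intro x y z; ext <;> simp only [mul_a, mul_b, map_add, map_mul, Complex.conj_conj] <;> ring)
    (by intro x; ext <;> simp [mul_a, mul_b, one_a, one_b])
    (by
      intro x
      ext
      · simp only [mul_a, inv_a, inv_b, one_a]
        linear_combination x.det'
      · simp only [mul_b, inv_a, inv_b, one_b]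
        ring)

/-- The numerator of the Möbius transformation `z ↦ (a z + b) / (conj b z + conj a)`. -/
def num (M : SU11) (z : ℂ) : ℂ := M.a * z + M.b

/-- The denominator of the Möbius transformation `z ↦ (a z + b) / (conj b z + conj a)`. -/
def den (M : SU11) (z : ℂ) : ℂ := conj M.b * z + conj M.a

/-- The Möbius transformation `z ↦ (a z + b) / (conj b z + conj a)`. -/
def mobius (M : SU11) (z : ℂ) : ℂ := M.num z / M.den z

theorem normSq_den_sub (M : SU11) (z : ℂ) :
    Complex.normSq (M.den z) - Complex.normSq (M.num z) = 1 - Complex.normSq z := by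
  have h : M.den z * conj (M.den z) - M.num z * conj (M.num z) = 1 - z * conj z := by
    simp only [den, num, map_add, map_mul, Complex.conj_conj]
    linear_combination (1 - z * conj z) * M.det'
  simp only [Complex.mul_conj] at h
  exact_mod_cast h

theorem den_ne_zero (M : SU11) {z : ℂ} (hz : ‖z‖ ≤ 1) : M.den z ≠ 0 := by
  intro h0
  have h1 := M.normSq_den_sub z
  rw [h0, Complex.normSq_zero] at h1
  have hz2 : Complex.normSq z ≤ 1 := by
    rw [Complex.normSq_eq_norm_sq]; nlinarith [norm_nonneg z]
  have h2 : Complex.normSq (M.num z) = 0 := by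
    nlinarith [Complex.normSq_nonneg (M.num z)]
  rw [Complex.normSq_eq_zero] at h2
  have h3 : z = conj M.a * M.num z - M.b * M.den z := by
    simp only [den, num]
    linear_combination (-z) * M.det'
  rw [h2, h0] at h3
  have h4 : M.den z = conj M.a := by rw [h3]; simp [den]
  have h5 : M.num z = M.b := by rw [h3]; simp [num]
  have := M.det'
  rw [← h4, ← h5, h0, h2] at this
  simp at this

theorem normSq_mobius (M : SU11) {z : ℂ} (hz : ‖z‖ ≤ 1) :
    1 - Complex.normSq (M.mobius z) = (1 - Complex.normSq z) / Complex.normSq (M.den z) := by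
  have h := M.den_ne_zero hz
  have h' : Complex.normSq (M.den z) ≠ 0 := by simpa using h
  rw [mobius, map_div₀, ← M.normSq_den_sub z]
  field_simp

theorem norm_mobius_lt (M : SU11) {z : ℂ} (hz : ‖z‖ < 1) : ‖M.mobius z‖ < 1 := by
  have h := M.normSq_mobius hz.le
  have h' : 0 < Complex.normSq (M.den z) := Complex.normSq_pos.2 (M.den_ne_zero hz.le)
  have hz2 : 0 < 1 - Complex.normSq z := by
    rw [Complex.normSq_eq_norm_sq]; nlinarith [norm_nonneg z]
  have := div_pos hz2 h'
  rw [← h, Complex.normSq_eq_norm_sq] at this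
  nlinarith [norm_nonneg (M.mobius z)]

theorem norm_mobius_eq (M : SU11) {z : ℂ} (hz : ‖z‖ = 1) : ‖M.mobius z‖ = 1 := by
  have h := M.normSq_mobius hz.le
  rw [Complex.normSq_eq_norm_sq, Complex.normSq_eq_norm_sq, hz] at h
  have h2 : ‖M.mobius z‖ ^ 2 = 1 := by
    have : (1 - (1 : ℝ) ^ 2) / Complex.normSq (M.den z) = 0 := by simp
    linarith
  nlinarith [norm_nonneg (M.mobius z)]

theorem den_mul (M N : SU11) {z : ℂ} (hz : ‖z‖ ≤ 1) :
    (M * N).den z = M.den (N.mobius z) * N.den z := by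
  have h := N.den_ne_zero hz
  have e : N.mobius z * N.den z = N.num z := by rw [mobius]; field_simp
  have e2 : M.den (N.mobius z) * N.den z = conj M.b * N.num z + conj M.a * N.den z := by
    rw [← e]; simp only [den]; ring
  rw [e2]
  simp only [den, num, mul_a, mul_b, map_add, map_mul, Complex.conj_conj]
  ring

theorem mobius_mul (M N : SU11) {z : ℂ} (hz : ‖z‖ ≤ 1) (hNz : ‖N.mobius z‖ ≤ 1) :
    (M * N).mobius z = M.mobius (N.mobius z) := by
  have h := N.den_ne_zero hz
  have h' := M.den_ne_zero hNz
  have e : N.mobius z * N.den z = N.num z := by rw [mobius]; field_simp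
  have e2 : (M * N).num z = M.num (N.mobius z) * N.den z := by
    have : M.num (N.mobius z) * N.den z = M.a * N.num z + M.b * N.den z := by
      rw [← e]; simp only [num]; ring
    rw [this]
    simp only [den, num, mul_a, mul_b]
    ring
  rw [mobius, e2, den_mul M N hz, mul_div_mul_right _ _ h]
  rfl

theorem den_one (z : ℂ) : (1 : SU11).den z = 1 := by simp [den, one_a, one_b]

theorem mobius_one (z : ℂ) : (1 : SU11).mobius z = z := by
  rw [mobius, den_one]; simp [num, one_a, one_b]

/-- `SU(1,1)` acts on the open unit disk by Möbius transformations. -/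
instance : MulAction SU11 Complex.UnitDisc where
  smul M z := Complex.UnitDisc.mk (M.mobius z) (M.norm_mobius_lt z.norm_lt_one)
  one_smul z := Complex.UnitDisc.coe_injective (mobius_one z)
  mul_smul M N z := Complex.UnitDisc.coe_injective
    (mobius_mul M N z.norm_lt_one.le (N.norm_mobius_lt z.norm_lt_one).le)

theorem coe_smul_disc (M : SU11) (z : Complex.UnitDisc) :
    ((M • z : Complex.UnitDisc) : ℂ) = M.mobius z := rfl

/-- `SU(1,1)` acts on the circle at infinity by Möbius transformations. -/
instance : MulAction SU11 Circle where
  smul M z := ⟨M.mobius z, mem_sphere_zero_iff_norm.2 (M.norm_mobius_eq z.norm_coe)⟩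
  one_smul z := Circle.ext (mobius_one z)
  mul_smul M N z := Circle.ext
    (mobius_mul M N z.norm_coe.le (N.norm_mobius_eq z.norm_coe).le)

theorem coe_smul_circle (M : SU11) (z : Circle) : ((M • z : Circle) : ℂ) = M.mobius z := rfl

end SU11

/-- `q ↦ conj q / q`, as a point of the unit circle (with the value `1` at `q = 0`). -/
def conjDivSelf (q : ℂ) : Circle := if h : q = 0 then 1 else Circle.ofConjDivSelf q h

theorem coe_conjDivSelf {q : ℂ} (h : q ≠ 0) : (conjDivSelf q : ℂ) = conj q / q := by
  simp [conjDivSelf, h]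

/-- A unit tangent vector `(z, ζ)` of the hyperbolic disk. It is recorded by its base point `z`
and its Euclidean direction `ζ`, `|ζ| = 1`; as a Euclidean vector, the tangent vector of hyperbolic
length one is `((1 - |z|²) / 2) ζ`. -/
@[ext]
structure UnitTangent where
  base : Complex.UnitDisc
  dir : Circle

namespace UnitTangent

/-- `SU(1,1)` acts on unit tangent vectors through the derivative: the Möbius transformation with
denominator `q z = conj b z + conj a` has derivative `1 / (q z)²`, which turns directions by
`conj (q z) / q z`. -/
instance : MulAction SU11 UnitTangent where
  smul M v := ⟨M • v.base, conjDivSelf (M.den v.base) * v.dir⟩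
  one_smul v := by
    refine UnitTangent.ext (one_smul SU11 v.base) ?_
    change conjDivSelf ((1 : SU11).den v.base) * v.dir = v.dir
    rw [SU11.den_one]
    apply Circle.ext
    simp [coe_conjDivSelf one_ne_zero]
  mul_smul M N v := by
    refine UnitTangent.ext (mul_smul M N v.base) ?_
    change conjDivSelf ((M * N).den v.base) * v.dir =
      conjDivSelf (M.den (N.mobius v.base)) * (conjDivSelf (N.den v.base) * v.dir)
    have hz := v.base.norm_lt_one
    have h1 := N.den_ne_zero hz.le
    have h2 := M.den_ne_zero (N.norm_mobius_lt hz).le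
    rw [SU11.den_mul M N hz.le]
    apply Circle.ext
    rw [Circle.coe_mul, Circle.coe_mul, Circle.coe_mul, coe_conjDivSelf (mul_ne_zero h2 h1),
      coe_conjDivSelf h1, coe_conjDivSelf h2, map_mul]
    field_simp

theorem smul_base (M : SU11) (v : UnitTangent) : (M • v).base = M • v.base := rfl

theorem smul_dir (M : SU11) (v : UnitTangent) :
    (M • v).dir = conjDivSelf (M.den v.base) * v.dir := rfl

/-! ### The geodesic flow on the disk -/

theorem abs_tanh_lt_one (t : ℝ) : |Real.tanh t| < 1 := by
  exact Real.abs_tanh_lt_one t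

/-- `1 + conj z ζ tanh (t / 2)`. -/
def flowDen (v : UnitTangent) (t : ℝ) : ℂ :=
  1 + conj (v.base : ℂ) * ((v.dir : ℂ) * (Real.tanh (t / 2) : ℝ))

theorem norm_dir_mul (v : UnitTangent) (t : ℝ) :
    ‖(v.dir : ℂ) * (Real.tanh (t / 2) : ℝ)‖ < 1 := by
  rw [norm_mul, Circle.norm_coe, one_mul, Complex.norm_real, Real.norm_eq_abs]
  exact abs_tanh_lt_one _

theorem flowDen_ne_zero (v : UnitTangent) (t : ℝ) : v.flowDen t ≠ 0 := by
  intro h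
  have h1 : conj (v.base : ℂ) * ((v.dir : ℂ) * (Real.tanh (t / 2) : ℝ)) = -1 := by
    rw [flowDen] at h
    linear_combination h
  have h2 := congrArg norm h1
  rw [norm_mul, RCLike.norm_conj, norm_neg, norm_one] at h2
  have h3 := v.norm_dir_mul t
  have h4 := v.base.norm_lt_one
  nlinarith [norm_nonneg (v.base : ℂ), norm_nonneg ((v.dir : ℂ) * (Real.tanh (t / 2) : ℝ))]

/-- `(ζ tanh (t / 2) + z) / (1 + conj z ζ tanh (t / 2))`. -/
def flowPoint (v : UnitTangent) (t : ℝ) : ℂ :=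
  ((v.dir : ℂ) * (Real.tanh (t / 2) : ℝ) + v.base) / v.flowDen t

theorem norm_flowPoint_lt (v : UnitTangent) (t : ℝ) : ‖v.flowPoint t‖ < 1 := by
  have hd := v.flowDen_ne_zero t
  have h1 := v.norm_dir_mul t
  have h2 := v.base.norm_lt_one
  rw [flowPoint, norm_div, div_lt_one (norm_pos_iff.2 hd)]
  unfold flowDen
  generalize (v.dir : ℂ) * (Real.tanh (t / 2) : ℝ) = w at h1
  generalize (v.base : ℂ) = z at h2
  refine lt_of_pow_lt_pow_left₀ 2 (norm_nonneg _) ?_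
  rw [← Complex.normSq_eq_norm_sq, ← Complex.normSq_eq_norm_sq]
  have hw : Complex.normSq w < 1 := by
    rw [Complex.normSq_eq_norm_sq]; nlinarith [norm_nonneg w]
  have hz : Complex.normSq z < 1 := by
    rw [Complex.normSq_eq_norm_sq]; nlinarith [norm_nonneg z]
  have key : Complex.normSq (1 + conj z * w) - Complex.normSq (w + z) =
      (1 - Complex.normSq z) * (1 - Complex.normSq w) := by
    simp only [Complex.normSq_apply, Complex.add_re, Complex.add_im, Complex.mul_re,
      Complex.mul_im, Complex.conj_re, Complex.conj_im, Complex.one_re, Complex.one_im]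
    ring
  nlinarith [mul_pos (sub_pos.2 hz) (sub_pos.2 hw)]

/-- The geodesic flow on the unit tangent bundle of the disk: the unit speed geodesic from the
origin in direction `ζ` is `t ↦ ζ tanh (t / 2)`, and it is moved to the base point `z` by the
isometry `x ↦ (x + z) / (1 + conj z x)`, which preserves directions at the origin and turns
directions at `x` by `conj q / q` with `q = 1 + conj z x`. -/
def flow (t : ℝ) (v : UnitTangent) : UnitTangent :=
  ⟨Complex.UnitDisc.mk (v.flowPoint t) (v.norm_flowPoint_lt t), conjDivSelf (v.flowDen t) * v.dir⟩

theorem flowDen_smul (M : SU11) (v : UnitTangent) (t : ℝ) :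
    (M • v).flowDen t * M.den v.base = M.den (v.flowPoint t) * v.flowDen t := by
  have h1 := M.den_ne_zero v.base.norm_lt_one.le
  have h2 := v.flowDen_ne_zero t
  have h1' : conj (M.den v.base) ≠ 0 := by simpa using h1
  have e : v.flowPoint t * v.flowDen t = (v.dir : ℂ) * (Real.tanh (t / 2) : ℝ) + v.base := by
    rw [flowPoint]; field_simp
  have e1 : M.den (v.flowPoint t) * v.flowDen t =
      conj M.b * ((v.dir : ℂ) * (Real.tanh (t / 2) : ℝ) + v.base) + conj M.a * v.flowDen t := by
    rw [← e]; simp only [SU11.den]; ring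
  rw [e1]
  rw [flowDen, smul_base, smul_dir, Circle.coe_mul, coe_conjDivSelf h1, SU11.coe_smul_disc,
    SU11.mobius, map_div₀, flowDen]
  field_simp
  simp only [SU11.den, SU11.num, map_add, map_mul]
  ring

/-- The geodesic flow commutes with isometries. -/
theorem flow_smul (M : SU11) (t : ℝ) (v : UnitTangent) : flow t (M • v) = M • flow t v := by
  have h1 := M.den_ne_zero v.base.norm_lt_one.le
  have h2 := v.flowDen_ne_zero t
  have h3 := M.den_ne_zero (v.norm_flowPoint_lt t).le
  have h4 := (M • v).flowDen_ne_zero t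
  have h1' : conj (M.den v.base) ≠ 0 := by simpa using h1
  have hq := flowDen_smul M v t
  apply UnitTangent.ext
  · apply Complex.UnitDisc.coe_injective
    change (M • v).flowPoint t = M.num (v.flowPoint t) / M.den (v.flowPoint t)
    have e : v.flowPoint t * v.flowDen t = (v.dir : ℂ) * (Real.tanh (t / 2) : ℝ) + v.base := by
      rw [flowPoint]; field_simp
    have e1 : M.num (v.flowPoint t) * v.flowDen t =
        M.a * ((v.dir : ℂ) * (Real.tanh (t / 2) : ℝ) + v.base) + M.b * v.flowDen t := by
      rw [← e]; simp only [SU11.num]; ring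
    have e2 : (((M • v).dir : ℂ) * (Real.tanh (t / 2) : ℝ) + (M • v).base) * M.den v.base =
        M.num (v.flowPoint t) * v.flowDen t := by
      rw [e1, smul_base, smul_dir, Circle.coe_mul, coe_conjDivSelf h1, SU11.coe_smul_disc,
        SU11.mobius, flowDen]
      field_simp
      simp only [SU11.den, SU11.num, map_add, map_mul, Complex.conj_conj]
      ring
    rw [flowPoint, div_eq_div_iff h4 h3]
    apply mul_right_cancel₀ (mul_ne_zero h1 h2)
    linear_combination (M.den (v.flowPoint t) * v.flowDen t) * e2 -
      (M.num (v.flowPoint t) * v.flowDen t) * hq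
  · change conjDivSelf ((M • v).flowDen t) * (conjDivSelf (M.den v.base) * v.dir) =
      conjDivSelf (M.den (v.flowPoint t)) * (conjDivSelf (v.flowDen t) * v.dir)
    have hq' := congrArg (starRingEnd ℂ) hq
    simp only [map_mul] at hq'
    apply Circle.ext
    simp only [Circle.coe_mul]
    rw [coe_conjDivSelf h1, coe_conjDivSelf h2, coe_conjDivSelf h3, coe_conjDivSelf h4]
    have : conj ((M • v).flowDen t) / (M • v).flowDen t * (conj (M.den v.base) / M.den v.base) =
        conj (M.den (v.flowPoint t)) / M.den (v.flowPoint t) *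
          (conj (v.flowDen t) / v.flowDen t) := by
      rw [div_mul_div_comm, div_mul_div_comm, hq, hq']
    linear_combination (v.dir : ℂ) * this

/-- The oriented geodesic through `v` goes from the point `u` to the point `w` of the circle at
infinity; that is, `v` is tangent to the oriented geodesic `uw`. -/
def Joins (v : UnitTangent) (u w : Circle) : Prop :=
  Tendsto (fun t : ℝ => ((flow t v).base : ℂ)) atBot (𝓝 (u : ℂ)) ∧
    Tendsto (fun t : ℝ => ((flow t v).base : ℂ)) atTop (𝓝 (w : ℂ))

/-- The geodesic through `v` enters the (convex) set `K` at the base point of `v`: time `0` is the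
infimum of the times at which the geodesic is in `K`. -/
def Enters (v : UnitTangent) (K : Set Complex.UnitDisc) : Prop :=
  IsGLB {t : ℝ | (flow t v).base ∈ K} 0

end UnitTangent

/-- The points of the oriented geodesic `uw`. -/
def geodesicLine (u w : Circle) : Set Complex.UnitDisc :=
  {z | ∃ v : UnitTangent, v.base = z ∧ v.Joins u w}

/-! ### The quotient surface -/

/-- The action of `Γ` on the disk is free (`Γ` is viewed through its image in the group of Möbius
transformations, in which `1` and `-1` become equal). -/
def ActsFreely (Γ : Subgroup SU11) : Prop :=
  ∀ γ ∈ Γ, (∃ z : Complex.UnitDisc, γ • z = z) → ∀ z : Complex.UnitDisc, γ • z = z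

/-- The unit tangent bundle `SM` of the surface `M = Γ \ 𝔻`. -/
abbrev SurfaceTangent (Γ : Subgroup SU11) : Type := MulAction.orbitRel.Quotient Γ UnitTangent

/-- The canonical projection `π` from the unit tangent bundle of the disk to `SM`. -/
def tangentProj (Γ : Subgroup SU11) (v : UnitTangent) : SurfaceTangent Γ :=
  Quotient.mk (MulAction.orbitRel Γ UnitTangent) v

/-- The geodesic flow on `SM`. -/
def surfaceFlow (Γ : Subgroup SU11) (t : ℝ) : SurfaceTangent Γ → SurfaceTangent Γ :=
  Quotient.map (UnitTangent.flow t) (by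
    rintro _ v ⟨γ, rfl⟩
    exact ⟨γ, (UnitTangent.flow_smul (γ : SU11) t v).symm⟩)

/-- `t` is the time of the first return of `x` to the set `C` under the geodesic flow, so that the
first return is `surfaceFlow Γ t x`. -/
def IsFirstReturnTime {Γ : Subgroup SU11} (C : Set (SurfaceTangent Γ)) (x : SurfaceTangent Γ)
    (t : ℝ) : Prop :=
  IsLeast {s : ℝ | 0 < s ∧ surfaceFlow Γ s x ∈ C} t

/-! ### Arcs and half-planes -/

/-- Twice the signed area of the triangle `x y z`: positive if and only if the vertices are in
counterclockwise order, equivalently `z` is strictly to the left of the line from `x` to `y`. -/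
def orient (x y z : ℂ) : ℝ := (conj (y - x) * (z - x)).im

/-- The closed arc `[x, y]` of the circle, counterclockwise from `x` to `y`. -/
def arc (x y : Circle) : Set Circle := {z | z = x ∨ z = y ∨ 0 < orient x z y}

/-- The passage from the Poincaré disk model to the Klein disk model, in which the geodesic `uw` is
the straight chord from `u` to `w`. -/
def klein (z : Complex.UnitDisc) : ℂ := 2 * (z : ℂ) / (1 + Complex.normSq (z : ℂ) : ℝ)

/-- The closed half-plane of the hyperbolic disk to the left of the oriented geodesic `uw`. -/
def leftHalfPlane (u w : Circle) : Set Complex.UnitDisc := {z | 0 ≤ orient u w (klein z)}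

/-! ### The `(8g-4)`-gon -/

/-- The labels `1, …, 8g-4` of the sides, modulo `8g-4` (so the label `8g-4` is `0`). -/
abbrev SideIndex (g : ℕ) : Type := ZMod (8 * g - 4)

/-- The side pairing: `4g - i` for odd `i`, and `2 - i` for even `i`. -/
def sidePair {g : ℕ} (i : SideIndex g) : SideIndex g :=
  if Odd i.val then 4 * (g : SideIndex g) - i else 2 - i

/-- `ρ i = σ i + 1`. -/
def rhoIdx {g : ℕ} (i : SideIndex g) : SideIndex g := sidePair i + 1

/-- `τ i = i + (4g - 2)`, the opposite side. -/
def tauIdx {g : ℕ} (i : SideIndex g) : SideIndex g := i + (4 * (g : SideIndex g) - 2)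

/-- The polygon bounded by the geodesics from `P i` to `Q (i+1)`, lying to their left. -/
def polygon {g : ℕ} (P Q : SideIndex g → Circle) : Set Complex.UnitDisc :=
  ⋂ i, leftHalfPlane (P i) (Q (i + 1))

/-- A labelled fundamental `(8g-4)`-gon for `Γ` with the side pairing `sidePair` and the extension
condition. -/
structure FundamentalPolygon (g : ℕ) (Γ : Subgroup SU11) where
  /-- side `i` lies on the geodesic from `P i` to `Q (i+1)` -/
  P : SideIndex g → Circle
  /-- side `i` lies on the geodesic from `P i` to `Q (i+1)` -/
  Q : SideIndex g → Circle
  /-- the vertices; side `i` connects `V i` to `V (i+1)` -/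
  V : SideIndex g → Complex.UnitDisc
  /-- the side pairing transformations -/
  T : SideIndex g → SU11
  /-- the points `P i` are in counterclockwise order -/
  P_order : ∀ i j k, i.val < j.val → j.val < k.val → 0 < orient (P i) (P j) (P k)
  /-- `Q i` is between `P i` and `P (i+1)`; so the counterclockwise order on the circle is
  `P 1, Q 1, P 2, Q 2, …` -/
  Q_order : ∀ i, 0 < orient (P i) (Q i) (P (i + 1))
  V_left : ∀ i, V i ∈ geodesicLine (P i) (Q (i + 1))
  V_right : ∀ i, V (i + 1) ∈ geodesicLine (P i) (Q (i + 1))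
  T_mem : ∀ i, T i ∈ Γ
  T_vertex : ∀ i, T i • V i = V (rhoIdx i)
  T_pair : ∀ i, ∀ z : Complex.UnitDisc, T (sidePair i) • T i • z = z
  T_cycle : ∀ i, ∀ z : Complex.UnitDisc,
    T (rhoIdx (rhoIdx (rhoIdx i))) • T (rhoIdx (rhoIdx i)) • T (rhoIdx i) • T i • z = z
  /-- the translates of the polygon cover the disk -/
  cover : ∀ z : Complex.UnitDisc, ∃ γ ∈ Γ, γ • z ∈ polygon P Q
  /-- distinct translates of the polygon have disjoint interiors -/
  tile_disjoint : ∀ γ ∈ Γ,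
    (∃ z ∈ interior (polygon P Q), γ • z ∈ interior (polygon P Q)) →
      ∀ z : Complex.UnitDisc, γ • z = z
  /-- the extension condition: the geodesics extending the sides do not meet the interior of any
  translate of the polygon -/
  extension : ∀ i, ∀ γ ∈ Γ, ∀ z ∈ interior (polygon P Q), γ • z ∉ geodesicLine (P i) (Q (i + 1))

namespace FundamentalPolygon

variable {g : ℕ} {Γ : Subgroup SU11} (R : FundamentalPolygon g Γ)

/-- The closed polygon. -/
def F : Set Complex.UnitDisc := polygon R.P R.Q

/-- The parameters `A` are extremal. -/
def IsExtremal (A : SideIndex g → Circle) : Prop := ∀ i, A i = R.P i ∨ A i = R.Q i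

/-- The system of conditions that determines the points `G i` from the parameters `A`. -/
def IsSystemSolution (A G : SideIndex g → Circle) : Prop :=
  ∀ i, G i ∈ arc (R.P i) (R.P (i + 1)) ∧
    (A i = R.P i → G (sidePair i) = R.T i • G (i - 2)) ∧
    (A i = R.Q i → G (sidePair i) = R.T (tauIdx i + 1) • G (tauIdx i))

/-- `U i = T (σ i) ∘ T (τ i - 1)`. -/
def U (i : SideIndex g) : SU11 := R.T (sidePair i) * R.T (tauIdx i - 1)

/-- `H i = U i (G (τ i - 1))`. -/
def H (G : SideIndex g → Circle) (i : SideIndex g) : Circle := R.U i • G (tauIdx i - 1)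

/-- The set `Ω_A` of pairs `(u, w)`, a union of rectangles. -/
def Omega (G : SideIndex g → Circle) : Set (Circle × Circle) :=
  ⋃ i, (arc (R.H G (i + 1)) (G (i - 2)) ×ˢ arc (R.P i) (R.Q i)) ∪
    (arc (R.H G (i + 1)) (G (i - 1)) ×ˢ arc (R.Q i) (R.P (i + 1)))

/-- The set of pairs `(u, w)` such that the geodesic `uw` meets `K`. For `K` the polygon (closed, or
its interior) this is `Ω_geo`. -/
def OmegaGeo (K : Set Complex.UnitDisc) : Set (Circle × Circle) :=
  {p | ∃ z ∈ K, z ∈ geodesicLine p.1 p.2}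

/-- The lower corner `C_i`. -/
def lowerCorner (G : SideIndex g → Circle) (K : Set Complex.UnitDisc) (i : SideIndex g) :
    Set (Circle × Circle) :=
  (R.Omega G \ OmegaGeo K) ∩
    (arc (R.Q (i + 1)) (R.Q (i + 2)) ×ˢ arc (R.P i) (R.P (i + 1)))

/-- The upper corner `C^i`. -/
def upperCorner (G : SideIndex g → Circle) (K : Set Complex.UnitDisc) (i : SideIndex g) :
    Set (Circle × Circle) :=
  (R.Omega G \ OmegaGeo K) ∩
    (arc (R.P (i - 1)) (R.P i) ×ˢ arc (R.Q i) (R.Q (i + 1)))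

/-- `v = φ (u, w)`: the vector tangent to `uw` at the point where `uw` enters `K` or, if `uw` does
not meet `K`, at the point where it enters `U j K`, with `j = i` if `(u, w)` is in the upper corner
`C^i` and `j = i + 1` if `(u, w)` is in the lower corner `C_i`. -/
def IsArithEntry (G : SideIndex g → Circle) (K : Set Complex.UnitDisc) (p : Circle × Circle)
    (v : UnitTangent) : Prop :=
  v.Joins p.1 p.2 ∧
    ((p ∈ OmegaGeo K ∧ v.Enters K) ∨
      (∃ i, p ∈ R.upperCorner G K i ∧ v.Enters ((fun z => R.U i • z) '' K)) ∨
      (∃ i, p ∈ R.lowerCorner G K i ∧ v.Enters ((fun z => R.U (i + 1) • z) '' K)))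

/-- The arithmetic cross-section `C_A`, the image of `Ω_A` under `π ∘ φ`. -/
def arithmeticCrossSection (G : SideIndex g → Circle) (K : Set Complex.UnitDisc) :
    Set (SurfaceTangent Γ) :=
  tangentProj Γ '' {v | ∃ p ∈ R.Omega G, R.IsArithEntry G K p v}

/-- The geometric cross-section `C_geo`, the image of `Ω_geo` under `π ∘ ψ`, where `ψ (u, w)` is the
vector tangent to `uw` at the point where `uw` enters `K`. -/
def geometricCrossSection (Γ : Subgroup SU11) (K : Set Complex.UnitDisc) :
    Set (SurfaceTangent Γ) :=
  tangentProj Γ '' {v | ∃ p ∈ OmegaGeo K, v.Joins p.1 p.2 ∧ v.Enters K}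

/-- The unit tangent vectors based on the boundary of the polygon and pointing inwards. -/
def inwardVectors : Set UnitTangent :=
  {v | v.base ∈ frontier R.F ∧ ∀ᶠ t in 𝓝[>] (0 : ℝ), (UnitTangent.flow t v).base ∈ interior R.F}

end FundamentalPolygon

end

open UnitTangent

/-! In the Klein model geodesics are chords, and lying to the left of `ab` is the sign of the affine
function `orient a b`. Along the geodesic from `u` to `w` this function equals `(orient a b u + r *
orient a b w) / (1 + r)`, where `r` increases from 0 to infinity (`UnitTangent.orient_flow`).
Questions about when a geodesic lies in a tile thus become inequalities linear in `r`. Questions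
about endpoints concern cyclic order on the circle, which a chart (`IsChart`) turns into linear
order.

Geometry of the polygon. `T i` carries the line of side `i` to the line of side `σ i` with reversed
direction (`T_side`). The four exterior rotations of a vertex cycle have product 1
(`extRotation_cycle`). The extension condition forbids two consecutive exterior angles to have sum
less than `π`, so each such sum is exactly `π`, and `T i` also carries the extension of side `i - 1`
to that of side `σ i + 1` (`T_prev`). Consequently `U i` reverses the two lines crossing at `V (τ
i)` onto the two lines crossing at `V i`: `U i F` is the tile vertically opposite to `F` at `V i`,
and `U (τ i)` is inverse to `U i` up to sign.

The points `G`. Each condition reads `G k = S k • G (f k)`, where `S k` maps the arc `[P (f k), P (f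
k + 1)]` monotonically into `[P k, P (k + 1)]`. A solution exists by the Knaster-Tarski theorem. Two
solutions that differ would give a composed step around a cycle of `f` two fixed points in its arc,
which `IsStep.eq_of_fixed` excludes.

Equality of the cross-sections. This part needs of `G` only that `G k` lies in `[P k, P (k + 1)]`.
Geodesics of `Omega` that miss `F` pass near a vertex `V j` and meet the opposite tile `U j F`;
pulling back by `U (τ j)` shows that their entry vectors project into the geometric cross-section.
Conversely, a geodesic that meets `F` but is not in `Omega` passes near some `V j`, and `U (τ j)`
carries it into `Omega`, because `H (τ j) = U (τ j) G (j - 1)` (`mem_Omega_or_smul_mem_Omega`). The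
image normally misses `K`, so that the arithmetic rule applies to it; when it does meet `K`, then
`K` is closed and both tiles are met in one common point, so the entry vectors still agree
(`geometricCrossSection_subset`).

First return. Return times are the times at which the geodesic enters translates of `K`.
Discreteness makes the tiling locally finite, so only finitely many return times lie below a given
bound. There is at least one, since the geodesic leaves the finitely many tiles that contain its
starting point and must then meet others; for the open polygon the extension condition keeps it from
running along sides. -/

theorem Circle.conj_coe_eq_inv (z : Circle) : conj (z : ℂ) = (z : ℂ)⁻¹ := by
  rw [← Circle.coe_inv_eq_conj, Circle.coe_inv]

/-! ### Orientation -/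

theorem orient_rotate (x y z : ℂ) : orient y z x = orient x y z := by
  simp only [orient, Complex.mul_im, Complex.sub_re, Complex.sub_im, Complex.conj_re,
    Complex.conj_im, map_sub]
  ring

theorem orient_swap (x y z : ℂ) : orient y x z = -orient x y z := by
  simp only [orient, Complex.mul_im, Complex.sub_re, Complex.sub_im, Complex.conj_re,
    Complex.conj_im, map_sub]
  ring

theorem orient_self_left (x z : ℂ) : orient x x z = 0 := by simp [orient]

theorem orient_self_mid (x y : ℂ) : orient x y x = 0 := by simp [orient]

/-- `orient` is affine in its last argument. -/
theorem orient_combo (a b x y : ℂ) {s t : ℝ} (h : s + t = 1) :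
    orient a b (s * x + t * y) = s * orient a b x + t * orient a b y := by
  obtain rfl : t = 1 - s := by linarith
  simp only [orient, Complex.mul_im, Complex.mul_re, Complex.add_re, Complex.add_im,
    Complex.sub_re, Complex.sub_im, Complex.conj_re,
    Complex.conj_im, map_sub, Complex.ofReal_re, Complex.ofReal_im]
  ring

/-- On the unit circle conjugation is inversion, so `orient` becomes a rational function of the
three points; the product form makes its transformation under isometries and its zeros visible. -/
theorem orient_circle (x y z : Circle) :
    (orient x y z : ℂ) * (2 * Complex.I) =
      ((x : ℂ) - y) * (z - x) * (z - y) / (x * y * z) := by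
  have hx := x.coe_ne_zero
  have hy := y.coe_ne_zero
  have hz := z.coe_ne_zero
  rw [orient]
  have h := Complex.sub_conj (conj ((y : ℂ) - x) * (z - x))
  have e : (((conj ((y : ℂ) - x) * (z - x)).im : ℝ) : ℂ) * (2 * Complex.I) =
      conj ((y : ℂ) - x) * (z - x) - conj (conj ((y : ℂ) - x) * (z - x)) := by
    rw [h]; push_cast; ring
  rw [e]
  simp only [map_mul, map_sub, map_inv₀, inv_inv, Circle.conj_coe_eq_inv]
  field_simp
  ring

/-! ### The action on the circle, and the elements that act trivially -/

namespace SU11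

theorem num_circle (M : SU11) (z : Circle) : M.num z = z * conj (M.den z) := by
  have := z.coe_ne_zero
  simp only [num, den, map_add, map_mul, Complex.conj_conj, Circle.conj_coe_eq_inv]
  field_simp
  ring

theorem den_circle_ne_zero (M : SU11) (z : Circle) : M.den z ≠ 0 :=
  M.den_ne_zero z.norm_coe.le

theorem coe_smul_circle' (M : SU11) (z : Circle) :
    ((M • z : Circle) : ℂ) = z * conj (M.den z) / M.den z := by
  rw [coe_smul_circle, mobius, num_circle]

theorem smul_circle_sub (M : SU11) (x y : Circle) :
    ((M • x : Circle) : ℂ) - (M • y : Circle) = (x - y) / (M.den x * M.den y) := by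
  have hx := M.den_circle_ne_zero x
  have hy := M.den_circle_ne_zero y
  rw [coe_smul_circle, coe_smul_circle, mobius, mobius]
  field_simp
  simp only [num, den]
  linear_combination ((x : ℂ) - y) * M.det'

/-- The action on the circle changes `orient` by a positive factor. -/
theorem orient_smul (M : SU11) (x y z : Circle) :
    orient (M • x : Circle) (M • y : Circle) (M • z : Circle) =
      orient x y z / (Complex.normSq (M.den x) * Complex.normSq (M.den y) *
        Complex.normSq (M.den z)) := by
  have hx := M.den_circle_ne_zero x
  have hy := M.den_circle_ne_zero y
  have hz := M.den_circle_ne_zero z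
  have h := orient_circle (M • x) (M • y) (M • z)
  rw [smul_circle_sub, smul_circle_sub, smul_circle_sub] at h
  have h0 := orient_circle x y z
  apply Complex.ofReal_injective
  have h2 : (2 * Complex.I) ≠ 0 := by simp
  apply mul_right_cancel₀ h2
  rw [h]
  simp only [coe_smul_circle']
  conv_rhs => rw [Complex.ofReal_div, div_mul_eq_mul_div, h0]
  push_cast
  rw [← Complex.mul_conj, ← Complex.mul_conj, ← Complex.mul_conj]
  have hx' : conj (M.den x) ≠ 0 := by simpa using hx
  have hy' : conj (M.den y) ≠ 0 := by simpa using hy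
  have hz' : conj (M.den z) ≠ 0 := by simpa using hz
  have := x.coe_ne_zero
  have := y.coe_ne_zero
  have := z.coe_ne_zero
  field_simp

theorem orient_smul_pos (M : SU11) (x y z : Circle) :
    0 < orient (M • x : Circle) (M • y : Circle) (M • z : Circle) ↔ 0 < orient x y z := by
  have hx := Complex.normSq_pos.2 (M.den_circle_ne_zero x)
  have hy := Complex.normSq_pos.2 (M.den_circle_ne_zero y)
  have hz := Complex.normSq_pos.2 (M.den_circle_ne_zero z)
  rw [orient_smul]
  constructor
  · intro h
    by_contra h'
    exact absurd h (not_lt.2 (div_nonpos_of_nonpos_of_nonneg (not_lt.1 h') (by positivity)))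
  · intro h; positivity

/-- `M` is one of the matrices `1`, `-1`. -/
def IsCentral (M : SU11) : Prop := M.b = 0 ∧ conj M.a = M.a

theorem IsCentral.a_ne_zero {M : SU11} (h : M.IsCentral) : M.a ≠ 0 := by
  intro h0
  have := M.det
  rw [h0, h.1] at this
  simp at this

theorem IsCentral.mobius {M : SU11} (h : M.IsCentral) (z : ℂ) : M.mobius z = z := by
  have := h.a_ne_zero
  simp only [SU11.mobius, num, den, h.1, h.2]
  rw [map_zero, zero_mul, zero_add, add_zero, mul_div_cancel_left₀ _ this]

theorem IsCentral.smul_circle {M : SU11} (h : M.IsCentral) (z : Circle) : M • z = z :=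
  Circle.ext (h.mobius z)

theorem IsCentral.smul_disc {M : SU11} (h : M.IsCentral) (z : Complex.UnitDisc) : M • z = z :=
  Complex.UnitDisc.coe_injective (h.mobius z)

theorem isCentral_of_disc {M : SU11} (h : ∀ z : Complex.UnitDisc, M • z = z) : M.IsCentral := by
  have h0 := congrArg (fun z : Complex.UnitDisc => (z : ℂ)) (h 0)
  have ha := M.den_ne_zero (z := 0) (by simp)
  simp only [coe_smul_disc, SU11.mobius, num, den] at h0 ha
  simp at h0 ha
  have hb : M.b = 0 := by tauto
  refine ⟨hb, ?_⟩
  have hn : ‖(1 / 2 : ℂ)‖ < 1 := by norm_num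
  have h1 := congrArg (fun z : Complex.UnitDisc => (z : ℂ)) (h (Complex.UnitDisc.mk (1 / 2) hn))
  simp only [coe_smul_disc, SU11.mobius, num, den, hb] at h1
  have hca : conj M.a ≠ 0 := by simpa using ha
  simp at h1
  field_simp at h1
  exact h1.symm

/-- A fixed point is a root of a polynomial of degree at most two; three distinct roots make all its
coefficients vanish. -/
theorem isCentral_of_circle {M : SU11} {x y z : Circle} (hxy : x ≠ y) (hyz : y ≠ z) (hzx : z ≠ x)
    (hx : M • x = x) (hy : M • y = y) (hz : M • z = z) : M.IsCentral := by
  have key : ∀ t : Circle, M • t = t → conj M.b * t ^ 2 + (conj M.a - M.a) * t - M.b = 0 := by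
    intro t ht
    have h1 := congrArg (fun z : Circle => (z : ℂ)) ht
    have h2 := M.den_circle_ne_zero t
    simp only [coe_smul_circle, SU11.mobius] at h1
    rw [div_eq_iff h2] at h1
    simp only [num, den] at h1
    linear_combination -h1
  have kx := key x hx
  have ky := key y hy
  have kz := key z hz
  have dxy : (x : ℂ) - y ≠ 0 := sub_ne_zero.2 fun h => hxy (Circle.ext h)
  have dyz : (y : ℂ) - z ≠ 0 := sub_ne_zero.2 fun h => hyz (Circle.ext h)
  have dzx : (z : ℂ) - x ≠ 0 := sub_ne_zero.2 fun h => hzx (Circle.ext h)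
  have h1 : conj M.b * (x + y) + (conj M.a - M.a) = 0 := by
    apply mul_left_cancel₀ dxy; linear_combination kx - ky
  have h2 : conj M.b * (y + z) + (conj M.a - M.a) = 0 := by
    apply mul_left_cancel₀ dyz; linear_combination ky - kz
  have h3 : conj M.b = 0 := by
    apply mul_left_cancel₀ dzx; linear_combination h2 - h1
  have h4 : M.b = 0 := by simpa using h3
  refine ⟨h4, ?_⟩
  rw [h3] at h1
  linear_combination h1

theorem IsCentral.smul_tangent {M : SU11} (h : M.IsCentral) (v : UnitTangent) : M • v = v := by
  refine UnitTangent.ext (h.smul_disc _) ?_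
  have := h.a_ne_zero
  rw [UnitTangent.smul_dir]
  have e : M.den v.base = M.a := by simp [den, h.1, h.2]
  rw [e]
  apply Circle.ext
  rw [Circle.coe_mul, coe_conjDivSelf this, h.2]
  field_simp

end SU11

/-! ### Directions towards points at infinity -/

/-- The direction at `z` of the geodesic ray from `z` to the point `a` of the circle. -/
noncomputable def dirTo (z : Complex.UnitDisc) (a : Circle) : ℂ := ((a : ℂ) - z) / (1 - conj (z : ℂ) * a)

theorem Complex.UnitDisc.one_sub_conj_mul_ne_zero (z : Complex.UnitDisc) (a : Circle) :
    1 - conj (z : ℂ) * a ≠ 0 := by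
  intro h
  have h1 : conj (z : ℂ) * a = 1 := by linear_combination -h
  have h2 := congrArg norm h1
  rw [norm_mul, RCLike.norm_conj, Circle.norm_coe, norm_one] at h2
  linarith [z.norm_lt_one]

theorem Complex.UnitDisc.circle_sub_ne_zero (z : Complex.UnitDisc) (a : Circle) :
    (a : ℂ) - z ≠ 0 := by
  intro h
  have h2 := congrArg norm (sub_eq_zero.1 h)
  rw [Circle.norm_coe] at h2
  linarith [z.norm_lt_one]

theorem Complex.UnitDisc.normSq_lt_one' (z : Complex.UnitDisc) : Complex.normSq (z : ℂ) < 1 := by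
  rw [Complex.normSq_eq_norm_sq]
  nlinarith [z.norm_lt_one, norm_nonneg (z : ℂ)]

theorem one_sub_conj_mul (z : Complex.UnitDisc) (a : Circle) :
    1 - conj (z : ℂ) * a = a * conj ((a : ℂ) - z) := by
  have := a.coe_ne_zero
  simp only [map_sub, Circle.conj_coe_eq_inv]
  field_simp

theorem norm_dirTo (z : Complex.UnitDisc) (a : Circle) : ‖dirTo z a‖ = 1 := by
  rw [dirTo, one_sub_conj_mul, norm_div, norm_mul, RCLike.norm_conj, Circle.norm_coe, one_mul]
  exact div_self (norm_ne_zero_iff.2 (z.circle_sub_ne_zero a))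

theorem dirTo_ne_zero (z : Complex.UnitDisc) (a : Circle) : dirTo z a ≠ 0 := by
  rw [← norm_ne_zero_iff, norm_dirTo]; exact one_ne_zero

theorem dirTo_injective (z : Complex.UnitDisc) : Function.Injective (dirTo z) := by
  intro a b h
  apply Circle.ext
  rw [dirTo, dirTo, div_eq_div_iff (z.one_sub_conj_mul_ne_zero a)
    (z.one_sub_conj_mul_ne_zero b)] at h
  have h1 : ((a : ℂ) - b) * (1 - (z : ℂ) * conj (z : ℂ)) = 0 := by linear_combination h
  rw [Complex.mul_conj] at h1
  have h2 := z.normSq_lt_one'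
  have h3 : (1 : ℂ) - (Complex.normSq (z : ℂ) : ℝ) ≠ 0 := by
    rw [← Complex.ofReal_one, ← Complex.ofReal_sub, Complex.ofReal_ne_zero]
    linarith
  exact sub_eq_zero.1 ((mul_eq_zero.1 h1).resolve_right h3)

/-- The factor by which `M` turns directions at `z`. -/
noncomputable def SU11.turn (M : SU11) (z : Complex.UnitDisc) : ℂ := conj (M.den z) / M.den z

theorem SU11.norm_turn (M : SU11) (z : Complex.UnitDisc) : ‖M.turn z‖ = 1 := by
  have := M.den_ne_zero z.norm_lt_one.le
  rw [SU11.turn, norm_div, RCLike.norm_conj]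
  exact div_self (norm_ne_zero_iff.2 this)

theorem SU11.turn_mul (M N : SU11) (z : Complex.UnitDisc) :
    (M * N).turn z = M.turn (N • z) * N.turn z := by
  rw [turn, turn, turn, den_mul M N z.norm_lt_one.le, map_mul, coe_smul_disc]
  rw [div_mul_div_comm]

theorem SU11.IsCentral.turn {M : SU11} (h : M.IsCentral) (z : Complex.UnitDisc) :
    M.turn z = 1 := by
  have := h.a_ne_zero
  simp [SU11.turn, den, h.1, h.2, this]

theorem dirTo_smul (M : SU11) (z : Complex.UnitDisc) (a : Circle) :
    dirTo (M • z) (M • a) = M.turn z * dirTo z a := by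
  have h1 := M.den_ne_zero z.norm_lt_one.le
  have h2 := M.den_circle_ne_zero a
  have h1' : conj (M.den z) ≠ 0 := by simpa using h1
  have h3 := z.one_sub_conj_mul_ne_zero a
  have h4 := (M • z).one_sub_conj_mul_ne_zero (M • a)
  rw [dirTo, dirTo, SU11.turn, SU11.coe_smul_circle, SU11.coe_smul_disc, SU11.mobius, SU11.mobius] at *
  have e1 : M.num a / M.den a - M.num z / M.den z = (a - z) / (M.den a * M.den z) := by
    field_simp
    simp only [SU11.num, SU11.den]
    linear_combination ((a : ℂ) - z) * M.det'
  have e2 : 1 - conj (M.num z / M.den z) * (M.num a / M.den a) =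
      (1 - conj (z : ℂ) * a) / (conj (M.den z) * M.den a) := by
    rw [map_div₀]
    field_simp
    simp only [SU11.num, SU11.den, map_add, map_mul, Complex.conj_conj]
    linear_combination (1 - conj (z : ℂ) * a) * M.det'
  rw [e1, e2]
  field_simp

/-! ### The Klein model -/

theorem klein_den_pos (z : Complex.UnitDisc) : 0 < 1 + Complex.normSq (z : ℂ) := by
  linarith [Complex.normSq_nonneg (z : ℂ)]

/-- Links the two ways of measuring sides: up to a positive factor, `orient` at the Klein point is
the sine of the angle at `z` from the direction of `a` to that of `b`. -/
theorem orient_klein (a b : Circle) (z : Complex.UnitDisc) :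
    orient a b (klein z) = (conj (dirTo z a) * dirTo z b).im *
      (Complex.normSq ((a : ℂ) - z) * Complex.normSq ((b : ℂ) - z) /
        ((1 + Complex.normSq (z : ℂ)) * (1 - Complex.normSq (z : ℂ)))) := by
  have ha := a.coe_ne_zero
  have hb := b.coe_ne_zero
  have hz1 := klein_den_pos z
  have hz2 : 0 < 1 - Complex.normSq (z : ℂ) := by linarith [z.normSq_lt_one']
  have ha1 := z.circle_sub_ne_zero a
  have hb1 := z.circle_sub_ne_zero b
  have ha2 : conj ((a : ℂ) - z) ≠ 0 := (map_ne_zero _).2 ha1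
  have hb2 : conj ((b : ℂ) - z) ≠ 0 := (map_ne_zero _).2 hb1
  have key : ((1 + Complex.normSq (z : ℂ)) * (1 - Complex.normSq (z : ℂ))) *
      orient a b (klein z) = (conj (dirTo z a) * dirTo z b).im *
      (Complex.normSq ((a : ℂ) - z) * Complex.normSq ((b : ℂ) - z)) := by
    apply Complex.ofReal_injective
    have h2 : (2 * Complex.I) ≠ 0 := by simp
    apply mul_right_cancel₀ h2
    rw [orient]
    have hI : ∀ q : ℂ, (q.im : ℂ) * (2 * Complex.I) = q - conj q := by
      intro q; rw [Complex.sub_conj]; push_cast; ring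
    push_cast
    rw [mul_assoc, hI, mul_right_comm (b := _ * _), hI]
    rw [klein, dirTo, dirTo, one_sub_conj_mul, one_sub_conj_mul]
    push_cast
    have hz1' : (1 : ℂ) + (Complex.normSq (z : ℂ) : ℝ) ≠ 0 := by
      exact_mod_cast hz1.ne'
    simp only [← Complex.mul_conj] at hz1' ⊢
    simp only [map_mul, map_sub, map_div₀, Complex.conj_conj, map_add, map_one, map_ofNat,
      map_inv₀, inv_inv, Circle.conj_coe_eq_inv] at hz1' ha2 hb2 ⊢
    have hz3 : (1 : ℂ) + conj (z : ℂ) * z ≠ 0 := by rwa [mul_comm]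
    have ha4 := z.one_sub_conj_mul_ne_zero a
    have hb4 := z.one_sub_conj_mul_ne_zero b
    have ha5 : 1 - (a : ℂ) * conj (z : ℂ) ≠ 0 := by rwa [mul_comm]
    have hb5 : 1 - (b : ℂ) * conj (z : ℂ) ≠ 0 := by rwa [mul_comm]
    rw [mul_comm (conj (z : ℂ)) z]
    field_simp
    ring
  rw [← mul_div_assoc, eq_div_iff (by positivity)]
  linear_combination key

/-! ### Klein coordinates of a point -/

theorem norm_klein_lt_one (z : Complex.UnitDisc) : ‖klein z‖ < 1 := by
  have h0 := klein_den_pos z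
  rw [klein, norm_div, norm_mul, Complex.norm_real, Real.norm_of_nonneg h0.le, div_lt_one h0,
    Complex.norm_ofNat, Complex.normSq_eq_norm_sq]
  nlinarith [z.norm_lt_one, norm_nonneg (z : ℂ)]

theorem klein_injective : Function.Injective klein := by
  intro z z' h
  have h0 := klein_den_pos z
  have h0' := klein_den_pos z'
  have h1 := congrArg norm h
  simp only [klein, norm_div, norm_mul, Complex.norm_real, Real.norm_of_nonneg h0.le,
    Real.norm_of_nonneg h0'.le, Complex.norm_ofNat] at h1
  rw [div_eq_div_iff h0.ne' h0'.ne', Complex.normSq_eq_norm_sq, Complex.normSq_eq_norm_sq] at h1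
  have hz := z.norm_lt_one
  have hz' := z'.norm_lt_one
  have h2 : (‖(z : ℂ)‖ - ‖(z' : ℂ)‖) * (1 - ‖(z : ℂ)‖ * ‖(z' : ℂ)‖) = 0 := by linarith
  have h3 : 1 - ‖(z : ℂ)‖ * ‖(z' : ℂ)‖ ≠ 0 := by
    have := mul_le_mul hz.le hz'.le (norm_nonneg _) zero_le_one
    nlinarith [norm_nonneg (z : ℂ), norm_nonneg (z' : ℂ)]
  have h4 : ‖(z : ℂ)‖ = ‖(z' : ℂ)‖ := by
    have := (mul_eq_zero.1 h2).resolve_right h3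
    linarith
  simp only [klein, Complex.normSq_eq_norm_sq, h4] at h
  rw [Complex.normSq_eq_norm_sq] at h0'
  have h5 : ((1 + ‖(z' : ℂ)‖ ^ 2 : ℝ) : ℂ) ≠ 0 := Complex.ofReal_ne_zero.2 h0'.ne'
  rw [div_left_inj' h5] at h
  apply Complex.UnitDisc.coe_injective
  linear_combination h / 2

theorem exists_klein_eq {k : ℂ} (hk : ‖k‖ < 1) : ∃ z, klein z = k := by
  -- The inverse of the Klein map is `k ↦ k / (1 + √(1 - |k|²))`.
  set q := Real.sqrt (1 - ‖k‖ ^ 2) with hq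
  have hk0 := norm_nonneg k
  have hpos : 0 < 1 - ‖k‖ ^ 2 := by nlinarith
  have hq2 : q ^ 2 = 1 - ‖k‖ ^ 2 := Real.sq_sqrt hpos.le
  have hq0 : 0 < q := Real.sqrt_pos.2 hpos
  have hn : ‖k / ((1 + q : ℝ) : ℂ)‖ < 1 := by
    rw [norm_div, Complex.norm_real, Real.norm_of_nonneg (by positivity), div_lt_one (by positivity)]
    linarith
  refine ⟨Complex.UnitDisc.mk _ hn, ?_⟩
  have hq1 : ((1 + q : ℝ) : ℂ) ≠ 0 := Complex.ofReal_ne_zero.2 (by positivity)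
  have e : 1 + Complex.normSq (k / ((1 + q : ℝ) : ℂ)) = 2 / (1 + q) := by
    rw [Complex.normSq_div, Complex.normSq_ofReal, Complex.normSq_eq_norm_sq]
    have : (1 + q) ≠ 0 := by positivity
    field_simp
    nlinarith
  rw [klein, Complex.UnitDisc.coe_mk, e]
  push_cast at hq1 ⊢
  field_simp

namespace UnitTangent

/-! ### The flow and its endpoints -/

theorem flow_zero (v : UnitTangent) : flow 0 v = v := by
  have h : v.flowDen 0 = 1 := by simp [flowDen]
  apply UnitTangent.ext
  · apply Complex.UnitDisc.coe_injective
    change v.flowPoint 0 = v.base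
    rw [flowPoint, h]
    simp
  · change conjDivSelf (v.flowDen 0) * v.dir = v.dir
    rw [h]
    apply Circle.ext
    simp [coe_conjDivSelf one_ne_zero]

theorem tanh_half_add (s t : ℝ) : Real.tanh ((s + t) / 2) *
    (1 + Real.tanh (s / 2) * Real.tanh (t / 2)) = Real.tanh (s / 2) + Real.tanh (t / 2) := by
  have e : (s + t) / 2 = s / 2 + t / 2 := by ring
  have h1 := (Real.cosh_pos (s / 2)).ne'
  have h2 := (Real.cosh_pos (t / 2)).ne'
  have h3 := (Real.cosh_pos (s / 2 + t / 2)).ne'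
  rw [e, Real.tanh_eq_sinh_div_cosh, Real.tanh_eq_sinh_div_cosh, Real.tanh_eq_sinh_div_cosh]
  generalize s / 2 = x at *
  generalize t / 2 = y at *
  field_simp
  rw [Real.sinh_add, Real.cosh_add]
  ring

theorem conj_dir (v : UnitTangent) : conj (v.dir : ℂ) = (v.dir : ℂ)⁻¹ :=
  Circle.conj_coe_eq_inv _

theorem flow_add (s t : ℝ) (v : UnitTangent) : flow t (flow s v) = flow (s + t) v := by
  have hS := v.flowDen_ne_zero s
  have hST := v.flowDen_ne_zero (s + t)
  have hT := (flow s v).flowDen_ne_zero t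
  have hd := v.dir.coe_ne_zero
  have hS' : conj (v.flowDen s) ≠ 0 := (map_ne_zero _).2 hS
  have key := tanh_half_add s t
  have key' : (Real.tanh ((s + t) / 2) : ℂ) *
    (1 + Real.tanh (s / 2) * Real.tanh (t / 2)) = Real.tanh (s / 2) + Real.tanh (t / 2) := by
    exact_mod_cast key
  have hpos : (0 : ℝ) < 1 + Real.tanh (s / 2) * Real.tanh (t / 2) := by
    have h1 := abs_lt.1 (abs_tanh_lt_one (s / 2))
    have h2 := abs_lt.1 (abs_tanh_lt_one (t / 2))
    nlinarith
  have hpos' : (1 + Real.tanh (s / 2) * Real.tanh (t / 2) : ℂ) ≠ 0 := by exact_mod_cast hpos.ne'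
  have e0 : v.flowPoint s * v.flowDen s = (v.dir : ℂ) * (Real.tanh (s / 2) : ℝ) + v.base := by
    rw [flowPoint]; field_simp
  have cS : conj (v.flowDen s) = 1 + (v.base : ℂ) * ((v.dir : ℂ)⁻¹ * (Real.tanh (s / 2) : ℝ)) := by
    simp only [flowDen, map_add, map_mul, map_one, Complex.conj_conj, Complex.conj_ofReal, conj_dir]
  have e0' := congrArg (starRingEnd ℂ) e0
  simp only [map_mul, map_add, Complex.conj_ofReal, conj_dir] at e0'
  have e1 : (flow s v).flowDen t * v.flowDen s =
      (1 + Real.tanh (s / 2) * Real.tanh (t / 2)) * v.flowDen (s + t) := by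
    have : (flow s v).flowDen t = 1 + conj (v.flowPoint s) *
      ((conj (v.flowDen s) / v.flowDen s * (v.dir : ℂ)) * (Real.tanh (t / 2) : ℝ)) := by
      rw [flowDen]
      change 1 + conj (v.flowPoint s) * (((conjDivSelf (v.flowDen s) * v.dir : Circle) : ℂ) * _) = _
      rw [Circle.coe_mul, coe_conjDivSelf hS]
    have e2 : (flow s v).flowDen t * v.flowDen s = v.flowDen s +
        (conj (v.flowPoint s) * conj (v.flowDen s)) * (v.dir * (Real.tanh (t / 2) : ℝ)) := by
      rw [this]; field_simp
    rw [e2, e0', flowDen, flowDen]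
    field_simp
    linear_combination (-conj (v.base : ℂ) * (v.dir : ℂ)) * key'
  apply UnitTangent.ext
  · apply Complex.UnitDisc.coe_injective
    change (flow s v).flowPoint t = v.flowPoint (s + t)
    rw [flowPoint, flowPoint, div_eq_div_iff hT hST]
    apply mul_right_cancel₀ hS
    have : (((flow s v).dir : ℂ) * (Real.tanh (t / 2) : ℝ) + (flow s v).base) * v.flowDen s =
        (1 + Real.tanh (s / 2) * Real.tanh (t / 2)) *
          ((v.dir : ℂ) * (Real.tanh ((s + t) / 2) : ℝ) + v.base) := by
      change (((conjDivSelf (v.flowDen s) * v.dir : Circle) : ℂ) * _ + v.flowPoint s) * _ = _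
      rw [Circle.coe_mul, coe_conjDivSelf hS, add_mul, e0]
      field_simp
      rw [cS]
      field_simp
      linear_combination (-(v.dir : ℂ)) * key'
    linear_combination v.flowDen (s + t) * this -
      ((v.dir : ℂ) * (Real.tanh ((s + t) / 2) : ℝ) + v.base) * e1
  · change conjDivSelf ((flow s v).flowDen t) * (conjDivSelf (v.flowDen s) * v.dir) =
      conjDivSelf (v.flowDen (s + t)) * v.dir
    have e1' := congrArg (starRingEnd ℂ) e1
    simp only [map_mul, map_add, map_one, Complex.conj_ofReal] at e1'
    apply Circle.ext
    simp only [Circle.coe_mul]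
    rw [coe_conjDivSelf hS, coe_conjDivSelf hT, coe_conjDivSelf hST]
    have : conj ((flow s v).flowDen t) / (flow s v).flowDen t *
        (conj (v.flowDen s) / v.flowDen s) = conj (v.flowDen (s + t)) / v.flowDen (s + t) := by
      rw [div_mul_div_comm, e1, e1']
      field_simp
    linear_combination (v.dir : ℂ) * this

theorem one_add_conj_mul_ne_zero (v : UnitTangent) : 1 + conj (v.base : ℂ) * v.dir ≠ 0 := by
  intro h
  have h1 : conj (v.base : ℂ) * v.dir = -1 := by linear_combination h
  have h2 := congrArg norm h1
  rw [norm_mul, RCLike.norm_conj, Circle.norm_coe, norm_neg, norm_one] at h2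
  linarith [v.base.norm_lt_one]

theorem norm_endpoint (z : Complex.UnitDisc) (d : ℂ) (hd : ‖d‖ = 1) :
    ‖((z : ℂ) + d) / (1 + conj (z : ℂ) * d)‖ = 1 := by
  have hd0 : d ≠ 0 := by rw [← norm_ne_zero_iff, hd]; exact one_ne_zero
  have hdd : d * conj d = 1 := by rw [Complex.mul_conj, Complex.normSq_eq_norm_sq, hd]; simp
  have e : 1 + conj (z : ℂ) * d = d * conj ((z : ℂ) + d) := by
    rw [map_add]; linear_combination -hdd
  have hne : (z : ℂ) + d ≠ 0 := by
    intro h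
    have := congrArg norm (eq_neg_of_add_eq_zero_left h)
    rw [norm_neg, hd] at this
    linarith [z.norm_lt_one]
  rw [e, norm_div, norm_mul, hd, RCLike.norm_conj, one_mul]
  exact div_self (norm_ne_zero_iff.2 hne)

/-- The endpoint at infinity of the geodesic through `v`. -/
noncomputable def fwd (v : UnitTangent) : Circle :=
  ⟨((v.base : ℂ) + v.dir) / (1 + conj (v.base : ℂ) * v.dir),
    mem_sphere_zero_iff_norm.2 (norm_endpoint v.base v.dir v.dir.norm_coe)⟩

/-- The starting point at infinity of the geodesic through `v`. -/
noncomputable def bwd (v : UnitTangent) : Circle :=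
  ⟨((v.base : ℂ) + -v.dir) / (1 + conj (v.base : ℂ) * -v.dir),
    mem_sphere_zero_iff_norm.2 (norm_endpoint v.base (-v.dir) (by rw [norm_neg, Circle.norm_coe]))⟩

theorem coe_fwd (v : UnitTangent) :
    (v.fwd : ℂ) = ((v.base : ℂ) + v.dir) / (1 + conj (v.base : ℂ) * v.dir) := rfl

theorem coe_bwd (v : UnitTangent) :
    (v.bwd : ℂ) = ((v.base : ℂ) + -v.dir) / (1 + conj (v.base : ℂ) * -v.dir) := rfl

theorem one_sub_conj_mul_dir_ne_zero (v : UnitTangent) : 1 - conj (v.base : ℂ) * v.dir ≠ 0 :=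
  v.base.one_sub_conj_mul_ne_zero v.dir

/-- The map from directions at `z` to endpoints at infinity is a Möbius transformation with inverse
`dirTo z`, so tangency to `uw` becomes a condition on directions at one point. -/
theorem eq_endpoint_iff (z : Complex.UnitDisc) (a : Circle) {d : ℂ}
    (hd : 1 + conj (z : ℂ) * d ≠ 0) :
    (a : ℂ) = ((z : ℂ) + d) / (1 + conj (z : ℂ) * d) ↔ d = dirTo z a := by
  rw [dirTo, eq_div_iff hd, eq_div_iff (z.one_sub_conj_mul_ne_zero a)]
  constructor <;> intro h <;> linear_combination -h

theorem fwd_eq_iff (v : UnitTangent) (w : Circle) :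
    v.fwd = w ↔ (v.dir : ℂ) = dirTo v.base w := by
  rw [← eq_endpoint_iff _ _ v.one_add_conj_mul_ne_zero, ← coe_fwd, eq_comm, Circle.ext_iff]

theorem bwd_eq_iff (v : UnitTangent) (u : Circle) :
    v.bwd = u ↔ -(v.dir : ℂ) = dirTo v.base u := by
  rw [← eq_endpoint_iff, ← coe_bwd, eq_comm, Circle.ext_iff]
  rw [mul_neg, ← sub_eq_add_neg]
  exact v.one_sub_conj_mul_dir_ne_zero

theorem bwd_ne_fwd (v : UnitTangent) : v.bwd ≠ v.fwd := by
  intro h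
  have h1 := (v.fwd_eq_iff _).1 rfl
  have h2 := (v.bwd_eq_iff _).1 rfl
  rw [h, ← h1] at h2
  have : (v.dir : ℂ) = 0 := by linear_combination (-1 / 2 : ℂ) * h2
  exact v.dir.coe_ne_zero this

theorem tendsto_tanh_atTop : Tendsto Real.tanh atTop (𝓝 1) := by
  have h : Real.tanh = fun x => 1 - 2 / (Real.exp (2 * x) + 1) := by
    funext x
    have := Real.exp_pos x
    rw [Real.tanh_eq, Real.exp_neg, two_mul, Real.exp_add]
    field_simp
    ring
  rw [h]
  have h1 : Tendsto (fun x : ℝ => Real.exp (2 * x) + 1) atTop atTop :=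
    tendsto_atTop_add_const_right _ _
      (Real.tendsto_exp_atTop.comp (tendsto_id.const_mul_atTop two_pos))
  simpa using (tendsto_const_nhds (x := (1 : ℝ))).sub (h1.const_div_atTop 2)

theorem tendsto_tanh_atBot : Tendsto Real.tanh atBot (𝓝 (-1)) := by
  have h := (tendsto_tanh_atTop.comp tendsto_neg_atBot_atTop).neg
  refine h.congr fun x => ?_
  simp [Real.tanh_neg]

theorem tendsto_flow_aux (v : UnitTangent) {l : Filter ℝ} {c : ℝ}
    (hl : Tendsto (fun t : ℝ => Real.tanh (t / 2)) l (𝓝 c))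
    (hc : 1 + conj (v.base : ℂ) * ((v.dir : ℂ) * (c : ℂ)) ≠ 0) :
    Tendsto (fun t : ℝ => ((flow t v).base : ℂ)) l
      (𝓝 (((v.dir : ℂ) * (c : ℂ) + v.base) / (1 + conj (v.base : ℂ) * ((v.dir : ℂ) * (c : ℂ))))) := by
  have h1 : Tendsto (fun t : ℝ => (v.dir : ℂ) * ((Real.tanh (t / 2) : ℝ) : ℂ)) l
      (𝓝 ((v.dir : ℂ) * (c : ℂ))) :=
    ((Complex.continuous_ofReal.tendsto c).comp hl).const_mul _
  exact (h1.add_const _).div ((h1.const_mul _).const_add _) hc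

theorem tendsto_fwd (v : UnitTangent) :
    Tendsto (fun t : ℝ => ((flow t v).base : ℂ)) atTop (𝓝 (v.fwd : ℂ)) := by
  have := v.tendsto_flow_aux (c := 1)
    (tendsto_tanh_atTop.comp (tendsto_id.atTop_div_const two_pos))
    (by simpa using v.one_add_conj_mul_ne_zero)
  rw [coe_fwd]
  simpa [add_comm] using this

theorem tendsto_bwd (v : UnitTangent) :
    Tendsto (fun t : ℝ => ((flow t v).base : ℂ)) atBot (𝓝 (v.bwd : ℂ)) := by
  have := v.tendsto_flow_aux (c := -1)
    (tendsto_tanh_atBot.comp (tendsto_id.atBot_div_const two_pos))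
    (by simpa [sub_eq_add_neg] using v.one_sub_conj_mul_dir_ne_zero)
  rw [coe_bwd]
  simpa [add_comm] using this

theorem joins_iff (v : UnitTangent) (u w : Circle) : v.Joins u w ↔ v.bwd = u ∧ v.fwd = w := by
  constructor
  · rintro ⟨h1, h2⟩
    exact ⟨Circle.ext (tendsto_nhds_unique v.tendsto_bwd h1),
      Circle.ext (tendsto_nhds_unique v.tendsto_fwd h2)⟩
  · rintro ⟨rfl, rfl⟩
    exact ⟨v.tendsto_bwd, v.tendsto_fwd⟩

theorem joins_self (v : UnitTangent) : v.Joins v.bwd v.fwd := ⟨v.tendsto_bwd, v.tendsto_fwd⟩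

theorem fwd_flow (v : UnitTangent) (s : ℝ) : (flow s v).fwd = v.fwd := by
  apply Circle.ext
  refine tendsto_nhds_unique (flow s v).tendsto_fwd ?_
  simp only [flow_add]
  exact v.tendsto_fwd.comp (tendsto_atTop_add_const_left _ s tendsto_id)

theorem bwd_flow (v : UnitTangent) (s : ℝ) : (flow s v).bwd = v.bwd := by
  apply Circle.ext
  refine tendsto_nhds_unique (flow s v).tendsto_bwd ?_
  simp only [flow_add]
  exact v.tendsto_bwd.comp (tendsto_atBot_add_const_left _ s tendsto_id)

theorem smul_dir_coe (M : SU11) (v : UnitTangent) :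
    ((M • v).dir : ℂ) = M.turn v.base * v.dir := by
  rw [smul_dir, Circle.coe_mul, coe_conjDivSelf (M.den_ne_zero v.base.norm_lt_one.le), SU11.turn]

theorem fwd_smul (M : SU11) (v : UnitTangent) : (M • v).fwd = M • v.fwd := by
  rw [fwd_eq_iff, smul_base, dirTo_smul, smul_dir_coe, ← (v.fwd_eq_iff _).1 rfl]

theorem bwd_smul (M : SU11) (v : UnitTangent) : (M • v).bwd = M • v.bwd := by
  rw [bwd_eq_iff, smul_base, dirTo_smul, smul_dir_coe, ← (v.bwd_eq_iff _).1 rfl]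
  ring

/-! ### The flow in the Klein model -/

/-- The parameter of the point at time `t` on the chord from `v.bwd` to `v.fwd`: the point is
`(v.bwd + s v.fwd) / (1 + s)`. -/
noncomputable def ratio (v : UnitTangent) (t : ℝ) : ℝ :=
  Complex.normSq (1 + conj (v.base : ℂ) * v.dir) / Complex.normSq (1 - conj (v.base : ℂ) * v.dir) *
    Real.exp (2 * t)

theorem ratio_const_pos (v : UnitTangent) : 0 < Complex.normSq (1 + conj (v.base : ℂ) * v.dir) /
    Complex.normSq (1 - conj (v.base : ℂ) * v.dir) :=
  div_pos (Complex.normSq_pos.2 v.one_add_conj_mul_ne_zero)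
    (Complex.normSq_pos.2 v.one_sub_conj_mul_dir_ne_zero)

theorem ratio_pos (v : UnitTangent) (t : ℝ) : 0 < v.ratio t :=
  mul_pos v.ratio_const_pos (Real.exp_pos _)

theorem ratio_strictMono (v : UnitTangent) : StrictMono v.ratio := by
  intro s t h
  exact mul_lt_mul_of_pos_left (Real.exp_lt_exp.2 (by linarith)) v.ratio_const_pos

theorem exists_ratio_eq (v : UnitTangent) {s : ℝ} (hs : 0 < s) : ∃ t, v.ratio t = s := by
  have hc := v.ratio_const_pos
  refine ⟨Real.log (s / (Complex.normSq (1 + conj (v.base : ℂ) * v.dir) /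
    Complex.normSq (1 - conj (v.base : ℂ) * v.dir))) / 2, ?_⟩
  rw [ratio, mul_div_cancel₀ _ two_ne_zero, Real.exp_log (by positivity), mul_div_cancel₀ _ hc.ne']

/-- The square of `exp t = (1 + tanh (t / 2)) / (1 - tanh (t / 2))`. -/
theorem exp_two_mul_eq (t : ℝ) :
    Real.exp (2 * t) = (1 + Real.tanh (t / 2)) ^ 2 / (1 - Real.tanh (t / 2)) ^ 2 := by
  have h1 := abs_lt.1 (abs_tanh_lt_one (t / 2))
  have h2 : (1 - Real.tanh (t / 2)) ≠ 0 := by linarith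
  have h3 : Real.exp (t / 2) ^ 2 * (1 - Real.tanh (t / 2)) = 1 + Real.tanh (t / 2) := by
    have := Real.exp_pos (t / 2)
    rw [Real.tanh_eq, Real.exp_neg]
    field_simp
    ring
  rw [eq_div_iff (pow_ne_zero 2 h2), ← h3, mul_pow, ← pow_mul, ← Real.exp_nat_mul]
  congr 2
  push_cast
  ring

/-- The algebra behind `klein_flow`, with `w` in place of the conjugate of `z`, `d⁻¹` in place of
the conjugate of `d`, and `T = tanh (t / 2)`. -/
theorem klein_flow_aux {z w d T : ℂ} (hd : d ≠ 0) (hT : 1 - T ≠ 0) (hp : 1 + w * d ≠ 0)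
    (hm : 1 - w * d ≠ 0) (hp' : 1 + z * d⁻¹ ≠ 0) (hm' : 1 - z * d⁻¹ ≠ 0)
    (hD : 1 + w * (d * T) ≠ 0) (hD' : 1 + z * (d⁻¹ * T) ≠ 0)
    (hy : 1 + (d * T + z) / (1 + w * (d * T)) * ((d⁻¹ * T + w) / (1 + z * (d⁻¹ * T))) ≠ 0)
    (hr : 1 + (1 + w * d) * (1 + z * d⁻¹) / ((1 - w * d) * (1 - z * d⁻¹)) *
      ((1 + T) ^ 2 / (1 - T) ^ 2) ≠ 0) :
    2 * ((d * T + z) / (1 + w * (d * T))) /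
      (1 + (d * T + z) / (1 + w * (d * T)) * ((d⁻¹ * T + w) / (1 + z * (d⁻¹ * T)))) =
    1 / (1 + (1 + w * d) * (1 + z * d⁻¹) / ((1 - w * d) * (1 - z * d⁻¹)) *
      ((1 + T) ^ 2 / (1 - T) ^ 2)) * ((z + -d) / (1 + w * -d)) +
    (1 + w * d) * (1 + z * d⁻¹) / ((1 - w * d) * (1 - z * d⁻¹)) *
      ((1 + T) ^ 2 / (1 - T) ^ 2) / (1 + (1 + w * d) * (1 + z * d⁻¹) /
      ((1 - w * d) * (1 - z * d⁻¹)) * ((1 + T) ^ 2 / (1 - T) ^ 2)) * ((z + d) / (1 + w * d)) := by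
  have e1 : 1 + w * -d = 1 - w * d := by ring
  have q1 : d + z ≠ 0 := by
    intro h; apply hp'; field_simp; rw [h, mul_zero]
  have q2 : d - z ≠ 0 := by
    intro h; apply hm'; field_simp; rw [h, mul_zero]
  have q3 : d + z * T ≠ 0 := by
    intro h; apply hD'; field_simp; rw [h, mul_zero]
  rw [e1]
  have i1 : 1 + z * d⁻¹ = (d + z) / d := by field_simp
  have i2 : 1 - z * d⁻¹ = (d - z) / d := by field_simp
  have i3 : 1 + z * (d⁻¹ * T) = (d + z * T) / d := by field_simp
  have i4 : d⁻¹ * T + w = (T + w * d) / d := by field_simp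
  rw [i1, i2] at hr ⊢
  rw [i3, i4] at hy ⊢
  obtain ⟨p, hpd⟩ : ∃ p, p = 1 + w * d := ⟨_, rfl⟩
  obtain ⟨m, hmd⟩ : ∃ m, m = 1 - w * d := ⟨_, rfl⟩
  obtain ⟨P, hPd⟩ : ∃ P, P = d + z := ⟨_, rfl⟩
  obtain ⟨M, hMd⟩ : ∃ M, M = d - z := ⟨_, rfl⟩
  obtain ⟨D, hDd⟩ : ∃ D, D = 1 + w * (d * T) := ⟨_, rfl⟩
  obtain ⟨E, hEd⟩ : ∃ E, E = d + z * T := ⟨_, rfl⟩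
  obtain ⟨S, hSd⟩ : ∃ S, S = 1 - T := ⟨_, rfl⟩
  rw [← hpd, ← hmd, ← hPd, ← hMd, ← hSd] at hr ⊢
  rw [← hDd, ← hEd] at hy ⊢
  rw [← hpd] at hp
  rw [← hmd] at hm
  rw [← hPd] at q1
  rw [← hMd] at q2
  rw [← hEd] at q3
  rw [← hDd] at hD
  rw [← hSd] at hT
  -- Both nontrivial denominators are multiples of `N`: that of the Klein point is `N / (D E)`, and
  -- one plus the ratio is `2 N / (m M S²)`.
  obtain ⟨N, hNd⟩ : ∃ N, N = D * E + (d * T + z) * (T + w * d) := ⟨_, rfl⟩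
  have l2 : m * M * S ^ 2 + p * P * (1 + T) ^ 2 = 2 * N := by
    rw [hNd, hpd, hmd, hPd, hMd, hDd, hEd, hSd]; ring
  have j1 : 1 + (d * T + z) / D * ((T + w * d) / d / (E / d)) = N / (D * E) := by
    rw [hNd]; field_simp
  have j2 : p * (P / d) / (m * (M / d)) * ((1 + T) ^ 2 / S ^ 2) =
      p * P * (1 + T) ^ 2 / (m * M * S ^ 2) := by field_simp
  have j3 : 1 + p * (P / d) / (m * (M / d)) * ((1 + T) ^ 2 / S ^ 2) = 2 * N / (m * M * S ^ 2) := by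
    rw [j2, ← l2]; field_simp
  rw [j1] at hy ⊢
  rw [j3] at hr
  rw [j3, j2]
  have n1 : N ≠ 0 := by
    intro h; apply hy; rw [h, zero_div]
  field_simp
  rw [hPd, hMd, hEd, hSd]
  ring

/-- The flow line is the chord from `v.bwd` to `v.fwd`. The ratio in which the point divides the
chord grows like `exp (2 * t)`, since hyperbolic distance is half the logarithm of the Klein
cross-ratio. -/
theorem klein_flow (v : UnitTangent) (t : ℝ) :
    klein (flow t v).base = ((1 / (1 + v.ratio t) : ℝ) : ℂ) * v.bwd +
      ((v.ratio t / (1 + v.ratio t) : ℝ) : ℂ) * v.fwd := by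
  have hr := v.ratio_pos t
  have h1 := abs_lt.1 (abs_tanh_lt_one (t / 2))
  have hk := klein_den_pos (flow t v).base
  have hr1 : (1 : ℂ) + (v.ratio t : ℝ) ≠ 0 := by exact_mod_cast (by positivity : 1 + v.ratio t ≠ 0)
  have hk1 : (1 : ℂ) + ((flow t v).base : ℂ) * conj ((flow t v).base : ℂ) ≠ 0 := by
    rw [Complex.mul_conj]; exact_mod_cast hk.ne'
  have hT : (1 : ℂ) - (Real.tanh (t / 2) : ℝ) ≠ 0 := by
    exact_mod_cast (by linarith : (1 : ℝ) - Real.tanh (t / 2) ≠ 0)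
  have hp := v.one_add_conj_mul_ne_zero
  have hm := v.one_sub_conj_mul_dir_ne_zero
  have hp' : conj (1 + conj (v.base : ℂ) * v.dir) ≠ 0 := (map_ne_zero _).2 hp
  have hm' : conj (1 - conj (v.base : ℂ) * v.dir) ≠ 0 := (map_ne_zero _).2 hm
  have hD : (1 + conj (v.base : ℂ) * ((v.dir : ℂ) * (Real.tanh (t / 2) : ℝ))) ≠ 0 :=
    v.flowDen_ne_zero t
  have hD' : conj (1 + conj (v.base : ℂ) * ((v.dir : ℂ) * (Real.tanh (t / 2) : ℝ))) ≠ 0 :=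
    (map_ne_zero _).2 hD
  have er : ((v.ratio t : ℝ) : ℂ) = (1 + conj (v.base : ℂ) * v.dir) *
      conj (1 + conj (v.base : ℂ) * v.dir) / ((1 - conj (v.base : ℂ) * v.dir) *
      conj (1 - conj (v.base : ℂ) * v.dir)) * ((1 + (Real.tanh (t / 2) : ℝ)) ^ 2 /
      (1 - (Real.tanh (t / 2) : ℝ)) ^ 2) := by
    rw [ratio, exp_two_mul_eq, Complex.mul_conj, Complex.mul_conj]
    simp only [Complex.ofReal_mul, Complex.ofReal_div, Complex.ofReal_pow, Complex.ofReal_add,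
      Complex.ofReal_sub, Complex.ofReal_one]
  have hb : ((flow t v).base : ℂ) = ((v.dir : ℂ) * (Real.tanh (t / 2) : ℝ) + v.base) /
      (1 + conj (v.base : ℂ) * ((v.dir : ℂ) * (Real.tanh (t / 2) : ℝ))) := rfl
  rw [klein]
  simp only [Complex.ofReal_div, Complex.ofReal_add, Complex.ofReal_one]
  rw [← Complex.mul_conj, coe_fwd, coe_bwd]
  rw [er] at hr1 ⊢
  rw [hb] at hk1 ⊢
  simp only [map_add, map_sub, map_mul, map_div₀, map_one, Complex.conj_conj, Complex.conj_ofReal,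
    conj_dir] at *
  exact klein_flow_aux v.dir.coe_ne_zero hT hp hm hp' hm' hD hD' hk1 hr1

theorem klein_base (v : UnitTangent) :
    klein v.base = ((1 / (1 + v.ratio 0) : ℝ) : ℂ) * v.bwd +
      ((v.ratio 0 / (1 + v.ratio 0) : ℝ) : ℂ) * v.fwd := by
  have := v.klein_flow 0
  rwa [flow_zero] at this

/-- The sign of the numerator, linear in `v.ratio t`, decides on which side of `ab` the geodesic is
at time `t`; all later crossing arguments rest on this. -/
theorem orient_flow (a b : ℂ) (v : UnitTangent) (t : ℝ) :
    orient a b (klein (flow t v).base) =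
      (orient a b v.bwd + v.ratio t * orient a b v.fwd) / (1 + v.ratio t) := by
  have hr := v.ratio_pos t
  rw [klein_flow, orient_combo _ _ _ _ (by field_simp)]
  field_simp

theorem flow_mem_leftHalfPlane (a b : Circle) (v : UnitTangent) (t : ℝ) :
    (flow t v).base ∈ leftHalfPlane a b ↔
      0 ≤ orient a b v.bwd + v.ratio t * orient a b v.fwd := by
  have hr := v.ratio_pos t
  have h : (0 : ℝ) < 1 + v.ratio t := by positivity
  rw [leftHalfPlane, Set.mem_ofPred_eq, orient_flow, le_div_iff₀ h, zero_mul]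

theorem orient_flow_pos (a b : Circle) (v : UnitTangent) (t : ℝ) :
    0 < orient a b (klein (flow t v).base) ↔
      0 < orient a b v.bwd + v.ratio t * orient a b v.fwd := by
  have hr := v.ratio_pos t
  have h : (0 : ℝ) < 1 + v.ratio t := by positivity
  rw [orient_flow, lt_div_iff₀ h, zero_mul]

theorem orient_flow_eq_zero (a b : Circle) (v : UnitTangent) (t : ℝ) :
    orient a b (klein (flow t v).base) = 0 ↔
      orient a b v.bwd + v.ratio t * orient a b v.fwd = 0 := by
  have hr := v.ratio_pos t
  have h : (1 + v.ratio t) ≠ 0 := by positivity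
  rw [orient_flow, div_eq_zero_iff, or_iff_left h]

/-- If the directions from `z` to `u` and to `w` are opposite, there is a geodesic through `z`. -/
theorem exists_joins_of_dirTo {z : Complex.UnitDisc} {u w : Circle} (h : dirTo z u = -dirTo z w) :
    ∃ v : UnitTangent, v.base = z ∧ v.Joins u w := by
  refine ⟨⟨z, ⟨dirTo z w, mem_sphere_zero_iff_norm.2 (norm_dirTo z w)⟩⟩, rfl, ?_⟩
  rw [joins_iff, bwd_eq_iff, fwd_eq_iff]
  exact ⟨h.symm, rfl⟩

end UnitTangent

/-- Points are on a common geodesic with `u` and `w` exactly if the directions to `u` and `w` are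
proportional. -/
theorem orient_klein_eq_zero_iff {a b : Circle} (hab : a ≠ b) (z : Complex.UnitDisc) :
    orient a b (klein z) = 0 ↔ dirTo z a = -dirTo z b := by
  have h1 : 0 < Complex.normSq ((a : ℂ) - z) := Complex.normSq_pos.2 (z.circle_sub_ne_zero a)
  have h2 : 0 < Complex.normSq ((b : ℂ) - z) := Complex.normSq_pos.2 (z.circle_sub_ne_zero b)
  have h3 := klein_den_pos z
  have h4 := z.normSq_lt_one'
  have h5 : 0 < 1 - Complex.normSq (z : ℂ) := by linarith
  rw [orient_klein, mul_eq_zero, or_iff_left (by positivity)]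
  have na : dirTo z a * conj (dirTo z a) = 1 := by
    rw [Complex.mul_conj, Complex.normSq_eq_norm_sq, norm_dirTo]; simp
  have nb : dirTo z b * conj (dirTo z b) = 1 := by
    rw [Complex.mul_conj, Complex.normSq_eq_norm_sq, norm_dirTo]; simp
  constructor
  · intro h
    have hc := Complex.conj_eq_iff_im.2 h
    simp only [map_mul, Complex.conj_conj] at hc
    have h6 : (dirTo z a - dirTo z b) * (dirTo z a + dirTo z b) = 0 := by
      linear_combination dirTo z a * dirTo z b * hc + dirTo z b ^ 2 * na - dirTo z a ^ 2 * nb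
    rcases mul_eq_zero.1 h6 with h7 | h7
    · exact absurd (dirTo_injective z (sub_eq_zero.1 h7)) hab
    · linear_combination h7
  · intro h
    rw [← Complex.conj_eq_iff_im, h]
    simp only [map_mul, map_neg, Complex.conj_conj]
    ring

theorem mem_geodesicLine_iff {u w : Circle} {z : Complex.UnitDisc} :
    z ∈ geodesicLine u w ↔ u ≠ w ∧ orient u w (klein z) = 0 := by
  constructor
  · rintro ⟨v, rfl, h⟩
    obtain ⟨rfl, rfl⟩ := (v.joins_iff _ _).1 h
    refine ⟨v.bwd_ne_fwd, ?_⟩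
    rw [orient_klein_eq_zero_iff v.bwd_ne_fwd, ← (v.bwd_eq_iff _).1 rfl, ← (v.fwd_eq_iff _).1 rfl]
  · rintro ⟨h, h0⟩
    exact exists_joins_of_dirTo ((orient_klein_eq_zero_iff h z).1 h0)

/-- Two vectors tangent to the same oriented geodesic differ by the flow. -/
theorem UnitTangent.Joins.exists_flow_eq {v v' : UnitTangent} {u w : Circle} (h : v.Joins u w)
    (h' : v'.Joins u w) : ∃ t, v' = flow t v := by
  obtain ⟨rfl, rfl⟩ := (v.joins_iff _ _).1 h
  obtain ⟨hb, hf⟩ := (v'.joins_iff _ _).1 h'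
  obtain ⟨t, ht⟩ := v.exists_ratio_eq (v'.ratio_pos 0)
  refine ⟨t, ?_⟩
  have hbase : v'.base = (flow t v).base := by
    apply klein_injective
    rw [klein_base, klein_flow, hb, hf, ht]
  refine UnitTangent.ext hbase (Circle.ext ?_)
  rw [(v'.fwd_eq_iff _).1 hf, hbase]
  exact (((flow t v).fwd_eq_iff _).1 (v.fwd_flow t)).symm

theorem UnitTangent.Joins.flow {v : UnitTangent} {u w : Circle} (h : v.Joins u w) (t : ℝ) :
    (flow t v).Joins u w := by
  rw [joins_iff] at h ⊢
  rwa [fwd_flow, bwd_flow]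

theorem UnitTangent.Joins.smul {v : UnitTangent} {u w : Circle} (h : v.Joins u w) (M : SU11) :
    (M • v).Joins (M • u) (M • w) := by
  rw [joins_iff] at h ⊢
  rw [fwd_smul, bwd_smul, h.1, h.2]
  exact ⟨rfl, rfl⟩

theorem UnitTangent.Joins.ne {v : UnitTangent} {u w : Circle} (h : v.Joins u w) : u ≠ w := by
  obtain ⟨rfl, rfl⟩ := (v.joins_iff _ _).1 h
  exact v.bwd_ne_fwd

theorem UnitTangent.Joins.base_mem {v : UnitTangent} {u w : Circle} (h : v.Joins u w) :
    v.base ∈ geodesicLine u w := ⟨v, rfl, h⟩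

/-- Isometries preserve the sides of geodesics. -/
theorem SU11.exists_orient_klein_smul (M : SU11) (a b : Circle) (z : Complex.UnitDisc) :
    ∃ c : ℝ, 0 < c ∧
      orient (M • a : Circle) (M • b : Circle) (klein (M • z)) = c * orient a b (klein z) := by
  have pos : ∀ (z : Complex.UnitDisc) (a b : Circle), 0 < Complex.normSq ((a : ℂ) - z) *
      Complex.normSq ((b : ℂ) - z) /
        ((1 + Complex.normSq (z : ℂ)) * (1 - Complex.normSq (z : ℂ))) := by
    intro z a b
    have h1 : 0 < Complex.normSq ((a : ℂ) - z) := Complex.normSq_pos.2 (z.circle_sub_ne_zero a)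
    have h2 : 0 < Complex.normSq ((b : ℂ) - z) := Complex.normSq_pos.2 (z.circle_sub_ne_zero b)
    have h3 := klein_den_pos z
    have h4 := z.normSq_lt_one'
    have h5 : 0 < 1 - Complex.normSq (z : ℂ) := by linarith
    positivity
  refine ⟨_, div_pos (pos (M • z) (M • a) (M • b)) (pos z a b), ?_⟩
  -- `M` turns both directions at `z` by the same factor of modulus one, so the angle between them
  -- is unchanged.
  have ht : conj (M.turn z) * M.turn z = 1 := by
    rw [mul_comm, Complex.mul_conj, Complex.normSq_eq_norm_sq, M.norm_turn]; simp
  rw [orient_klein, orient_klein a b z, dirTo_smul, dirTo_smul, map_mul]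
  have e : conj (M.turn z) * conj (dirTo z a) * (M.turn z * dirTo z b) =
      conj (dirTo z a) * dirTo z b := by linear_combination conj (dirTo z a) * dirTo z b * ht
  rw [e, mul_comm (_ / _), mul_assoc, mul_div_cancel₀ _ (pos z a b).ne']

theorem SU11.smul_mem_leftHalfPlane (M : SU11) (a b : Circle) (z : Complex.UnitDisc) :
    M • z ∈ leftHalfPlane (M • a) (M • b) ↔ z ∈ leftHalfPlane a b := by
  obtain ⟨c, hc, h⟩ := M.exists_orient_klein_smul a b z
  simp only [leftHalfPlane, Set.mem_ofPred_eq]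
  rw [h, mul_nonneg_iff_of_pos_left hc]

theorem SU11.smul_mem_geodesicLine (M : SU11) (a b : Circle) (z : Complex.UnitDisc) :
    M • z ∈ geodesicLine (M • a) (M • b) ↔ z ∈ geodesicLine a b := by
  obtain ⟨c, hc, h⟩ := M.exists_orient_klein_smul a b z
  rw [mem_geodesicLine_iff, mem_geodesicLine_iff, h, mul_eq_zero, or_iff_right hc.ne', ne_eq,
    smul_left_cancel_iff]

/-! ### Cyclic order on the circle -/

/-- `a`, `b`, `c` are in cyclic order. -/
def Cyc (a b c : ℝ) : Prop := (a < b ∧ b < c) ∨ (b < c ∧ c < a) ∨ (c < a ∧ a < b)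

/-- The angle, in `[0, 2π)`, from `o` to `z`. -/
noncomputable def angleFrom (o z : Circle) : ℝ := Real.pi - Complex.arg (-(o / z : Circle) : ℂ)

theorem angleFrom_nonneg (o z : Circle) : 0 ≤ angleFrom o z :=
  sub_nonneg.2 (Complex.arg_le_pi _)

theorem angleFrom_lt (o z : Circle) : angleFrom o z < 2 * Real.pi := by
  have := Complex.neg_pi_lt_arg (-(o / z : Circle) : ℂ)
  unfold angleFrom; linarith

theorem angleFrom_self (o : Circle) : angleFrom o o = 0 := by
  simp [angleFrom]

theorem eq_mul_exp_angleFrom (o z : Circle) :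
    (z : ℂ) = o * Complex.exp (angleFrom o z * Complex.I) := by
  have ho := o.coe_ne_zero
  have hz := z.coe_ne_zero
  have h := Complex.norm_mul_exp_arg_mul_I (-(o / z : Circle) : ℂ)
  rw [norm_neg, Circle.norm_coe, Complex.ofReal_one, one_mul] at h
  have e : Complex.exp (angleFrom o z * Complex.I) =
      -(Complex.exp (Complex.arg (-(o / z : Circle) : ℂ) * Complex.I))⁻¹ := by
    rw [angleFrom, ← Complex.exp_neg]
    push_cast
    rw [sub_mul, sub_eq_add_neg, Complex.exp_add, Complex.exp_pi_mul_I]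
    ring
  rw [e, h, Circle.coe_div]
  field_simp

theorem angleFrom_injective (o : Circle) : Function.Injective (angleFrom o) := by
  intro x y h
  apply Circle.ext
  rw [eq_mul_exp_angleFrom o x, eq_mul_exp_angleFrom o y, h]

theorem orient_mul_exp (o : Circle) (a b c : ℝ) :
    orient (o * Complex.exp (a * Complex.I)) (o * Complex.exp (b * Complex.I))
      (o * Complex.exp (c * Complex.I)) =
    4 * (Real.sin ((b - a) / 2) * Real.sin ((c - b) / 2) * Real.sin ((c - a) / 2)) := by
  have ho : (o : ℂ) * conj (o : ℂ) = 1 := by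
    rw [Circle.conj_coe_eq_inv, mul_inv_cancel₀ o.coe_ne_zero]
  have h1 : orient (o * Complex.exp (a * Complex.I)) (o * Complex.exp (b * Complex.I))
      (o * Complex.exp (c * Complex.I)) = Real.sin (b - a) * -1 + Real.sin (c - a) * 1 * -1
        + Real.sin (c - b) + 2 * Real.sin (b - a) := by
    have e : conj ((o : ℂ) * Complex.exp (b * Complex.I) - o * Complex.exp (a * Complex.I)) *
        (o * Complex.exp (c * Complex.I) - o * Complex.exp (a * Complex.I)) =
        conj (Complex.exp (b * Complex.I) - Complex.exp (a * Complex.I)) *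
        (Complex.exp (c * Complex.I) - Complex.exp (a * Complex.I)) := by
      simp only [map_sub, map_mul]
      linear_combination (conj (Complex.exp (b * Complex.I)) - conj (Complex.exp (a * Complex.I))) *
        (Complex.exp (c * Complex.I) - Complex.exp (a * Complex.I)) * ho
    rw [orient, e]
    simp only [Complex.exp_mul_I, ← Complex.ofReal_cos, ← Complex.ofReal_sin, Complex.mul_im,
      map_sub, map_add, map_mul, Complex.conj_ofReal, Complex.conj_I, Complex.sub_re,
      Complex.sub_im, Complex.add_re, Complex.add_im, Complex.mul_re, Complex.ofReal_re,
      Complex.ofReal_im, Complex.I_re, Complex.I_im, Complex.neg_re, Complex.neg_im, Real.sin_sub]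
    ring_nf
  have h2 : Real.sin (b - a) = 2 * Real.sin ((b - a) / 2) * Real.cos ((b - a) / 2) := by
    rw [← Real.sin_two_mul]; ring_nf
  have h3 : Real.sin (c - b) = 2 * Real.sin ((c - b) / 2) * Real.cos ((c - b) / 2) := by
    rw [← Real.sin_two_mul]; ring_nf
  have h4 : Real.sin (c - a) = 2 * Real.sin ((c - a) / 2) * Real.cos ((c - a) / 2) := by
    rw [← Real.sin_two_mul]; ring_nf
  have h5 : (c - a) / 2 = (b - a) / 2 + (c - b) / 2 := by ring
  rw [h1, h2, h3, h4, h5, Real.sin_add, Real.cos_add]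
  have s1 := Real.sin_sq_add_cos_sq ((b - a) / 2)
  have s2 := Real.sin_sq_add_cos_sq ((c - b) / 2)
  generalize Real.sin ((b - a) / 2) = x at *
  generalize Real.cos ((b - a) / 2) = x' at *
  generalize Real.sin ((c - b) / 2) = y at *
  generalize Real.cos ((c - b) / 2) = y' at *
  linear_combination (-2 * y * y') * s1 + (-2 * x * x') * s2

/-- A chart: an injective function that carries the cyclic order of the circle to that of `ℝ`. -/
structure IsChart (κ : Circle → ℝ) : Prop where
  inj : Function.Injective κ
  pos : ∀ x y z : Circle, 0 < orient x y z ↔ Cyc (κ x) (κ y) (κ z)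

theorem sin_half_pos_iff {x : ℝ} (h1 : -(2 * Real.pi) < x) (h2 : x < 2 * Real.pi) :
    0 < Real.sin (x / 2) ↔ 0 < x := by
  constructor
  · intro h
    by_contra h'
    have := Real.sin_nonpos_of_nonpos_of_neg_pi_le (x := x / 2) (by linarith) (by linarith)
    linarith
  · intro h
    exact Real.sin_pos_of_pos_of_lt_pi (by linarith) (by linarith)

/-- By `orient_mul_exp` the orientation is a positive multiple of a product of sines of half
differences of angles. The angles lie in `[0, 2π)`, so each sine has the sign of its difference. -/
theorem isChart_angleFrom (o : Circle) : IsChart (angleFrom o) := by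
  refine ⟨angleFrom_injective o, fun x y z => ?_⟩
  have hx := angleFrom_nonneg o x
  have hy := angleFrom_nonneg o y
  have hz := angleFrom_nonneg o z
  have hx' := angleFrom_lt o x
  have hy' := angleFrom_lt o y
  have hz' := angleFrom_lt o z
  rw [eq_mul_exp_angleFrom o x, eq_mul_exp_angleFrom o y, eq_mul_exp_angleFrom o z,
    orient_mul_exp]
  generalize angleFrom o x = a at *
  generalize angleFrom o y = b at *
  generalize angleFrom o z = c at *
  have pos : ∀ {x y : ℝ}, 0 ≤ x → 0 ≤ y → x < 2 * Real.pi → y < 2 * Real.pi → x < y →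
      0 < Real.sin ((y - x) / 2) := fun hx hy hx' hy' h =>
    (sin_half_pos_iff (by linarith) (by linarith)).2 (by linarith)
  have neg : ∀ {x y : ℝ}, 0 ≤ x → 0 ≤ y → x < 2 * Real.pi → y < 2 * Real.pi → y < x →
      Real.sin ((y - x) / 2) < 0 := by
    intro x y hx hy hx' hy' h
    have := pos hy hx hy' hx' h
    have e : (y - x) / 2 = -((x - y) / 2) := by ring
    rw [e, Real.sin_neg]; linarith
  rcases lt_trichotomy a b with h1 | h1 | h1 <;> rcases lt_trichotomy b c with h2 | h2 | h2 <;>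
    rcases lt_trichotomy a c with h3 | h3 | h3 <;> try (exfalso; linarith)
  · have := mul_pos (mul_pos (pos hx hy hx' hy' h1) (pos hy hz hy' hz' h2)) (pos hx hz hx' hz' h3)
    simp only [Cyc]; constructor
    · intro; tauto
    · intro; linarith
  · subst h2; simp [Cyc]; intros; linarith
  · have := mul_pos_of_neg_of_neg (neg hy hz hy' hz' h2) (pos hx hz hx' hz' h3 |> fun h => neg_neg_iff_pos.2 h)
    have := mul_pos (pos hx hy hx' hy' h1) this
    simp only [Cyc]; constructor
    · intro; nlinarith
    · rintro (⟨h, h'⟩ | ⟨h, h'⟩ | ⟨h, h'⟩) <;> linarith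
  · subst h3; simp [Cyc]; intros; linarith
  · have := mul_pos_of_neg_of_neg (neg hy hz hy' hz' h2) (neg hx hz hx' hz' h3)
    have := mul_pos (pos hx hy hx' hy' h1) this
    simp only [Cyc]; constructor
    · intro; tauto
    · intro; nlinarith
  · subst h1; simp [Cyc]; intros; linarith
  · subst h1; subst h2; simp [Cyc]
  · subst h1; simp [Cyc]; intros; linarith
  · have := mul_pos_of_neg_of_neg (neg hx hy hx' hy' h1) (pos hy hz hy' hz' h2 |> fun h => neg_neg_iff_pos.2 h)
    have := mul_pos this (pos hx hz hx' hz' h3)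
    simp only [Cyc]; constructor
    · intro; nlinarith
    · rintro (⟨h, h'⟩ | ⟨h, h'⟩ | ⟨h, h'⟩) <;> linarith
  · subst h3; simp [Cyc]; intros; linarith
  · have := mul_pos_of_neg_of_neg (neg hx hy hx' hy' h1) (neg hx hz hx' hz' h3)
    have := mul_pos this (pos hy hz hy' hz' h2)
    simp only [Cyc]; constructor
    · intro; tauto
    · intro; nlinarith
  · subst h2; simp [Cyc]; intros; linarith
  · have := mul_pos_of_neg_of_neg (neg hx hy hx' hy' h1) (neg hy hz hy' hz' h2)
    have := mul_pos this (neg_pos.2 (neg hx hz hx' hz' h3))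
    simp only [Cyc]; constructor
    · intro; nlinarith
    · rintro (⟨h, h'⟩ | ⟨h, h'⟩ | ⟨h, h'⟩) <;> linarith

namespace IsChart

theorem neg {κ : Circle → ℝ} (h : IsChart κ) (x y z : Circle) : orient x y z < 0 ↔ Cyc (κ y) (κ x) (κ z) := by
  rw [← h.pos, orient_swap (x : ℂ) y z]; exact neg_pos.symm

theorem nonneg {κ : Circle → ℝ} (h : IsChart κ) (x y z : Circle) : 0 ≤ orient x y z ↔ ¬ Cyc (κ y) (κ x) (κ z) := by
  rw [← h.neg, not_lt]

theorem nonpos {κ : Circle → ℝ} (h : IsChart κ) (x y z : Circle) : orient x y z ≤ 0 ↔ ¬ Cyc (κ x) (κ y) (κ z) := by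
  rw [← h.pos, not_lt]

theorem eq_iff {κ : Circle → ℝ} (h : IsChart κ) (x y : Circle) : x = y ↔ κ x = κ y := h.inj.eq_iff.symm

theorem mem_arc {κ : Circle → ℝ} (h : IsChart κ) (x y z : Circle) :
    z ∈ arc x y ↔ κ z = κ x ∨ κ z = κ y ∨ Cyc (κ x) (κ z) (κ y) := by
  rw [← h.pos, h.inj.eq_iff, h.inj.eq_iff]; rfl

end IsChart

theorem orient_circle_eq_zero_iff (x y z : Circle) :
    orient x y z = 0 ↔ x = y ∨ y = z ∨ x = z := by
  have h := isChart_angleFrom x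
  rw [h.eq_iff, h.eq_iff, h.eq_iff]
  have h1 := h.pos x y z
  have h2 := h.neg x y z
  generalize orient x y z = c at *
  simp only [Cyc] at h1 h2
  constructor
  · rintro rfl
    simp only [lt_irrefl, false_iff] at h1 h2
    grind
  · grind

/-! ### Labels of the sides -/

theorem eight_mul_cast {g : ℕ} (hg : 2 ≤ g) : (8 : SideIndex g) * g = 4 := by
  have h : ((8 * g - 4 : ℕ) : SideIndex g) = 0 := ZMod.natCast_self _
  rw [Nat.cast_sub (by omega)] at h
  push_cast at h
  linear_combination h

theorem neZero_sideIndex {g : ℕ} (hg : 2 ≤ g) : NeZero (8 * g - 4) := ⟨by omega⟩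

/-- The parity of a label. -/
noncomputable def parity {g : ℕ} : SideIndex g →+* ZMod 2 :=
  ZMod.castHom (show 2 ∣ 8 * g - 4 by omega) (ZMod 2)

theorem odd_val_iff {g : ℕ} (hg : 2 ≤ g) (i : SideIndex g) : Odd i.val ↔ parity i = 1 := by
  have := neZero_sideIndex hg
  have e : (parity i : ZMod 2) = (i.val : ZMod 2) := by
    conv_lhs => rw [← ZMod.natCast_zmod_val i]
    rw [map_natCast]
  rw [e, ZMod.natCast_eq_one_iff_odd]

theorem parity_cases {g : ℕ} (i : SideIndex g) : parity i = 0 ∨ parity i = 1 := by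
  generalize parity i = x
  revert x
  decide

theorem sidePair_odd {g : ℕ} (hg : 2 ≤ g) {i : SideIndex g} (h : parity i = 1) :
    sidePair i = 4 * g - i := by
  rw [sidePair, if_pos ((odd_val_iff hg i).2 h)]

theorem sidePair_even {g : ℕ} (hg : 2 ≤ g) {i : SideIndex g} (h : parity i = 0) :
    sidePair i = 2 - i := by
  rw [sidePair, if_neg]
  rw [odd_val_iff hg, h]
  decide

theorem parity_four {g : ℕ} : parity (4 : SideIndex g) = 0 := by
  rw [map_ofNat]; decide

theorem parity_two {g : ℕ} : parity (2 : SideIndex g) = 0 := by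
  rw [map_ofNat]; decide

theorem sidePair_cases {g : ℕ} (hg : 2 ≤ g) (i : SideIndex g) :
    (parity i = 1 ∧ sidePair i = 4 * g - i ∧ parity (sidePair i) = 1) ∨
      (parity i = 0 ∧ sidePair i = 2 - i ∧ parity (sidePair i) = 0) := by
  rcases parity_cases i with h | h
  · right
    refine ⟨h, sidePair_even hg h, ?_⟩
    rw [sidePair_even hg h, map_sub, parity_two, h, sub_zero]
  · left
    refine ⟨h, sidePair_odd hg h, ?_⟩
    rw [sidePair_odd hg h, map_sub, map_mul, parity_four, h, zero_mul]
    decide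

theorem sidePair_sidePair {g : ℕ} (hg : 2 ≤ g) (i : SideIndex g) : sidePair (sidePair i) = i := by
  rcases sidePair_cases hg i with ⟨h, e, h'⟩ | ⟨h, e, h'⟩
  · rw [sidePair_odd hg h', e]; ring
  · rw [sidePair_even hg h', e]; ring

theorem parity_add_one_of_even {g : ℕ} {i : SideIndex g} (h : parity i = 0) :
    parity (i + 1) = 1 := by rw [map_add, h, map_one, zero_add]

theorem parity_add_one_of_odd {g : ℕ} {i : SideIndex g} (h : parity i = 1) :
    parity (i + 1) = 0 := by rw [map_add, h, map_one]; decide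

theorem parity_sub_one_of_even {g : ℕ} {i : SideIndex g} (h : parity i = 0) :
    parity (i - 1) = 1 := by rw [map_sub, h, map_one]; decide

theorem parity_sub_one_of_odd {g : ℕ} {i : SideIndex g} (h : parity i = 1) :
    parity (i - 1) = 0 := by rw [map_sub, h, map_one]; decide

theorem parity_tauIdx {g : ℕ} (i : SideIndex g) : parity (tauIdx i) = parity i := by
  rw [tauIdx, map_add, map_sub, map_mul, parity_four, parity_two, zero_mul, sub_zero, add_zero]

theorem tauIdx_tauIdx {g : ℕ} (hg : 2 ≤ g) (i : SideIndex g) : tauIdx (tauIdx i) = i := by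
  simp only [tauIdx]
  linear_combination eight_mul_cast hg

/-- This identity and `sidePair_tauIdx_add_one` are what allows the images of neighbouring sides to
be matched in `U` and in the second condition on `G`. -/
theorem sidePair_tauIdx_sub_one {g : ℕ} (hg : 2 ≤ g) (i : SideIndex g) :
    sidePair (tauIdx i - 1) = sidePair i + 1 := by
  have ht := parity_tauIdx i
  rcases sidePair_cases hg i with ⟨h, e, h'⟩ | ⟨h, e, h'⟩
  · rw [sidePair_even hg (parity_sub_one_of_odd (ht.trans h)), e, tauIdx]
    linear_combination -eight_mul_cast hg
  · rw [sidePair_odd hg (parity_sub_one_of_even (ht.trans h)), e, tauIdx]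
    ring

theorem sidePair_tauIdx_add_one {g : ℕ} (hg : 2 ≤ g) (i : SideIndex g) :
    sidePair (tauIdx i + 1) = sidePair i - 1 := by
  have ht := parity_tauIdx i
  rcases sidePair_cases hg i with ⟨h, e, h'⟩ | ⟨h, e, h'⟩
  · rw [sidePair_even hg (parity_add_one_of_odd (ht.trans h)), e, tauIdx]
    linear_combination -eight_mul_cast hg
  · rw [sidePair_odd hg (parity_add_one_of_even (ht.trans h)), e, tauIdx]
    ring

/-- Two applications of `rhoIdx` shift the label by `4g - 2` up to sign, and twice that is `8g - 4 =
0`; so the vertex cycles close up after four steps. -/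
theorem sidePair_rhoIdx {g : ℕ} (hg : 2 ≤ g) (i : SideIndex g) :
    rhoIdx (rhoIdx (rhoIdx (rhoIdx i))) = i := by
  have odd : ∀ j : SideIndex g, parity j = 1 →
      rhoIdx j = 4 * g - j + 1 ∧ parity (rhoIdx j) = 0 := by
    intro j hj
    have e := sidePair_cases hg j
    rw [hj] at e
    rcases e with ⟨-, e, h'⟩ | ⟨h, -⟩
    · exact ⟨by rw [rhoIdx, e], by rw [rhoIdx]; exact parity_add_one_of_odd h'⟩
    · exact absurd h (by decide)
  have even : ∀ j : SideIndex g, parity j = 0 →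
      rhoIdx j = 2 - j + 1 ∧ parity (rhoIdx j) = 1 := by
    intro j hj
    have e := sidePair_cases hg j
    rw [hj] at e
    rcases e with ⟨h, -⟩ | ⟨-, e, h'⟩
    · exact absurd h (by decide)
    · exact ⟨by rw [rhoIdx, e], by rw [rhoIdx]; exact parity_add_one_of_even h'⟩
  have h8 := eight_mul_cast hg
  rcases parity_cases i with h | h
  · have h1 := even i h
    have h2 := odd _ h1.2
    have h3 := even _ h2.2
    have h4 := odd _ h3.2
    rw [h4.1, h3.1, h2.1, h1.1]
    linear_combination h8
  · have h1 := odd i h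
    have h2 := even _ h1.2
    have h3 := odd _ h2.2
    have h4 := even _ h3.2
    rw [h4.1, h3.1, h2.1, h1.1]
    linear_combination -h8

/-- A point of a geodesic is a convex combination of the endpoints in the Klein model. -/
theorem exists_combo_of_mem_geodesicLine {u w : Circle} {z : Complex.UnitDisc}
    (h : z ∈ geodesicLine u w) : ∃ s t : ℝ, 0 < s ∧ 0 < t ∧ s + t = 1 ∧
      (klein z = s * u + t * w) ∧
      ∀ a b : ℂ, orient a b (klein z) = s * orient a b u + t * orient a b w := by
  obtain ⟨v, rfl, hv⟩ := h
  obtain ⟨rfl, rfl⟩ := (v.joins_iff _ _).1 hv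
  have hr := v.ratio_pos 0
  have h1 : 1 / (1 + v.ratio 0) + v.ratio 0 / (1 + v.ratio 0) = 1 := by field_simp
  refine ⟨1 / (1 + v.ratio 0), v.ratio 0 / (1 + v.ratio 0), by positivity, by positivity,
    h1, v.klein_base, fun a b => ?_⟩
  rw [v.klein_base, orient_combo _ _ _ _ h1]

namespace FundamentalPolygon

variable {g : ℕ} {Γ : Subgroup SU11} (R : FundamentalPolygon g Γ)

/-! ### Cyclic order of the endpoints of the sides -/

theorem orient_P_of_cyc {i j k : SideIndex g} (h : (i.val < j.val ∧ j.val < k.val) ∨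
    (j.val < k.val ∧ k.val < i.val) ∨ (k.val < i.val ∧ i.val < j.val)) :
    0 < orient (R.P i) (R.P j) (R.P k) := by
  rcases h with ⟨h1, h2⟩ | ⟨h1, h2⟩ | ⟨h1, h2⟩
  · exact R.P_order _ _ _ h1 h2
  · rw [← orient_rotate]; exact R.P_order _ _ _ h1 h2
  · rw [orient_rotate]; exact R.P_order _ _ _ h1 h2

/-- Measuring angles from `P b` cuts the circle just before `P b`, which puts all the endpoints in
linear order starting there. -/
theorem exists_chart (hg : 2 ≤ g) (b : SideIndex g) : ∃ κ : Circle → ℝ, IsChart κ ∧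
    (∀ m : ℕ, m < 8 * g - 4 → κ (R.P (b + m)) < κ (R.Q (b + m))) ∧
    ∀ m l : ℕ, m < l → l < 8 * g - 4 → κ (R.Q (b + m)) < κ (R.P (b + l)) := by
  have := neZero_sideIndex hg
  have hκ := isChart_angleFrom (R.P b)
  have h0 := angleFrom_self (R.P b)
  have hn := angleFrom_nonneg (R.P b)
  refine ⟨_, hκ, ?_⟩
  generalize angleFrom (R.P b) = κ at *
  have hval : ∀ m : ℕ, m < 8 * g - 4 → (b + m).val = if b.val + m < 8 * g - 4 then b.val + m else
      b.val + m - (8 * g - 4) := by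
    intro m hm
    have hb := b.val_lt
    rw [ZMod.val_add, ZMod.val_natCast, Nat.mod_eq_of_lt hm]
    split_ifs with h
    · exact Nat.mod_eq_of_lt h
    · rw [Nat.mod_eq_sub_mod (by omega), Nat.mod_eq_of_lt (by omega)]
  have hP : ∀ m l : ℕ, m < l → l < 8 * g - 4 → κ (R.P (b + m)) < κ (R.P (b + l)) := by
    intro m l hml hl
    have hpos : ∀ m : ℕ, 0 < m → m < 8 * g - 4 → 0 < κ (R.P (b + m)) := by
      intro m hm0 hm
      have hne : κ (R.P (b + m)) ≠ 0 := by
        intro h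
        have e := hκ.inj (h.trans h0.symm)
        -- A third label: the order axiom for three distinct labels rules out that two of the points
        -- coincide.
        obtain ⟨c, hc⟩ : ∃ c : ℕ, c < 8 * g - 4 ∧ c ≠ 0 ∧ c ≠ m := by
          rcases eq_or_ne m 1 with h | h
          · exact ⟨2, by omega, by omega, by omega⟩
          · exact ⟨1, by omega, by omega, by omega⟩
        have hb := b.val_lt
        have v1 := hval m hm
        have v2 := hval c hc.1
        rcases lt_or_gt_of_ne hc.2.2 with h | h
        · have := R.orient_P_of_cyc (i := b) (j := b + c) (k := b + m)
            (by rw [v1, v2]; split_ifs <;> omega)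
          rw [e, orient_self_mid] at this
          exact lt_irrefl _ this
        · have := R.orient_P_of_cyc (i := b) (j := b + m) (k := b + c)
            (by rw [v1, v2]; split_ifs <;> omega)
          rw [e, orient_self_left] at this
          exact lt_irrefl _ this
      exact lt_of_le_of_ne (hn _) hne.symm
    rcases Nat.eq_zero_or_pos m with rfl | hm
    · simp only [Nat.cast_zero, add_zero, h0]
      exact hpos l hml hl
    · have hb := b.val_lt
      have v1 := hval m (by omega)
      have v2 := hval l hl
      have := R.orient_P_of_cyc (i := b) (j := b + m) (k := b + l)
        (by rw [v1, v2]; split_ifs <;> omega)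
      rw [hκ.pos, h0] at this
      have p1 := hpos m hm (by omega)
      have p2 := hpos l (by omega) hl
      simp only [Cyc] at this
      rcases this with h | h | h
      · exact h.2
      · linarith
      · linarith
  have hQ : ∀ m : ℕ, m < 8 * g - 4 → κ (R.P (b + m)) < κ (R.Q (b + m)) ∧
      (m + 1 < 8 * g - 4 → κ (R.Q (b + m)) < κ (R.P (b + (m + 1 : ℕ)))) := by
    intro m hm
    have h := R.Q_order (b + m)
    rw [hκ.pos] at h
    have e : b + m + 1 = b + (m + 1 : ℕ) := by push_cast; ring
    rw [e] at h
    rcases Nat.lt_or_ge (m + 1) (8 * g - 4) with h1 | h1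
    · have := hP m (m + 1) (by omega) h1
      simp only [Cyc] at h
      grind
    · have e2 : b + (m + 1 : ℕ) = b := by
        have : m + 1 = 8 * g - 4 := by omega
        rw [this, ZMod.natCast_self, add_zero]
      rw [e2, h0] at h
      have := hn (R.P (b + m))
      have := hn (R.Q (b + m))
      simp only [Cyc] at h
      grind
  refine ⟨fun m hm => (hQ m hm).1, fun m l hml hl => ?_⟩
  have h1 := (hQ m (by omega)).2 (by omega)
  rcases Nat.eq_or_lt_of_le hml with h2 | h2
  · rw [← h2]; exact h1
  · exact h1.trans (hP _ _ h2 hl)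

/-- A chart in which the endpoints of the sides close to side `i` are in linear order. -/
structure IsLocalChart (i : SideIndex g) (κ : Circle → ℝ) : Prop extends IsChart κ where
  p4 : κ (R.P (i - 4)) < κ (R.Q (i - 4))
  q4 : κ (R.Q (i - 4)) < κ (R.P (i - 3))
  p3 : κ (R.P (i - 3)) < κ (R.Q (i - 3))
  q3 : κ (R.Q (i - 3)) < κ (R.P (i - 2))
  p2 : κ (R.P (i - 2)) < κ (R.Q (i - 2))
  q2 : κ (R.Q (i - 2)) < κ (R.P (i - 1))
  p1 : κ (R.P (i - 1)) < κ (R.Q (i - 1))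
  q1 : κ (R.Q (i - 1)) < κ (R.P i)
  p : κ (R.P i) < κ (R.Q i)
  q : κ (R.Q i) < κ (R.P (i + 1))
  p1' : κ (R.P (i + 1)) < κ (R.Q (i + 1))
  q1' : κ (R.Q (i + 1)) < κ (R.P (i + 2))
  p2' : κ (R.P (i + 2)) < κ (R.Q (i + 2))
  q2' : κ (R.Q (i + 2)) < κ (R.P (i + 3))
  p3' : κ (R.P (i + 3)) < κ (R.Q (i + 3))
  q3' : κ (R.Q (i + 3)) < κ (R.P (i + 4))
  p4' : κ (R.P (i + 4)) < κ (R.Q (i + 4))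

theorem exists_localChart (hg : 2 ≤ g) (i : SideIndex g) : ∃ κ, R.IsLocalChart i κ := by
  -- The nine labels from `i - 4` to `i + 4` are distinct because `8g - 4 ≥ 12`.
  obtain ⟨κ, hκ, hP, hQ⟩ := R.exists_chart hg (i - 4)
  have e0 : i - 4 + ((0 : ℕ) : SideIndex g) = i - 4 := by simp
  have e1 : i - 4 + ((1 : ℕ) : SideIndex g) = i - 3 := by push_cast; ring
  have e2 : i - 4 + ((2 : ℕ) : SideIndex g) = i - 2 := by push_cast; ring
  have e3 : i - 4 + ((3 : ℕ) : SideIndex g) = i - 1 := by push_cast; ring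
  have e4 : i - 4 + ((4 : ℕ) : SideIndex g) = i := by push_cast; ring
  have e5 : i - 4 + ((5 : ℕ) : SideIndex g) = i + 1 := by push_cast; ring
  have e6 : i - 4 + ((6 : ℕ) : SideIndex g) = i + 2 := by push_cast; ring
  have e7 : i - 4 + ((7 : ℕ) : SideIndex g) = i + 3 := by push_cast; ring
  have e8 : i - 4 + ((8 : ℕ) : SideIndex g) = i + 4 := by push_cast; ring
  have p := fun m (hm : m < 9) => hP m (by omega)
  have q := fun m (hm : m < 8) => hQ m (m + 1) (by omega) (by omega)
  refine ⟨κ, hκ, ?_, ?_, ?_, ?_, ?_, ?_, ?_, ?_, ?_, ?_, ?_, ?_, ?_, ?_, ?_, ?_, ?_⟩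
  · simpa only [e0] using p 0 (by omega)
  · simpa only [e0, e1, zero_add] using q 0 (by omega)
  · simpa only [e1] using p 1 (by omega)
  · simpa only [e1, e2] using q 1 (by omega)
  · simpa only [e2] using p 2 (by omega)
  · simpa only [e2, e3] using q 2 (by omega)
  · simpa only [e3] using p 3 (by omega)
  · simpa only [e3, e4] using q 3 (by omega)
  · simpa only [e4] using p 4 (by omega)
  · simpa only [e4, e5] using q 4 (by omega)
  · simpa only [e5] using p 5 (by omega)
  · simpa only [e5, e6] using q 5 (by omega)
  · simpa only [e6] using p 6 (by omega)
  · simpa only [e6, e7] using q 6 (by omega)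
  · simpa only [e7] using p 7 (by omega)
  · simpa only [e7, e8] using q 7 (by omega)
  · simpa only [e8] using p 8 (by omega)

end FundamentalPolygon

/-! ### Continuity -/

theorem UnitTangent.continuous_flow_base (v : UnitTangent) :
    Continuous fun t : ℝ => (flow t v).base := by
  rw [Complex.UnitDisc.isEmbedding_coe.continuous_iff]
  change Continuous fun t : ℝ => v.flowPoint t
  have h : Continuous fun t : ℝ => (v.dir : ℂ) * ((Real.tanh (t / 2) : ℝ) : ℂ) := by
    have : Continuous Real.tanh := by
      have e : Real.tanh = fun x => Real.sinh x / Real.cosh x :=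
        funext Real.tanh_eq_sinh_div_cosh
      rw [e]
      exact Real.continuous_sinh.div Real.continuous_cosh fun x => (Real.cosh_pos x).ne'
    fun_prop
  exact (h.add continuous_const).div ((continuous_const.mul h).const_add 1) v.flowDen_ne_zero

theorem continuous_klein : Continuous klein := by
  have h := Complex.UnitDisc.continuous_coe
  unfold klein
  refine Continuous.div (by fun_prop) ?_ ?_
  · have := Complex.continuous_normSq
    fun_prop
  · intro z
    exact Complex.ofReal_ne_zero.2 (klein_den_pos z).ne'

theorem continuous_orient (a b : ℂ) : Continuous (orient a b) := by
  unfold orient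
  fun_prop

/-- The numerator of `orient_flow` is linear in the increasing ratio, with positive slope, and
vanishes at time `s`. -/
theorem UnitTangent.orient_lt_of_lt (v : UnitTangent) {a b : ℂ} {s t : ℝ} (hst : s < t)
    (h0 : orient a b (klein (flow s v).base) = 0) (hw : 0 < orient a b v.fwd) :
    0 < orient a b (klein (flow t v).base) := by
  have hs := v.ratio_pos s
  have ht := v.ratio_pos t
  have h := v.ratio_strictMono hst
  rw [orient_flow, div_eq_zero_iff, or_iff_left (by positivity)] at h0
  rw [orient_flow]
  apply div_pos _ (by positivity)
  nlinarith

/-- If `z` lies on `ab` then the side of `ab` on which `w` lies is seen from the directions. -/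
theorem orient_pos_iff_of_mem_geodesicLine {a b : Circle} {z : Complex.UnitDisc}
    (h : z ∈ geodesicLine a b) (w : Circle) :
    0 < orient a b w ↔ 0 < (conj (dirTo z b) * dirTo z w).im := by
  obtain ⟨s, t, hs, ht, -, -, h1⟩ := exists_combo_of_mem_geodesicLine h
  have h2 := h1 b w
  rw [orient_self_mid, mul_zero, add_zero, orient_rotate a b w, orient_klein] at h2
  have h1 : 0 < Complex.normSq ((b : ℂ) - z) := Complex.normSq_pos.2 (z.circle_sub_ne_zero b)
  have h2' : 0 < Complex.normSq ((w : ℂ) - z) := Complex.normSq_pos.2 (z.circle_sub_ne_zero w)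
  have h3 := klein_den_pos z
  have h4 := z.normSq_lt_one'
  have h5 : 0 < 1 - Complex.normSq (z : ℂ) := by linarith
  rw [← mul_pos_iff_of_pos_left hs, ← h2, mul_pos_iff_of_pos_right (by positivity)]

theorem dirTo_eq_neg_of_mem_geodesicLine {a b : Circle} {z : Complex.UnitDisc}
    (h : z ∈ geodesicLine a b) : dirTo z a = -dirTo z b := by
  obtain ⟨h1, h2⟩ := mem_geodesicLine_iff.1 h
  exact (orient_klein_eq_zero_iff h1 z).1 h2

theorem SU11.IsCentral.smul_circle_mul {M N : SU11} (h : (M * N).IsCentral) (z : Circle) :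
    M • N • z = z := by
  rw [← mul_smul]; exact h.smul_circle z

namespace FundamentalPolygon

variable {g : ℕ} {Γ : Subgroup SU11} (R : FundamentalPolygon g Γ)

/-! ### The polygon and its vertices -/

theorem mem_F {z : Complex.UnitDisc} :
    z ∈ R.F ↔ ∀ k, 0 ≤ orient (R.P k) (R.Q (k + 1)) (klein z) := by
  simp only [F, polygon, Set.mem_iInter]
  rfl

theorem orient_P_Q_P (hg : 2 ≤ g) (k : SideIndex g) :
    orient (R.P k) (R.Q (k + 1)) (R.P (k + 1)) < 0 := by
  obtain ⟨κ, h⟩ := R.exists_localChart hg k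
  have := h.p
  have := h.q
  have := h.p1'
  rw [h.neg]
  right; left
  constructor <;> linarith

/-- A point of the polygon on the line of side `k` is not interior, because moving from it towards
`P (k + 1)`, which is to the right of that line, leaves the polygon. -/
theorem mem_interior_F (hg : 2 ≤ g) {z : Complex.UnitDisc} :
    z ∈ interior R.F ↔ ∀ k, 0 < orient (R.P k) (R.Q (k + 1)) (klein z) := by
  have := neZero_sideIndex hg
  constructor
  · intro hz k
    have hz0 := R.mem_F.1 (interior_subset hz) k
    refine lt_of_le_of_ne hz0 fun h0 => ?_
    set v : UnitTangent := ⟨z, ⟨dirTo z (R.P (k + 1)), mem_sphere_zero_iff_norm.2 (norm_dirTo _ _)⟩⟩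
    have hv : v.fwd = R.P (k + 1) := (v.fwd_eq_iff _).2 rfl
    have h1 : ∀ᶠ t in 𝓝 (0 : ℝ), (flow t v).base ∈ interior R.F := by
      apply v.continuous_flow_base.continuousAt.eventually_mem
      rw [v.flow_zero]
      exact isOpen_interior.mem_nhds hz
    obtain ⟨t, ht, ht0⟩ := ((h1.filter_mono nhdsWithin_le_nhds).and
      (self_mem_nhdsWithin : Set.Ioi (0 : ℝ) ∈ 𝓝[>] 0)).exists
    have h2 := R.mem_F.1 (interior_subset ht) k
    have h3 := v.orient_lt_of_lt (a := R.Q (k + 1)) (b := R.P k) (s := 0) (t := t) ht0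
      (by rw [v.flow_zero, orient_swap, ← h0, neg_zero])
      (by rw [hv, orient_swap]; linarith [R.orient_P_Q_P hg k])
    rw [orient_swap] at h3
    linarith
  · intro h
    have hopen : IsOpen {z : Complex.UnitDisc | ∀ k, 0 < orient (R.P k) (R.Q (k + 1)) (klein z)} := by
      simp only [Set.ofPred_forall]
      exact isOpen_iInter_of_finite fun k =>
        isOpen_lt continuous_const ((continuous_orient _ _).comp continuous_klein)
    exact interior_maximal (fun z hz => R.mem_F.2 fun k => (hz k).le) hopen h

theorem V_mem_left (j : SideIndex g) : R.V j ∈ geodesicLine (R.P j) (R.Q (j + 1)) := R.V_left j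

theorem V_mem_right (j : SideIndex g) : R.V j ∈ geodesicLine (R.P (j - 1)) (R.Q j) := by
  have := R.V_right (j - 1)
  rwa [sub_add_cancel] at this

theorem orient_V_left (j : SideIndex g) : orient (R.P j) (R.Q (j + 1)) (klein (R.V j)) = 0 :=
  (mem_geodesicLine_iff.1 (R.V_mem_left j)).2

theorem orient_V_right (j : SideIndex g) : orient (R.P (j - 1)) (R.Q j) (klein (R.V j)) = 0 :=
  (mem_geodesicLine_iff.1 (R.V_mem_right j)).2

/-- `V j` lies on the two chords of sides `j - 1` and `j`; for each other side `k`, at least one of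
these chords has both endpoints strictly to the left of side `k`. -/
theorem orient_V_pos (hg : 2 ≤ g) {j k : SideIndex g} (h1 : k ≠ j - 1) (h2 : k ≠ j) :
    0 < orient (R.P k) (R.Q (k + 1)) (klein (R.V j)) := by
  have := neZero_sideIndex hg
  obtain ⟨κ, hκ, hP, hQ⟩ := R.exists_chart hg (j - 1)
  have e0 : j - 1 + ((0 : ℕ) : SideIndex g) = j - 1 := by simp
  have e1 : j - 1 + ((1 : ℕ) : SideIndex g) = j := by push_cast; ring
  have e2 : j - 1 + ((2 : ℕ) : SideIndex g) = j + 1 := by push_cast; ring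
  obtain ⟨m, hm, rfl⟩ : ∃ m : ℕ, m < 8 * g - 4 ∧ k = j - 1 + m :=
    ⟨(k - (j - 1)).val, ZMod.val_lt _, by rw [ZMod.natCast_zmod_val]; ring⟩
  have hm0 : m ≠ 0 := by rintro rfl; exact h1 e0
  have hm1 : m ≠ 1 := by rintro rfl; exact h2 e1
  have a0 := hP 0 (by omega)
  have a1 := hQ 0 1 (by omega) (by omega)
  have a2 := hP 1 (by omega)
  have a3 := hQ 1 2 (by omega) (by omega)
  have a4 := hP 2 (by omega)
  have a5 := hQ 1 m (by omega) hm
  rw [e0] at a0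
  rw [e0, e1] at a1
  rw [e1] at a2 a5
  rw [e1, e2] at a3
  rw [e2] at a4
  rcases Nat.lt_or_ge (m + 1) (8 * g - 4) with h | h
  · have b1 := hP m hm
    have b2 := hQ m (m + 1) (by omega) h
    have b3 := hP (m + 1) h
    have e : j - 1 + (m : SideIndex g) + 1 = j - 1 + (m + 1 : ℕ) := by push_cast; ring
    rw [e]
    obtain ⟨s, t, hs, ht, -, -, hst⟩ := exists_combo_of_mem_geodesicLine (R.V_mem_right j)
    rw [hst]
    have c1 := (hκ.pos (R.P (j - 1 + m)) (R.Q (j - 1 + (m + 1 : ℕ))) (R.P (j - 1))).2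
      (by simp only [Cyc]; grind)
    have c2 := (hκ.pos (R.P (j - 1 + m)) (R.Q (j - 1 + (m + 1 : ℕ))) (R.Q j)).2
      (by simp only [Cyc]; grind)
    positivity
  -- Here `k = j - 2`. The chord of side `k` separates the endpoints of the chord of side `j - 1`,
  -- so the chord of side `j` is used instead.
  · have e : j - 1 + (m : SideIndex g) + 1 = j - 1 := by
      have : ((m + 1 : ℕ) : SideIndex g) = 0 := by
        have : m + 1 = 8 * g - 4 := by omega
        rw [this, ZMod.natCast_self]
      push_cast at this
      linear_combination this
    have b1 := hQ 2 m (by omega) hm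
    rw [e2] at b1
    rw [e]
    obtain ⟨s, t, hs, ht, -, -, hst⟩ := exists_combo_of_mem_geodesicLine (R.V_mem_left j)
    rw [hst]
    have c1 := (hκ.pos (R.P (j - 1 + m)) (R.Q (j - 1)) (R.P j)).2
      (by simp only [Cyc]; grind)
    have c2 := (hκ.pos (R.P (j - 1 + m)) (R.Q (j - 1)) (R.Q (j + 1))).2
      (by simp only [Cyc]; grind)
    positivity

theorem V_mem_F (hg : 2 ≤ g) (j : SideIndex g) : R.V j ∈ R.F := by
  rw [mem_F]
  intro k
  by_cases h1 : k = j - 1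
  · rw [h1, sub_add_cancel, orient_V_right]
  by_cases h2 : k = j
  · rw [h2, orient_V_left]
  exact (R.orient_V_pos hg h1 h2).le

theorem orient_V_succ (hg : 2 ≤ g) (j : SideIndex g) :
    0 < orient (R.P (j - 1)) (R.Q j) (klein (R.V (j + 1))) := by
  have := neZero_sideIndex hg
  have h8 := eight_mul_cast hg
  have ne : ∀ m : ℕ, 0 < m → m < 8 * g - 4 → (m : SideIndex g) ≠ 0 := by
    intro m h0 hm h
    rw [ZMod.natCast_eq_zero_iff] at h
    exact absurd (Nat.le_of_dvd h0 h) (by omega)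
  have := R.orient_V_pos hg (j := j + 1) (k := j - 1)
    (fun h => ne 1 (by omega) (by omega) (by push_cast; linear_combination -h))
    (fun h => ne 2 (by omega) (by omega) (by push_cast; linear_combination -h))
  rwa [sub_add_cancel] at this

/-- A geodesic that has points of the polygon on both sides meets the polygon. -/
theorem exists_mem_F_of_sides {u w : Circle} (huw : u ≠ w) {x y : Complex.UnitDisc}
    (hx : x ∈ R.F) (hy : y ∈ R.F) (hx0 : 0 ≤ orient u w (klein x))
    (hy0 : orient u w (klein y) ≤ 0) : (u, w) ∈ OmegaGeo R.F := by
  rcases hx0.eq_or_lt with h | h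
  · exact ⟨x, hx, mem_geodesicLine_iff.2 ⟨huw, h.symm⟩⟩
  set A := orient u w (klein x)
  set B := orient u w (klein y)
  have hAB : 0 < A - B := by linarith
  -- The weights of the zero, on the Klein segment from `x` to `y`, of the affine function with
  -- values `A` and `B` at its ends.
  have hs : 0 ≤ -B / (A - B) := div_nonneg (by linarith) hAB.le
  have ht : 0 < A / (A - B) := div_pos h hAB
  have hst : -B / (A - B) + A / (A - B) = 1 := by field_simp; ring
  have hn : ‖((-B / (A - B) : ℝ) : ℂ) * klein x + ((A / (A - B) : ℝ) : ℂ) * klein y‖ < 1 := by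
    refine (norm_add_le _ _).trans_lt ?_
    rw [norm_mul, norm_mul, Complex.norm_real, Complex.norm_real, Real.norm_of_nonneg hs,
      Real.norm_of_nonneg ht.le]
    have h1 := mul_le_mul_of_nonneg_left (norm_klein_lt_one x).le hs
    have h2 := mul_lt_mul_of_pos_left (norm_klein_lt_one y) ht
    linarith
  obtain ⟨z, hz⟩ := exists_klein_eq hn
  refine ⟨z, R.mem_F.2 fun k => ?_, mem_geodesicLine_iff.2 ⟨huw, ?_⟩⟩
  · rw [hz, orient_combo _ _ _ _ hst]
    exact add_nonneg (mul_nonneg hs (R.mem_F.1 hx k)) (mul_nonneg ht.le (R.mem_F.1 hy k))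
  · rw [hz, orient_combo _ _ _ _ hst]
    change -B / (A - B) * A + A / (A - B) * B = 0
    field_simp
    ring

/-! ### The side pairings on the circle -/

/-- The relations among the `T i` are given on the disk; passing to a central matrix makes them
available on the circle and on tangent vectors. -/
theorem isCentral_T_pair (i : SideIndex g) : (R.T (sidePair i) * R.T i).IsCentral :=
  SU11.isCentral_of_disc fun z => by rw [mul_smul]; exact R.T_pair i z

theorem T_pair_circle (i : SideIndex g) (z : Circle) : R.T (sidePair i) • R.T i • z = z :=
  (R.isCentral_T_pair i).smul_circle_mul z

theorem T_pair_circle' (hg : 2 ≤ g) (i : SideIndex g) (z : Circle) :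
    R.T i • R.T (sidePair i) • z = z := by
  have := R.T_pair_circle (sidePair i) z
  rwa [sidePair_sidePair hg] at this

theorem T_vertex_succ (hg : 2 ≤ g) (i : SideIndex g) : R.T i • R.V (i + 1) = R.V (sidePair i) := by
  have h1 := R.T_vertex (sidePair i)
  rw [rhoIdx, sidePair_sidePair hg] at h1
  have h2 := R.T_pair (sidePair i) (R.V (sidePair i))
  rwa [sidePair_sidePair hg, h1] at h2

theorem orient_P_Q_Q (hg : 2 ≤ g) (j : SideIndex g) :
    0 < orient (R.P (j - 1)) (R.Q j) (R.Q (j + 1)) := by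
  obtain ⟨κ, h⟩ := R.exists_localChart hg j
  have := h.p1
  have := h.q1
  have := h.p
  have := h.q
  have := h.p1'
  rw [h.pos]
  left
  constructor <;> linarith

/-- Along the geodesic through side `i`, the vertex `V i` precedes `V (i + 1)`. -/
theorem pos_of_flow_V (hg : 2 ≤ g) {i : SideIndex g} {v : UnitTangent} {t : ℝ}
    (hv : v.Joins (R.P i) (R.Q (i + 1))) (h0 : v.base = R.V i)
    (ht : (flow t v).base = R.V (i + 1)) : 0 < t := by
  have h1 := R.orient_V_right i
  have h2 := R.orient_V_succ hg i
  rw [← h0, ← v.flow_zero] at h1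
  rw [← ht] at h2
  have hw := R.orient_P_Q_Q hg i
  obtain ⟨-, hf⟩ := (v.joins_iff _ _).1 hv
  rw [← hf] at hw
  by_contra h
  rcases (not_lt.1 h).eq_or_lt with h | h
  · rw [h, h1] at h2; exact lt_irrefl _ h2
  · have p1 := v.ratio_pos 0
    have p2 := v.ratio_pos t
    have hm := v.ratio_strictMono h
    rw [orient_flow, div_eq_zero_iff, or_iff_left (by positivity)] at h1
    rw [orient_flow, lt_div_iff₀ (by positivity), zero_mul] at h2
    nlinarith

/-- The endpoints `V i`, `V (i + 1)` of side `i` go to `V (σ i + 1)`, `V (σ i)`, so the whole line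
goes to the line of side `σ i`. The order of the vertices along the oriented lines shows that the
direction is reversed. -/
theorem T_side (hg : 2 ≤ g) (i : SideIndex g) :
    R.T i • R.P i = R.Q (sidePair i + 1) ∧ R.T i • R.Q (i + 1) = R.P (sidePair i) := by
  set σ := sidePair i with hσ
  have m1 : R.V (σ + 1) ∈ geodesicLine (R.T i • R.P i) (R.T i • R.Q (i + 1)) := by
    have := ((R.T i).smul_mem_geodesicLine _ _ _).2 (R.V_left i)
    rwa [R.T_vertex] at this
  have m2 : R.V σ ∈ geodesicLine (R.T i • R.P i) (R.T i • R.Q (i + 1)) := by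
    have := ((R.T i).smul_mem_geodesicLine _ _ _).2 (R.V_right i)
    rwa [R.T_vertex_succ hg] at this
  obtain ⟨hne, z1⟩ := mem_geodesicLine_iff.1 m1
  obtain ⟨-, z2⟩ := mem_geodesicLine_iff.1 m2
  obtain ⟨s, t, hs, ht, hst, hk, h1⟩ := exists_combo_of_mem_geodesicLine (R.V_left σ)
  obtain ⟨s', t', hs', ht', hst', hk', h1'⟩ := exists_combo_of_mem_geodesicLine (R.V_right σ)
  have hV : klein (R.V σ) ≠ klein (R.V (σ + 1)) := by
    intro h
    have h2 := R.orient_V_succ hg σ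
    rw [← h, R.orient_V_right] at h2
    exact lt_irrefl _ h2
  have hss : s - s' ≠ 0 := by
    intro h
    apply hV
    have e1 : s = s' := by linarith
    have e2 : t = t' := by linarith
    rw [hk, hk', e1, e2]
  rw [h1] at z2
  rw [h1'] at z1
  -- An affine function that vanishes at two distinct points of the chord of side `σ i` vanishes at
  -- both endpoints of the chord.
  have o1 : orient (R.T i • R.P i : Circle) (R.T i • R.Q (i + 1) : Circle) (R.P σ) = 0 := by
    apply mul_left_cancel₀ hss
    generalize orient (R.T i • R.P i : Circle) (R.T i • R.Q (i + 1) : Circle) (R.P σ) = x at *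
    generalize orient (R.T i • R.P i : Circle) (R.T i • R.Q (i + 1) : Circle) (R.Q (σ + 1)) = y at *
    obtain rfl : t = 1 - s := by linarith
    obtain rfl : t' = 1 - s' := by linarith
    linear_combination (1 - s') * z2 - (1 - s) * z1
  have o2 : orient (R.T i • R.P i : Circle) (R.T i • R.Q (i + 1) : Circle) (R.Q (σ + 1)) = 0 := by
    rw [o1, mul_zero, zero_add] at z1
    exact (mul_eq_zero.1 z1).resolve_left ht'.ne'
  have hPQ := (mem_geodesicLine_iff.1 (R.V_left σ)).1
  rw [orient_circle_eq_zero_iff, or_iff_right hne] at o1 o2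
  -- If the direction were preserved, the time `d` from `V i` to `V (i + 1)` would also be the time
  -- from `V (σ i + 1)` to `V (σ i)`, making both `d` and `-d` positive.
  have key : ¬ (R.T i • R.P i = R.P σ ∧ R.T i • R.Q (i + 1) = R.Q (σ + 1)) := by
    rintro ⟨e1, e2⟩
    obtain ⟨v, hv0, hv⟩ := R.V_left i
    obtain ⟨v', hv0', hv'⟩ := R.V_right i
    obtain ⟨d, rfl⟩ := hv.exists_flow_eq hv'
    have hd := R.pos_of_flow_V hg hv hv0 hv0'
    have hTv := hv.smul (R.T i)
    rw [e1, e2] at hTv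
    have hb1 : (R.T i • v).base = R.V (σ + 1) := by
      rw [smul_base, hv0, R.T_vertex]; rfl
    have hb2 : (flow d (R.T i • v)).base = R.V σ := by
      rw [flow_smul, smul_base, hv0', R.T_vertex_succ hg]
    have hd' := R.pos_of_flow_V hg (v := flow d (R.T i • v)) (t := -d) (hTv.flow d) hb2
      (by rw [flow_add, add_neg_cancel, flow_zero, hb1])
    linarith
  rcases o1 with o1 | o1 <;> rcases o2 with o2 | o2
  · exact absurd (o1.symm.trans o2) hPQ
  · exact ⟨o2, o1⟩
  · exact absurd ⟨o1, o2⟩ key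
  · exact absurd (o1.symm.trans o2) hPQ

end FundamentalPolygon

/-- Four exterior angles with sum `2π` of which no two neighbours have sum less than `π`. -/
theorem mul_eq_neg_one_of_mul_eq_one {a b c d : ℂ} (ha : ‖a‖ = 1) (hb : ‖b‖ = 1) (ha0 : 0 < a.im)
    (hb0 : 0 < b.im) (h : d * c * b * a = 1) (hab : (a * b).im ≤ 0) (hcd : (c * d).im ≤ 0) :
    a * b = -1 := by
  have ha1 : a * conj a = 1 := by rw [Complex.mul_conj, Complex.normSq_eq_norm_sq, ha]; simp
  have hb1 : b * conj b = 1 := by rw [Complex.mul_conj, Complex.normSq_eq_norm_sq, hb]; simp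
  have h1 : c * d = conj (a * b) := by
    rw [map_mul]
    linear_combination conj a * conj b * h - c * d * b * conj b * ha1 - c * d * hb1
  rw [h1, Complex.conj_im] at hcd
  have h2 : (a * b).im = 0 := by linarith
  have h3 := Complex.conj_eq_iff_im.2 h2
  rw [map_mul] at h3
  have h4 : (a * b - 1) * (a * b + 1) = 0 := by
    linear_combination (-a * b) * h3 + a * conj a * hb1 + ha1
  rcases mul_eq_zero.1 h4 with h5 | h5
  · have h6 : b = conj a := by linear_combination conj a * h5 - b * ha1
    rw [h6, Complex.conj_im] at hb0
    linarith
  · linear_combination h5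

/-! ### Exterior angles and the lines crossing at a vertex -/

namespace FundamentalPolygon

variable {g : ℕ} {Γ : Subgroup SU11} (R : FundamentalPolygon g Γ)

theorem dirTo_V_right (i : SideIndex g) :
    dirTo (R.V i) (R.P (i - 1)) = -dirTo (R.V i) (R.Q i) :=
  dirTo_eq_neg_of_mem_geodesicLine (R.V_mem_right i)

theorem dirTo_V_left (i : SideIndex g) :
    dirTo (R.V i) (R.P i) = -dirTo (R.V i) (R.Q (i + 1)) :=
  dirTo_eq_neg_of_mem_geodesicLine (R.V_mem_left i)

/-- The rotation through the exterior angle at the vertex `V i`. -/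
noncomputable def extRotation (i : SideIndex g) : ℂ :=
  conj (dirTo (R.V i) (R.Q i)) * dirTo (R.V i) (R.Q (i + 1))

theorem dirTo_mul_conj (z : Complex.UnitDisc) (a : Circle) :
    dirTo z a * conj (dirTo z a) = 1 := by
  rw [Complex.mul_conj, Complex.normSq_eq_norm_sq, norm_dirTo]; simp

theorem norm_extRotation (i : SideIndex g) : ‖R.extRotation i‖ = 1 := by
  rw [extRotation, norm_mul, RCLike.norm_conj, norm_dirTo, norm_dirTo, one_mul]

theorem extRotation_mul (i : SideIndex g) :
    R.extRotation i * dirTo (R.V i) (R.Q i) = dirTo (R.V i) (R.Q (i + 1)) := by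
  rw [extRotation]
  linear_combination dirTo (R.V i) (R.Q (i + 1)) * dirTo_mul_conj (R.V i) (R.Q i)

theorem extRotation_im_pos (hg : 2 ≤ g) (i : SideIndex g) : 0 < (R.extRotation i).im := by
  rw [extRotation, ← orient_pos_iff_of_mem_geodesicLine (R.V_mem_right i)]
  exact R.orient_P_Q_Q hg i

/-- The direction of side `i` at `V i` is carried to the direction opposite to that of side `σ i` at
`V (σ i + 1)`; the minus sign is the reversal in `T_side`. -/
theorem turn_T (hg : 2 ≤ g) (i : SideIndex g) :
    (R.T i).turn (R.V i) * (R.extRotation i * dirTo (R.V i) (R.Q i)) =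
      -dirTo (R.V (rhoIdx i)) (R.Q (rhoIdx i)) := by
  rw [extRotation_mul, ← dirTo_smul, R.T_vertex, (R.T_side hg i).2, ← dirTo_V_right, rhoIdx,
    add_sub_cancel_right]

theorem isCentral_T_cycle (i : SideIndex g) :
    (R.T (rhoIdx (rhoIdx (rhoIdx i))) * (R.T (rhoIdx (rhoIdx i)) * (R.T (rhoIdx i) * R.T i))).IsCentral :=
  SU11.isCentral_of_disc fun z => by rw [mul_smul, mul_smul, mul_smul]; exact R.T_cycle i z

/-- The turning factors of the four side pairings multiply to that of a central matrix, which is 1.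
Chaining the four instances of `turn_T` leaves the exterior rotations, and the four minus signs
cancel. -/
theorem extRotation_cycle (hg : 2 ≤ g) (i : SideIndex g) :
    R.extRotation (rhoIdx (rhoIdx (rhoIdx i))) * R.extRotation (rhoIdx (rhoIdx i)) * R.extRotation (rhoIdx i) *
      R.extRotation i = 1 := by
  have h0 := R.turn_T hg i
  have h1 := R.turn_T hg (rhoIdx i)
  have h2 := R.turn_T hg (rhoIdx (rhoIdx i))
  have h3 := R.turn_T hg (rhoIdx (rhoIdx (rhoIdx i)))
  rw [sidePair_rhoIdx hg] at h3
  have hc := (R.isCentral_T_cycle i).turn (R.V i)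
  rw [SU11.turn_mul, SU11.turn_mul, SU11.turn_mul, mul_smul, mul_smul, R.T_vertex, R.T_vertex,
    R.T_vertex] at hc
  have hD := dirTo_ne_zero (R.V i) (R.Q i)
  apply mul_right_cancel₀ hD
  generalize dirTo (R.V i) (R.Q i) = D0 at *
  generalize dirTo (R.V (rhoIdx i)) (R.Q (rhoIdx i)) = D1 at *
  generalize dirTo (R.V (rhoIdx (rhoIdx i))) (R.Q (rhoIdx (rhoIdx i))) = D2 at *
  generalize dirTo (R.V (rhoIdx (rhoIdx (rhoIdx i)))) (R.Q (rhoIdx (rhoIdx (rhoIdx i)))) = D3 at *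
  generalize R.extRotation i = b0 at *
  generalize R.extRotation (rhoIdx i) = b1 at *
  generalize R.extRotation (rhoIdx (rhoIdx i)) = b2 at *
  generalize R.extRotation (rhoIdx (rhoIdx (rhoIdx i))) = b3 at *
  generalize (R.T i).turn (R.V i) = r0 at *
  generalize (R.T (rhoIdx i)).turn (R.V (rhoIdx i)) = r1 at *
  generalize (R.T (rhoIdx (rhoIdx i))).turn (R.V (rhoIdx (rhoIdx i))) = r2 at *
  generalize (R.T (rhoIdx (rhoIdx (rhoIdx i)))).turn (R.V (rhoIdx (rhoIdx (rhoIdx i)))) = r3 at *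
  linear_combination (-(b3 * b2 * b1 * b0 * D0)) * hc + r3 * b3 * r2 * b2 * r1 * b1 * h0 -
    r3 * b3 * r2 * b2 * h1 + r3 * b3 * h2 - h3

/-- A geodesic through a vertex that points inwards enters the interior of the polygon. -/
theorem exists_mem_interior_of_inward (hg : 2 ≤ g) {j : SideIndex g} {v : UnitTangent}
    (hv : v.base = R.V j) (h1 : 0 < orient (R.P (j - 1)) (R.Q j) v.fwd)
    (h2 : 0 < orient (R.P j) (R.Q (j + 1)) v.fwd) : ∃ t, (flow t v).base ∈ interior R.F := by
  have := neZero_sideIndex hg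
  have h : ∀ k, ∀ᶠ t in 𝓝[>] (0 : ℝ), 0 < orient (R.P k) (R.Q (k + 1)) (klein (flow t v).base) := by
    intro k
    by_cases k1 : k = j - 1
    · filter_upwards [self_mem_nhdsWithin] with t ht
      rw [k1, sub_add_cancel]
      exact v.orient_lt_of_lt ht (by rw [flow_zero, hv, orient_V_right]) h1
    by_cases k2 : k = j
    · filter_upwards [self_mem_nhdsWithin] with t ht
      rw [k2]
      exact v.orient_lt_of_lt ht (by rw [flow_zero, hv, orient_V_left]) h2
    apply Filter.Eventually.filter_mono nhdsWithin_le_nhds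
    have hc : Continuous fun t => orient (R.P k) (R.Q (k + 1)) (klein (flow t v).base) :=
      (continuous_orient _ _).comp (continuous_klein.comp v.continuous_flow_base)
    apply hc.continuousAt.eventually_const_lt
    change 0 < orient (R.P k) (R.Q (k + 1)) (klein (flow 0 v).base)
    rw [flow_zero, hv]
    exact R.orient_V_pos hg k1 k2
  obtain ⟨t, ht⟩ := (eventually_all.2 h).exists
  exact ⟨t, (R.mem_interior_F hg).2 ht⟩

/-- If two consecutive exterior angles had sum less than `π`, the image under `T i` of the extension
of side `i - 1` beyond `V i` would leave `V (ρ i)` into the interior of the polygon, against the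
extension condition. -/
theorem extRotation_mul_im_nonpos (hg : 2 ≤ g) (i : SideIndex g) :
    (R.extRotation i * R.extRotation (rhoIdx i)).im ≤ 0 := by
  by_contra hpos
  rw [not_le] at hpos
  obtain ⟨v, hv0, hv⟩ := R.V_mem_right i
  have hb : (R.T i • v).base = R.V (rhoIdx i) := by rw [smul_base, hv0, R.T_vertex]
  have hj := hv.smul (R.T i)
  have hf : (R.T i • v).fwd = R.T i • R.Q i := ((joins_iff _ _ _).1 hj).2
  have hr := R.turn_T hg i
  have hD := dirTo_mul_conj (R.V (rhoIdx i)) (R.Q (rhoIdx i))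
  have hB : R.extRotation i * conj (R.extRotation i) = 1 := by
    rw [Complex.mul_conj, Complex.normSq_eq_norm_sq, norm_extRotation]; simp
  -- If `β` is the exterior angle at `V i`, this ray makes the angle `π - β` with the direction of
  -- `Q (ρ i)`.
  have hw : dirTo (R.V (rhoIdx i)) (R.T i • R.Q i) =
      -conj (R.extRotation i) * dirTo (R.V (rhoIdx i)) (R.Q (rhoIdx i)) := by
    rw [← R.T_vertex i, dirTo_smul, R.T_vertex]
    linear_combination conj (R.extRotation i) * hr -
      (R.T i).turn (R.V i) * dirTo (R.V i) (R.Q i) * hB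
  obtain ⟨t, ht⟩ := R.exists_mem_interior_of_inward hg hb
    (by
      rw [hf, orient_pos_iff_of_mem_geodesicLine (R.V_mem_right _), hw]
      have e : conj (dirTo (R.V (rhoIdx i)) (R.Q (rhoIdx i))) *
          (-conj (R.extRotation i) * dirTo (R.V (rhoIdx i)) (R.Q (rhoIdx i))) = -conj (R.extRotation i) := by
        linear_combination -conj (R.extRotation i) * hD
      rw [e, Complex.neg_im, Complex.conj_im, neg_neg]
      exact R.extRotation_im_pos hg i)
    (by
      rw [hf, orient_pos_iff_of_mem_geodesicLine (R.V_mem_left _), hw, ← R.extRotation_mul (rhoIdx i)]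
      have e : conj (R.extRotation (rhoIdx i) * dirTo (R.V (rhoIdx i)) (R.Q (rhoIdx i))) *
          (-conj (R.extRotation i) * dirTo (R.V (rhoIdx i)) (R.Q (rhoIdx i))) =
          -conj (R.extRotation i * R.extRotation (rhoIdx i)) := by
        simp only [map_mul]
        linear_combination -conj (R.extRotation i) * conj (R.extRotation (rhoIdx i)) * hD
      rw [e, Complex.neg_im, Complex.conj_im, neg_neg]
      exact hpos)
  refine R.extension (i - 1) (R.T i)⁻¹ (inv_mem (R.T_mem i)) _ ht ?_
  rw [flow_smul, smul_base, inv_smul_smul, sub_add_cancel]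
  exact (hv.flow t).base_mem

/-- Opposite angles: the side pairing `T i` carries the extension of side `i - 1` to that of side
`σ i + 1`. -/
theorem T_prev (hg : 2 ≤ g) (i : SideIndex g) :
    R.T i • R.P (i - 1) = R.P (sidePair i + 1) ∧ R.T i • R.Q i = R.Q (sidePair i + 2) := by
  have h := mul_eq_neg_one_of_mul_eq_one (R.norm_extRotation i) (R.norm_extRotation _) (R.extRotation_im_pos hg i)
    (R.extRotation_im_pos hg _) (R.extRotation_cycle hg i) (R.extRotation_mul_im_nonpos hg i)
    (R.extRotation_mul_im_nonpos hg (rhoIdx (rhoIdx i)))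
  have hr := R.turn_T hg i
  have hB : R.extRotation i * conj (R.extRotation i) = 1 := by
    rw [Complex.mul_conj, Complex.normSq_eq_norm_sq, norm_extRotation]; simp
  have key : (R.T i).turn (R.V i) * dirTo (R.V i) (R.Q i) =
      R.extRotation (rhoIdx i) * dirTo (R.V (rhoIdx i)) (R.Q (rhoIdx i)) := by
    linear_combination (-R.extRotation (rhoIdx i)) * hr +
      (R.T i).turn (R.V i) * dirTo (R.V i) (R.Q i) * h
  have e2 : sidePair i + 2 = rhoIdx i + 1 := by rw [rhoIdx]; ring
  constructor
  · apply dirTo_injective (R.V (rhoIdx i))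
    change _ = dirTo (R.V (rhoIdx i)) (R.P (rhoIdx i))
    rw [dirTo_V_left, ← R.extRotation_mul, ← key, ← R.T_vertex i, dirTo_smul, dirTo_V_right]
    ring
  · apply dirTo_injective (R.V (rhoIdx i))
    rw [e2, ← R.extRotation_mul, ← key, ← R.T_vertex i, dirTo_smul]

theorem T_next (hg : 2 ≤ g) (i : SideIndex g) :
    R.T i • R.P (i + 1) = R.P (sidePair i - 1) ∧ R.T i • R.Q (i + 2) = R.Q (sidePair i) := by
  have h := R.T_prev hg (sidePair i)
  rw [sidePair_sidePair hg] at h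
  constructor
  · rw [← h.1, R.T_pair_circle' hg]
  · rw [← h.2, R.T_pair_circle' hg]

/-! ### The transformations to the opposite tiles -/

theorem U_smul (i : SideIndex g) (z : Circle) :
    R.U i • z = R.T (sidePair i) • R.T (tauIdx i - 1) • z := mul_smul _ _ _

theorem U_mem (i : SideIndex g) : R.U i ∈ Γ := mul_mem (R.T_mem _) (R.T_mem _)

/-- Together with the next three lemmas: the lines of sides `τ i - 1` and `τ i`, which cross at `V
(τ i)`, go with reversed directions to the lines of sides `i - 1` and `i`, which cross at `V i`. -/
theorem U_P_prev (hg : 2 ≤ g) (i : SideIndex g) : R.U i • R.P (tauIdx i - 1) = R.Q i := by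
  have h1 := (R.T_side hg (tauIdx i - 1)).1
  have h2 := (R.T_next hg (sidePair i)).2
  rw [sidePair_tauIdx_sub_one hg] at h1
  rw [sidePair_sidePair hg] at h2
  rw [U_smul, h1, add_assoc, one_add_one_eq_two, h2]

theorem U_Q (hg : 2 ≤ g) (i : SideIndex g) : R.U i • R.Q (tauIdx i) = R.P (i - 1) := by
  have h1 := (R.T_side hg (tauIdx i - 1)).2
  have h2 := (R.T_next hg (sidePair i)).1
  rw [sidePair_tauIdx_sub_one hg, sub_add_cancel] at h1
  rw [sidePair_sidePair hg] at h2
  rw [U_smul, h1, h2]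

theorem U_P (hg : 2 ≤ g) (i : SideIndex g) : R.U i • R.P (tauIdx i) = R.Q (i + 1) := by
  have h1 := (R.T_next hg (tauIdx i - 1)).1
  have h2 := (R.T_side hg (sidePair i)).1
  rw [sidePair_tauIdx_sub_one hg, sub_add_cancel, add_sub_cancel_right] at h1
  rw [sidePair_sidePair hg] at h2
  rw [U_smul, h1, h2]

theorem U_Q_next (hg : 2 ≤ g) (i : SideIndex g) : R.U i • R.Q (tauIdx i + 1) = R.P i := by
  have h1 := (R.T_next hg (tauIdx i - 1)).2
  have h2 := (R.T_side hg (sidePair i)).2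
  have e : tauIdx i - 1 + 2 = tauIdx i + 1 := by ring
  rw [sidePair_tauIdx_sub_one hg, e] at h1
  rw [sidePair_sidePair hg] at h2
  rw [U_smul, h1, h2]

theorem P_ne_of_chart (hg : 2 ≤ g) (i : SideIndex g) :
    R.Q i ≠ R.P (i - 1) ∧ R.P (i - 1) ≠ R.Q (i + 1) ∧ R.Q (i + 1) ≠ R.Q i := by
  obtain ⟨κ, h⟩ := R.exists_localChart hg i
  have := h.p1
  have := h.q1
  have := h.p
  have := h.q
  have := h.p1'
  refine ⟨fun h => ?_, fun h => ?_, fun h => ?_⟩ <;>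
  · have := congrArg κ h
    linarith

/-- The values of `U` at the ends of the lines through `V (τ i)` and through `V i` show that the
product fixes three points of the circle. -/
theorem isCentral_U_U (hg : 2 ≤ g) (i : SideIndex g) : (R.U (tauIdx i) * R.U i).IsCentral := by
  obtain ⟨h1, h2, h3⟩ := R.P_ne_of_chart hg (tauIdx i)
  have a := R.U_Q hg (tauIdx i)
  have b := R.U_P_prev hg (tauIdx i)
  have c := R.U_Q_next hg (tauIdx i)
  have d := R.U_P hg (tauIdx i)
  rw [tauIdx_tauIdx hg] at a b c d
  refine SU11.isCentral_of_circle h1 h2 h3 ?_ ?_ ?_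
  · rw [mul_smul, R.U_Q hg, b]
  · rw [mul_smul, R.U_P_prev hg, a]
  · rw [mul_smul, R.U_Q_next hg, d]

theorem U_U_circle (hg : 2 ≤ g) (i : SideIndex g) (z : Circle) :
    R.U (tauIdx i) • R.U i • z = z := (R.isCentral_U_U hg i).smul_circle_mul z

theorem U_U_circle' (hg : 2 ≤ g) (i : SideIndex g) (z : Circle) :
    R.U i • R.U (tauIdx i) • z = z := by
  have := R.U_U_circle hg (tauIdx i) z
  rwa [tauIdx_tauIdx hg] at this

theorem U_V (hg : 2 ≤ g) (i : SideIndex g) : R.U i • R.V (tauIdx i) = R.V i := by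
  have h1 := R.T_vertex_succ hg (tauIdx i - 1)
  rw [sub_add_cancel, sidePair_tauIdx_sub_one hg] at h1
  have h2 := R.T_pair i (R.V i)
  rw [R.T_vertex] at h2
  rw [U, mul_smul, h1]
  exact h2

end FundamentalPolygon

/-! ### Arcs -/

theorem mem_arc_iff_angleFrom {x y z : Circle} : z ∈ arc x y ↔ angleFrom x z ≤ angleFrom x y := by
  have h := isChart_angleFrom x
  have h0 := angleFrom_self x
  have h1 := angleFrom_nonneg x y
  have h2 := angleFrom_nonneg x z
  rw [h.mem_arc, h0]
  simp only [Cyc]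
  grind

theorem angleFrom_mul_exp (o : Circle) {t : ℝ} (h0 : 0 ≤ t) (h1 : t < 2 * Real.pi) :
    angleFrom o (o * Circle.exp t) = t := by
  have e : -((o / (o * Circle.exp t) : Circle) : ℂ) = (Circle.exp (Real.pi - t) : ℂ) := by
    have ho := o.coe_ne_zero
    rw [Circle.coe_div, Circle.coe_mul, Circle.coe_exp, Circle.coe_exp]
    push_cast
    rw [sub_mul, sub_eq_add_neg, Complex.exp_add, Complex.exp_pi_mul_I, Complex.exp_neg]
    field_simp
  rw [angleFrom, e, Circle.arg_exp (by linarith) (by linarith)]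
  ring

/-- Isometries are monotone on arcs. -/
theorem SU11.arc_mono (M : SU11) {κ : Circle → ℝ} (hκ : IsChart κ) {x y : Circle}
    (hM : κ (M • x) < κ (M • y)) {z z' : Circle} (hzz' : angleFrom x z ≤ angleFrom x z')
    (hz' : z' ∈ arc x y) :
    κ (M • x) ≤ κ (M • z) ∧ κ (M • z) ≤ κ (M • z') ∧ κ (M • z') ≤ κ (M • y) := by
  have hx := isChart_angleFrom x
  have h0 := angleFrom_self x
  have hn := angleFrom_nonneg x
  have e : ∀ a b c, Cyc (κ (M • a)) (κ (M • b)) (κ (M • c)) ↔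
      Cyc (angleFrom x a) (angleFrom x b) (angleFrom x c) := fun a b c => by
    rw [← hκ.pos, ← hx.pos]; exact M.orient_smul_pos a b c
  rw [mem_arc_iff_angleFrom] at hz'
  have mem : ∀ z, angleFrom x z ≤ angleFrom x y → κ (M • x) ≤ κ (M • z) ∧ κ (M • z) ≤ κ (M • y) := by
    intro z hz
    by_cases h1 : z = x
    · rw [h1]; exact ⟨le_rfl, hM.le⟩
    by_cases h2 : z = y
    · rw [h2]; exact ⟨hM.le, le_rfl⟩
    have h3 : angleFrom x z ≠ angleFrom x x := fun h => h1 (hx.inj h)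
    have h4 : angleFrom x z ≠ angleFrom x y := fun h => h2 (hx.inj h)
    have h5 := hn z
    have := (e x z y).2 (by simp only [Cyc]; grind)
    simp only [Cyc] at this
    grind
  refine ⟨(mem z (hzz'.trans hz')).1, ?_, (mem z' hz').2⟩
  by_cases h1 : z = x
  · rw [h1]; exact (mem z' hz').1
  by_cases h2 : z = z'
  · rw [h2]
  have h3 : angleFrom x z ≠ angleFrom x x := fun h => h1 (hx.inj h)
  have h4 : angleFrom x z ≠ angleFrom x z' := fun h => h2 (hx.inj h)
  have h5 := hn z
  have := (e x z z').2 (by simp only [Cyc]; grind)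
  have := mem z (hzz'.trans hz')
  have := mem z' hz'
  simp only [Cyc] at *
  grind

theorem normSq_circle_sub (x y : Circle) :
    (Complex.normSq ((x : ℂ) - y) : ℂ) = -((x : ℂ) - y) ^ 2 / (x * y) := by
  have hx := x.coe_ne_zero
  have hy := y.coe_ne_zero
  rw [← Complex.mul_conj, map_sub, Circle.conj_coe_eq_inv, Circle.conj_coe_eq_inv]
  field_simp
  ring

/-- Divided by the three squared distances to `y`, this says that signed differences of coordinates
add up once `y` is sent to infinity. -/
theorem orient_mul_normSq (x y z z' : Circle) :
    orient y x z' * Complex.normSq ((y : ℂ) - z) - orient y x z * Complex.normSq ((y : ℂ) - z') =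
      orient y z z' * Complex.normSq ((y : ℂ) - x) := by
  have hx := x.coe_ne_zero
  have hy := y.coe_ne_zero
  have hz := z.coe_ne_zero
  have hz' := z'.coe_ne_zero
  apply Complex.ofReal_injective
  have h2 : (2 * Complex.I) ≠ 0 := by simp
  apply mul_right_cancel₀ h2
  simp only [Complex.ofReal_mul, Complex.ofReal_sub]
  have h1 := orient_circle y x z'
  have h3 := orient_circle y x z
  have h4 := orient_circle y z z'
  have e : ((orient y x z' : ℝ) * (Complex.normSq ((y : ℂ) - z) : ℝ) -
      (orient y x z : ℝ) * (Complex.normSq ((y : ℂ) - z') : ℝ) : ℂ) * (2 * Complex.I) =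
      (orient y x z' * (2 * Complex.I)) * (Complex.normSq ((y : ℂ) - z) : ℝ) -
      (orient y x z * (2 * Complex.I)) * (Complex.normSq ((y : ℂ) - z') : ℝ) := by ring
  have e' : ((orient y z z' : ℝ) * (Complex.normSq ((y : ℂ) - x) : ℝ) : ℂ) * (2 * Complex.I) =
      (orient y z z' * (2 * Complex.I)) * (Complex.normSq ((y : ℂ) - x) : ℝ) := by ring
  rw [e, e', h1, h3, h4, normSq_circle_sub, normSq_circle_sub, normSq_circle_sub]
  field_simp
  ring

/-- The direction in which an isometry with fixed points `x` and `y` moves the other points. -/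
theorem SU11.orient_of_fixed (M : SU11) {x y : Circle} (hx : M • x = x) (hy : M • y = y)
    {z : Circle} (hyz : y ≠ z) : ∃ c : ℝ, 0 < c ∧
      orient y z (M • z : Circle) * Complex.normSq ((y : ℂ) - x) =
        c * (orient y x z * (1 / Complex.normSq (M.den x) - 1)) := by
  have nx := Complex.normSq_pos.2 (M.den_circle_ne_zero x)
  have ny := Complex.normSq_pos.2 (M.den_circle_ne_zero y)
  have nz := Complex.normSq_pos.2 (M.den_circle_ne_zero z)
  have hd : 0 < Complex.normSq ((y : ℂ) - z) :=
    Complex.normSq_pos.2 (sub_ne_zero.2 fun h => hyz (Circle.ext h))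
  have h1 := M.orient_smul y x z
  rw [hx, hy] at h1
  have h2 := congrArg Complex.normSq (M.smul_circle_sub y z)
  rw [hy, Complex.normSq_div, Complex.normSq_mul] at h2
  refine ⟨Complex.normSq ((y : ℂ) - z) / (Complex.normSq (M.den y) * Complex.normSq (M.den z)),
    by positivity, ?_⟩
  rw [← orient_mul_normSq, h1, h2]
  field_simp

/-- An isometry that maps an arc monotonically into itself and has two fixed points inside the arc
fixes an endpoint of the arc. -/
theorem SU11.fixed_endpoint_of_fixed {M : SU11} {a b x y : Circle} (hx : M • x = x) (hy : M • y = y)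
    (hax : 0 < angleFrom a x) (hxy : angleFrom a x < angleFrom a y)
    (hyb : angleFrom a y < angleFrom a b) (hMa : angleFrom a (M • a) ≤ angleFrom a x)
    (hMb : angleFrom a y ≤ angleFrom a (M • b)) (hMb' : angleFrom a (M • b) ≤ angleFrom a b) :
    M • a = a ∨ M • b = b := by
  by_contra hne
  rw [not_or] at hne
  have hκ := isChart_angleFrom a
  have h0 := angleFrom_self a
  have hn := angleFrom_nonneg a (M • a)
  have nx := Complex.normSq_pos.2 (M.den_circle_ne_zero x)
  have hyx : y ≠ x := fun h => by rw [h] at hxy; exact lt_irrefl _ hxy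
  have hya : y ≠ a := fun h => by rw [h, h0] at hxy; linarith
  have hyb' : y ≠ b := fun h => by rw [h] at hyb; exact lt_irrefl _ hyb
  have hd : 0 < Complex.normSq ((y : ℂ) - x) :=
    Complex.normSq_pos.2 (sub_ne_zero.2 fun h => hyx (Circle.ext h))
  have i1 : angleFrom a (M • a) ≠ 0 := fun h => hne.1 (hκ.inj (h.trans h0.symm))
  have i2 : angleFrom a (M • b) ≠ angleFrom a b := fun h => hne.2 (hκ.inj h)
  have i3 : angleFrom a (M • b) ≠ angleFrom a y := by
    intro h
    have h' := hκ.inj h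
    rw [← hy] at h'
    exact hyb' ((smul_left_cancel_iff M).1 h').symm
  obtain ⟨c, hc, e1⟩ := M.orient_of_fixed hx hy hya
  obtain ⟨c', hc', e2⟩ := M.orient_of_fixed hx hy hyb'
  -- The points `a` and `b` lie in the same component of the complement of `x` and `y`, in which `M`
  -- moves all points the same way. Yet `a` would move counterclockwise and `b` clockwise.
  have s1 := (hκ.pos y a (M • a)).2 (by simp only [Cyc]; grind)
  have s2 := (hκ.neg y x a).2 (by simp only [Cyc]; grind)
  have s3 := (hκ.neg y b (M • b)).2 (by simp only [Cyc]; grind)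
  have s4 := (hκ.neg y x b).2 (by simp only [Cyc]; grind)
  have p1 := mul_pos s1 hd
  rw [e1, mul_pos_iff_of_pos_left hc] at p1
  have p2 := mul_neg_of_neg_of_pos s3 hd
  rw [e2] at p2
  have p3 : orient y x b * (1 / Complex.normSq (M.den x) - 1) < 0 := by
    by_contra h
    have := mul_nonneg hc'.le (not_lt.1 h)
    linarith
  have q1 : 1 / Complex.normSq (M.den x) - 1 < 0 := by
    by_contra h
    have := mul_nonpos_of_nonpos_of_nonneg s2.le (not_lt.1 h)
    linarith
  have q2 := mul_pos_of_neg_of_neg s4 q1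
  linarith

namespace FundamentalPolygon

variable {g : ℕ} {Γ : Subgroup SU11} (R : FundamentalPolygon g Γ)

/-! ### The system of conditions -/

/-- One step of the system: the isometry `M` maps the arc `[P f, P (f + 1)]` into the arc
`[P k, P (k + 1)]`. -/
structure IsStep (M : SU11) (f k : SideIndex g) : Prop where
  mem : ∀ z ∈ arc (R.P f) (R.P (f + 1)), M • z ∈ arc (R.P k) (R.P (k + 1))
  mono : ∀ z, ∀ z' ∈ arc (R.P f) (R.P (f + 1)), angleFrom (R.P f) z ≤ angleFrom (R.P f) z' →
    angleFrom (R.P k) (M • z) ≤ angleFrom (R.P k) (M • z')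
  left : ∀ z ∈ arc (R.P f) (R.P (f + 1)), M • z = R.P k →
    z = R.P f ∧ M • R.Q (f + 1) = R.Q (k + 1)
  right : ∀ z ∈ arc (R.P f) (R.P (f + 1)), M • z = R.P (k + 1) →
    z = R.P (f + 1) ∧ M • R.Q (f + 2) = R.Q (k + 2)

theorem angleFrom_P (hg : 2 ≤ g) (k : SideIndex g) :
    0 < angleFrom (R.P k) (R.Q k) ∧ angleFrom (R.P k) (R.Q k) < angleFrom (R.P k) (R.P (k + 1)) ∧
    angleFrom (R.P k) (R.P (k + 1)) < angleFrom (R.P k) (R.Q (k + 1)) ∧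
    angleFrom (R.P k) (R.Q (k + 1)) < angleFrom (R.P k) (R.Q (k + 2)) := by
  obtain ⟨κ, h⟩ := R.exists_localChart hg k
  have hκ := isChart_angleFrom (R.P k)
  have h0 := angleFrom_self (R.P k)
  have hn := angleFrom_nonneg (R.P k)
  have := h.p
  have := h.q
  have := h.p1'
  have := h.q1'
  have := h.p2'
  have c1 := (hκ.pos _ _ _).1 ((h.pos (R.P k) (R.Q k) (R.P (k + 1))).2 (by simp only [Cyc]; grind))
  have c2 := (hκ.pos _ _ _).1
    ((h.pos (R.P k) (R.P (k + 1)) (R.Q (k + 1))).2 (by simp only [Cyc]; grind))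
  have c3 := (hκ.pos _ _ _).1
    ((h.pos (R.P k) (R.Q (k + 1)) (R.Q (k + 2))).2 (by simp only [Cyc]; grind))
  rw [h0] at c1 c2 c3
  have h1 := hn (R.Q k)
  have h2 := hn (R.P (k + 1))
  have h3 := hn (R.Q (k + 1))
  have h4 := hn (R.Q (k + 2))
  simp only [Cyc] at c1 c2 c3
  grind

theorem left_mem_arc (x y : Circle) : x ∈ arc x y := Or.inl rfl

theorem right_mem_arc (x y : Circle) : y ∈ arc x y := Or.inr (Or.inl rfl)

/-- Isometries preserve cyclic order, so it suffices to control the images of the endpoints of the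
arc. The last two hypotheses are needed only when an endpoint goes to the corresponding endpoint. -/
theorem isStep_of_bounds {M : SU11} {f k : SideIndex g}
    (h1 : angleFrom (R.P k) (M • R.P f) < angleFrom (R.P k) (M • R.P (f + 1)))
    (h2 : angleFrom (R.P k) (M • R.P (f + 1)) ≤ angleFrom (R.P k) (R.P (k + 1)))
    (hl : M • R.P f = R.P k → M • R.Q (f + 1) = R.Q (k + 1))
    (hr : M • R.P (f + 1) = R.P (k + 1) → M • R.Q (f + 2) = R.Q (k + 2)) : R.IsStep M f k := by
  have hκ := isChart_angleFrom (R.P k)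
  have h0 := angleFrom_self (R.P k)
  have hn := angleFrom_nonneg (R.P k) (M • R.P f)
  constructor
  · intro z hz
    rw [mem_arc_iff_angleFrom]
    exact (M.arc_mono hκ h1 le_rfl hz).2.2.trans h2
  · intro z z' hz' hzz'
    exact (M.arc_mono hκ h1 hzz' hz').2.1
  · intro z hz hMz
    have h3 := (M.arc_mono hκ h1 le_rfl hz).1
    rw [hMz, h0] at h3
    have h4 : M • R.P f = R.P k := hκ.inj (by rw [h0]; linarith)
    exact ⟨(smul_left_cancel_iff M).1 (hMz.trans h4.symm), hl h4⟩
  · intro z hz hMz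
    have h3 := (M.arc_mono hκ h1 le_rfl hz).2.2
    rw [hMz] at h3
    have h4 : M • R.P (f + 1) = R.P (k + 1) := hκ.inj (by linarith)
    exact ⟨(smul_left_cancel_iff M).1 (hMz.trans h4.symm), hr h4⟩

/-- `T i` carries `P (i - 1)` to `P (σ i + 1)` and `P (i - 2)` strictly inside the target arc, so
exactly the right endpoints correspond. -/
theorem isStep_P (hg : 2 ≤ g) (i : SideIndex g) :
    R.IsStep (R.T i) (i - 2) (sidePair i) ∧ R.T i • R.P (i - 2) ≠ R.P (sidePair i) := by
  have e1 : i - 2 + 1 = i - 1 := by ring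
  have e2 : i - 2 + 2 = i := by ring
  have a := R.T_prev hg i
  have b := R.T_side hg i
  have hκ := isChart_angleFrom (R.P (sidePair i))
  have h0 := angleFrom_self (R.P (sidePair i))
  obtain ⟨κ, h⟩ := R.exists_localChart hg i
  have := h.p2
  have := h.q2
  have := h.p1
  have := h.q1
  have := h.p
  have := h.q
  have := h.p1'
  have c : 0 < orient (R.Q (i + 1)) (R.P (i - 2)) (R.P (i - 1)) :=
    (h.pos _ _ _).2 (by simp only [Cyc]; grind)
  rw [← (R.T i).orient_smul_pos, b.2, a.1, hκ.pos, h0] at c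
  have n1 := angleFrom_nonneg (R.P (sidePair i)) (R.T i • R.P (i - 2))
  have n2 := (R.angleFrom_P hg (sidePair i)).1.trans (R.angleFrom_P hg (sidePair i)).2.1
  constructor
  · apply R.isStep_of_bounds
    · rw [e1, a.1]
      simp only [Cyc] at c
      grind
    · rw [e1, a.1]
    · intro h
      rw [h, h0] at c
      simp only [Cyc] at c
      grind
    · intro _
      rw [e2, a.2]
  · intro h
    rw [h, h0] at c
    simp only [Cyc] at c
    grind

/-- The source arc is carried onto `[P (σ i), Q (σ i)]`, so exactly the left endpoints correspond.
-/
theorem isStep_Q (hg : 2 ≤ g) (i : SideIndex g) :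
    R.IsStep (R.T (tauIdx i + 1)) (tauIdx i) (sidePair i) ∧
      R.T (tauIdx i + 1) • R.P (tauIdx i + 1) ≠ R.P (sidePair i + 1) := by
  have a := R.T_prev hg (tauIdx i + 1)
  have b := R.T_side hg (tauIdx i + 1)
  have e3 : sidePair i - 1 + 2 = sidePair i + 1 := by ring
  rw [sidePair_tauIdx_add_one hg, add_sub_cancel_right, sub_add_cancel, e3] at a
  rw [sidePair_tauIdx_add_one hg, sub_add_cancel] at b
  have h0 := angleFrom_self (R.P (sidePair i))
  have h1 := R.angleFrom_P hg (sidePair i)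
  constructor
  · apply R.isStep_of_bounds
    · rw [a.1, b.1, h0]
      exact h1.1
    · rw [b.1]
      exact h1.2.1.le
    · intro _
      exact a.2
    · intro h
      rw [b.1] at h
      rw [h] at h1
      exact absurd h1.2.1 (lt_irrefl _)
  · intro h
    rw [b.1] at h
    rw [h] at h1
    exact absurd h1.2.1 (lt_irrefl _)

theorem IsStep.comp {R : FundamentalPolygon g Γ} {M N : SU11} {f j k : SideIndex g}
    (hM : R.IsStep M j k) (hN : R.IsStep N f j) : R.IsStep (M * N) f k := by
  constructor
  · intro z hz
    rw [mul_smul]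
    exact hM.mem _ (hN.mem _ hz)
  · intro z z' hz' hzz'
    rw [mul_smul, mul_smul]
    exact hM.mono _ _ (hN.mem _ hz') (hN.mono _ _ hz' hzz')
  · intro z hz h
    rw [mul_smul] at h ⊢
    obtain ⟨h1, h2⟩ := hM.left _ (hN.mem _ hz) h
    obtain ⟨h3, h4⟩ := hN.left _ hz h1
    exact ⟨h3, by rw [h4, h2]⟩
  · intro z hz h
    rw [mul_smul] at h ⊢
    obtain ⟨h1, h2⟩ := hM.right _ (hN.mem _ hz) h
    obtain ⟨h3, h4⟩ := hN.right _ hz h1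
    exact ⟨h3, by rw [h4, h2]⟩

/-- A step from an arc to itself that does not fix both endpoints has at most one fixed point. -/
theorem IsStep.eq_of_fixed {R : FundamentalPolygon g Γ} (hg : 2 ≤ g) {M : SU11} {k : SideIndex g}
    (hM : R.IsStep M k k) (hne : ¬ (M • R.P k = R.P k ∧ M • R.P (k + 1) = R.P (k + 1)))
    {x y : Circle} (hx : x ∈ arc (R.P k) (R.P (k + 1))) (hy : y ∈ arc (R.P k) (R.P (k + 1)))
    (hMx : M • x = x) (hMy : M • y = y) : x = y := by
  wlog hxy : angleFrom (R.P k) x ≤ angleFrom (R.P k) y generalizing x y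
  · exact (this hy hx hMy hMx (le_of_not_ge hxy)).symm
  by_contra hxy'
  have hκ := isChart_angleFrom (R.P k)
  have h0 := angleFrom_self (R.P k)
  have h1 := R.angleFrom_P hg k
  have hlt : angleFrom (R.P k) x < angleFrom (R.P k) y :=
    lt_of_le_of_ne hxy fun h => hxy' (hκ.inj h)
  have central : ¬ M.IsCentral := fun h => hne ⟨h.smul_circle _, h.smul_circle _⟩
  have hx' := mem_arc_iff_angleFrom.1 hx
  have hy' := mem_arc_iff_angleFrom.1 hy
  have outside : ∀ q z, angleFrom (R.P k) (R.P (k + 1)) < angleFrom (R.P k) q →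
      angleFrom (R.P k) z ≤ angleFrom (R.P k) (R.P (k + 1)) → z ≠ q := by
    intro q z hq hz h
    rw [h] at hz
    linarith
  -- The points `x` and `y` are already fixed; a third fixed point, outside the arc, would make `M`
  -- central and hence fix both endpoints. By the fields `left` and `right` of `IsStep`, fixing one
  -- endpoint produces such a point, so neither endpoint is fixed.
  have fixQ : ∀ q, angleFrom (R.P k) (R.P (k + 1)) < angleFrom (R.P k) q → M • q ≠ q := by
    intro q hq h
    exact central (SU11.isCentral_of_circle hxy' (outside q y hq hy')
      (outside q x hq hx').symm hMx hMy h)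
  have fl : M • R.P k ≠ R.P k := fun h =>
    fixQ _ h1.2.2.1 (hM.left _ (left_mem_arc _ _) h).2
  have fr : M • R.P (k + 1) ≠ R.P (k + 1) := fun h =>
    fixQ _ (h1.2.2.1.trans h1.2.2.2) (hM.right _ (right_mem_arc _ _) h).2
  have m1 := hM.mono (R.P k) x hx (by rw [h0]; exact angleFrom_nonneg _ _)
  have m2 := hM.mono y (R.P (k + 1)) (right_mem_arc _ _) hy'
  have m3 := mem_arc_iff_angleFrom.1 (hM.mem _ (right_mem_arc _ _))
  rw [hMx] at m1
  rw [hMy] at m2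
  have hx0 : 0 < angleFrom (R.P k) x := by
    refine lt_of_le_of_ne (angleFrom_nonneg _ _) fun h => fl ?_
    rw [← hκ.inj (h0.trans h)] at hMx
    exact hMx
  have hy1 : angleFrom (R.P k) y < angleFrom (R.P k) (R.P (k + 1)) := by
    refine lt_of_le_of_ne hy' fun h => fr ?_
    rw [hκ.inj h] at hMy
    exact hMy
  rcases SU11.fixed_endpoint_of_fixed hMx hMy hx0 hlt hy1 m1 m2 m3 with h | h
  · exact fl h
  · exact fr h

/-- The composition of the steps `S k`, `S (f k)`, …. -/
noncomputable def word (S : SideIndex g → SU11) (f : SideIndex g → SideIndex g) :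
    ℕ → SideIndex g → SU11
  | 0, _ => 1
  | p + 1, k => S k * word S f p (f k)

theorem isStep_word {R : FundamentalPolygon g Γ} {S : SideIndex g → SU11}
    {f : SideIndex g → SideIndex g} (hS : ∀ k, R.IsStep (S k) (f k) k) (p : ℕ) (k : SideIndex g) :
    R.IsStep (word S f (p + 1) k) (f^[p + 1] k) k := by
  induction p generalizing k with
  | zero => simpa [word] using hS k
  | succ p ih =>
    rw [word, Function.iterate_succ_apply]
    exact (hS k).comp (ih (f k))

/-- A system of steps has exactly one solution. -/
theorem existsUnique_of_isStep (hg : 2 ≤ g) {S : SideIndex g → SU11}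
    {f : SideIndex g → SideIndex g} (hS : ∀ k, R.IsStep (S k) (f k) k)
    (hne : ∀ k, ¬ (S k • R.P (f k) = R.P k ∧ S k • R.P (f k + 1) = R.P (k + 1))) :
    ∃! G : SideIndex g → Circle, (∀ k, G k ∈ arc (R.P k) (R.P (k + 1))) ∧
      ∀ k, G k = S k • G (f k) := by
  have := neZero_sideIndex hg
  refine existsUnique_of_exists_of_unique ?_ ?_
  · have hle : ∀ k, Fact ((0 : ℝ) ≤ angleFrom (R.P k) (R.P (k + 1))) :=
      fun k => ⟨angleFrom_nonneg _ _⟩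
    let pt : ∀ k, Set.Icc (0 : ℝ) (angleFrom (R.P k) (R.P (k + 1))) → Circle :=
      fun k t => R.P k * Circle.exp t
    have hpt : ∀ k t, angleFrom (R.P k) (pt k t) = t := fun k t =>
      angleFrom_mul_exp _ t.2.1 (t.2.2.trans_lt (angleFrom_lt _ _))
    have hmem : ∀ k t, pt k t ∈ arc (R.P k) (R.P (k + 1)) := fun k t => by
      rw [mem_arc_iff_angleFrom, hpt]; exact t.2.2
    let Φ : (∀ k, Set.Icc (0 : ℝ) (angleFrom (R.P k) (R.P (k + 1)))) →o
        (∀ k, Set.Icc (0 : ℝ) (angleFrom (R.P k) (R.P (k + 1)))) :=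
      ⟨fun t k => ⟨angleFrom (R.P k) (S k • pt (f k) (t (f k))), angleFrom_nonneg _ _,
        mem_arc_iff_angleFrom.1 ((hS k).mem _ (hmem _ _))⟩, fun s t hst k => by
          apply (hS k).mono _ _ (hmem _ _)
          rw [hpt, hpt]
          exact hst (f k)⟩
    have hfix := Φ.map_lfp
    refine ⟨fun k => pt k (OrderHom.lfp Φ k), fun k => hmem _ _, fun k => ?_⟩
    apply angleFrom_injective (R.P k)
    rw [hpt]
    conv_lhs => rw [← hfix]
    rfl
  · rintro G G' ⟨hG, hGS⟩ ⟨hG', hGS'⟩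
    by_contra hGG'
    obtain ⟨k₀, hk₀⟩ : ∃ k, G k ≠ G' k := by
      by_contra h
      push Not at h
      exact hGG' (funext h)
    -- Uniqueness: a discrepancy at `k` forces one at `f k`. As there are finitely many labels, it
    -- recurs along a cycle of `f`.
    have step : ∀ k, G k ≠ G' k → G (f k) ≠ G' (f k) := by
      intro k hk h
      apply hk
      rw [hGS, hGS', h]
    have iter : ∀ m, G (f^[m] k₀) ≠ G' (f^[m] k₀) := by
      intro m
      induction m with
      | zero => exact hk₀
      | succ m ih => rw [Function.iterate_succ_apply']; exact step _ ih
    have hword : ∀ (G : SideIndex g → Circle), (∀ k, G k = S k • G (f k)) → ∀ p k,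
        G k = word S f p k • G (f^[p] k) := by
      intro G hG p
      induction p with
      | zero => intro k; simp [word]
      | succ p ih =>
        intro k
        rw [word, mul_smul, Function.iterate_succ_apply, ← ih, ← hG]
    obtain ⟨a, b, hab, he⟩ := Finite.exists_ne_map_eq_of_infinite fun m : ℕ => f^[m] k₀
    wlog hlt : a < b generalizing a b
    · exact this b a hab.symm he.symm (by omega)
    obtain ⟨p, rfl⟩ : ∃ p, b = p + 1 + a := ⟨b - a - 1, by omega⟩
    simp only [Function.iterate_add_apply f (p + 1) a] at he
    set k := f^[a] k₀
    have hst := isStep_word hS p k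
    have e1 := hword G hGS (p + 1) k
    have e2 := hword G' hGS' (p + 1) k
    rw [← he] at hst e1 e2
    refine iter a (hst.eq_of_fixed hg ?_ (hG k) (hG' k) e1.symm e2.symm)
    -- If the word around the cycle fixed both endpoints, then its first letter would carry both
    -- endpoints of the source arc to those of the target arc.
    rintro ⟨h1, h2⟩
    rw [word, mul_smul] at h1 h2
    rcases Nat.eq_zero_or_pos p with rfl | hp
    · simp only [word, one_smul] at h1 h2
      have hk : f k = k := he.symm
      exact hne k (by rw [hk]; exact ⟨h1, h2⟩)
    · obtain ⟨q, rfl⟩ : ∃ q, p = q + 1 := ⟨p - 1, by omega⟩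
      have hst' := isStep_word hS q (f k)
      have hk : f^[q + 1] (f k) = k := he.symm
      rw [hk] at hst'
      have l := (hS k).left _ (hst'.mem _ (left_mem_arc _ _)) h1
      have r := (hS k).right _ (hst'.mem _ (right_mem_arc _ _)) h2
      rw [l.1] at h1
      rw [r.1] at h2
      exact hne k ⟨h1, h2⟩

theorem exists_systemSolution (hg : 2 ≤ g) {A : SideIndex g → Circle} (hA : R.IsExtremal A) :
    ∃ G : SideIndex g → Circle, R.IsSystemSolution A G ∧
      ∀ G', R.IsSystemSolution A G' → G' = G := by
  classical
  have hPQ : ∀ i, R.P i ≠ R.Q i := by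
    intro i h
    have := (R.angleFrom_P hg i).1
    rw [← h, angleFrom_self] at this
    exact lt_irrefl _ this
  -- The conditions are stated for `G (σ i)`; with `k = σ i` they become one equation for each `G
  -- k`.
  let S : SideIndex g → SU11 := fun k =>
    if A (sidePair k) = R.P (sidePair k) then R.T (sidePair k) else R.T (tauIdx (sidePair k) + 1)
  let f : SideIndex g → SideIndex g := fun k =>
    if A (sidePair k) = R.P (sidePair k) then sidePair k - 2 else tauIdx (sidePair k)
  have hS : ∀ k, R.IsStep (S k) (f k) k := by
    intro k
    simp only [S, f]
    split_ifs with h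
    · have := (R.isStep_P hg (sidePair k)).1
      rwa [sidePair_sidePair hg] at this
    · have := (R.isStep_Q hg (sidePair k)).1
      rwa [sidePair_sidePair hg] at this
  have hne : ∀ k, ¬ (S k • R.P (f k) = R.P k ∧ S k • R.P (f k + 1) = R.P (k + 1)) := by
    rintro k ⟨h1, h2⟩
    simp only [S, f] at h1 h2
    split_ifs at h1 h2 with h
    · have := (R.isStep_P hg (sidePair k)).2
      rw [sidePair_sidePair hg] at this
      exact this h1
    · have := (R.isStep_Q hg (sidePair k)).2
      rw [sidePair_sidePair hg] at this
      exact this h2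
  have hiff : ∀ G, R.IsSystemSolution A G ↔ (∀ k, G k ∈ arc (R.P k) (R.P (k + 1))) ∧
      ∀ k, G k = S k • G (f k) := by
    intro G
    constructor
    · intro h
      refine ⟨fun k => (h k).1, fun k => ?_⟩
      have h1 := h (sidePair k)
      rw [sidePair_sidePair hg] at h1
      simp only [S, f]
      split_ifs with hk
      · exact h1.2.1 hk
      · exact h1.2.2 ((hA _).resolve_left hk)
    · rintro ⟨h1, h2⟩ i
      have h3 := h2 (sidePair i)
      simp only [S, f, sidePair_sidePair hg] at h3
      refine ⟨h1 i, fun hi => ?_, fun hi => ?_⟩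
      · rwa [if_pos hi, if_pos hi] at h3
      · have hi' : A i ≠ R.P i := by rw [hi]; exact (hPQ i).symm
        rwa [if_neg hi', if_neg hi'] at h3
  obtain ⟨G, hG, huniq⟩ := R.existsUnique_of_isStep hg hS hne
  exact ⟨G, (hiff G).2 hG, fun G' hG' => huniq G' ((hiff G').1 hG')⟩

end FundamentalPolygon

/-! ### Entering a set -/

theorem UnitTangent.enters_flow_iff (v : UnitTangent) (K : Set Complex.UnitDisc) (s : ℝ) :
    (flow s v).Enters K ↔ IsGLB {t : ℝ | (flow t v).base ∈ K} s := by
  have h := (OrderIso.addLeft s).isGLB_preimage (s := {t : ℝ | (flow t v).base ∈ K}) (x := 0)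
  rw [OrderIso.addLeft_apply, add_zero] at h
  rw [← h, Enters]
  simp only [flow_add]
  rfl

theorem UnitTangent.Enters.exists_mem {v : UnitTangent} {K : Set Complex.UnitDisc} (h : v.Enters K) :
    ∃ t, (flow t v).base ∈ K := by
  by_contra hne
  push Not at hne
  have : {t : ℝ | (flow t v).base ∈ K} = ∅ := Set.eq_empty_of_forall_notMem hne
  rw [Enters, this, isGLB_empty_iff] at h
  exact not_isTop _ h

theorem UnitTangent.Joins.eq_of_enters {v v' : UnitTangent} {u w : Circle} (h : v.Joins u w)
    (h' : v'.Joins u w) {K : Set Complex.UnitDisc} (hK : v.Enters K) (hK' : v'.Enters K) : v = v' := by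
  obtain ⟨t, rfl⟩ := h.exists_flow_eq h'
  rw [enters_flow_iff] at hK'
  rw [← hK.unique hK', UnitTangent.flow_zero]

theorem UnitTangent.Joins.mem_OmegaGeo {v : UnitTangent} {u w : Circle} (h : v.Joins u w) {t : ℝ}
    {K : Set Complex.UnitDisc} (ht : (UnitTangent.flow t v).base ∈ K) : (u, w) ∈ FundamentalPolygon.OmegaGeo K :=
  ⟨_, ht, (h.flow t).base_mem⟩

theorem UnitTangent.Joins.exists_flow_mem {v : UnitTangent} {u w : Circle} (h : v.Joins u w)
    {K : Set Complex.UnitDisc} (hK : (u, w) ∈ FundamentalPolygon.OmegaGeo K) :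
    ∃ t, (UnitTangent.flow t v).base ∈ K := by
  obtain ⟨_, hz, v', rfl, hv'⟩ := hK
  obtain ⟨t, rfl⟩ := h.exists_flow_eq hv'
  exact ⟨t, hz⟩

theorem SU11.smul_base_mem_image (M : SU11) (v : UnitTangent) (K : Set Complex.UnitDisc) :
    (M • v).base ∈ (fun z => M • z) '' K ↔ v.base ∈ K := by
  rw [smul_base]
  exact (MulAction.injective M).mem_set_image

theorem SU11.smul_enters_image (M : SU11) (v : UnitTangent) (K : Set Complex.UnitDisc) :
    (M • v).Enters ((fun z => M • z) '' K) ↔ v.Enters K := by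
  unfold Enters
  simp only [flow_smul, M.smul_base_mem_image]

theorem OmegaGeo_swap {u w : Circle} {K : Set Complex.UnitDisc} :
    (w, u) ∈ FundamentalPolygon.OmegaGeo K ↔ (u, w) ∈ FundamentalPolygon.OmegaGeo K := by
  have : geodesicLine w u = geodesicLine u w := by
    ext z
    rw [mem_geodesicLine_iff, mem_geodesicLine_iff, orient_swap u w, neg_eq_zero, ne_comm]
  change (∃ z ∈ K, z ∈ geodesicLine w u) ↔ ∃ z ∈ K, z ∈ geodesicLine u w
  rw [this]

theorem SU11.smul_arc (M : SU11) {x y z : Circle} (h : z ∈ arc x y) : M • z ∈ arc (M • x) (M • y) := by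
  rcases h with rfl | rfl | h
  · exact Or.inl rfl
  · exact Or.inr (Or.inl rfl)
  · exact Or.inr (Or.inr ((M.orient_smul_pos _ _ _).2 h))

theorem norm_le_norm_klein (z : Complex.UnitDisc) : ‖(z : ℂ)‖ ≤ ‖klein z‖ := by
  have h0 := klein_den_pos z
  have h1 := z.norm_lt_one
  have h2 := norm_nonneg (z : ℂ)
  rw [klein, norm_div, norm_mul, Complex.norm_real, Real.norm_of_nonneg h0.le, le_div_iff₀ h0,
    Complex.norm_ofNat, Complex.normSq_eq_norm_sq]
  nlinarith [mul_nonneg h2 (sub_nonneg.2 h1.le)]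

namespace FundamentalPolygon

variable {g : ℕ} {Γ : Subgroup SU11} (R : FundamentalPolygon g Γ)

/-- The half-planes to the right of the sides cover the circle at infinity. -/
theorem exists_orient_neg (hg : 2 ≤ g) (u : Circle) :
    ∃ k, orient (R.P k) (R.Q (k + 1)) u < 0 := by
  have := neZero_sideIndex hg
  -- `P k` is the last of the points `P` met going counterclockwise from `u`, so `u` lies after `P
  -- k` and not beyond `P (k + 1)`, hence to the right of side `k`.
  obtain ⟨k, hk⟩ := Finite.exists_max fun k => angleFrom u (R.P k)
  obtain ⟨κ, h⟩ := R.exists_localChart hg k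
  have hu := isChart_angleFrom u
  have h0 := angleFrom_self u
  have hn := angleFrom_nonneg u
  have := h.p
  have := h.q
  have := h.p1'
  have := h.q1'
  have c1 := (hu.pos _ _ _).1 ((h.pos (R.P k) (R.P (k + 1)) (R.Q (k + 1))).2 (by simp only [Cyc]; grind))
  have h1 := hn (R.P (k + 1))
  have h2 := hk (k + 1)
  refine ⟨k, (hu.neg _ _ _).2 ?_⟩
  rw [h0]
  simp only [Cyc] at *
  grind

/-- The closed Klein polygon is a compact subset of the closed disk that misses the circle, since
every point of the circle is to the right of some side; so the Klein norm has a maximum below 1 on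
it. -/
theorem exists_norm_le (hg : 2 ≤ g) : ∃ r : ℝ, r < 1 ∧ ∀ z ∈ R.F, ‖(z : ℂ)‖ ≤ r := by
  let C : Set ℂ := Metric.closedBall 0 1 ∩ ⋂ k, {x | 0 ≤ orient (R.P k) (R.Q (k + 1)) x}
  have hC : IsCompact C := (isCompact_closedBall _ _).inter_right
    (isClosed_iInter fun k => isClosed_le continuous_const (continuous_orient _ _))
  have hF : ∀ z ∈ R.F, klein z ∈ C := fun z hz => by
    refine ⟨mem_closedBall_zero_iff.2 (norm_klein_lt_one z).le, Set.mem_iInter.2 fun k => ?_⟩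
    exact R.mem_F.1 hz k
  obtain ⟨x, hx, hmax⟩ := hC.exists_isMaxOn ⟨_, hF _ (R.V_mem_F hg 0)⟩ continuous_norm.continuousOn
  refine ⟨‖x‖, lt_of_le_of_ne (mem_closedBall_zero_iff.1 hx.1) fun h1 => ?_, fun z hz =>
    (norm_le_norm_klein z).trans (hmax (hF z hz))⟩
  obtain ⟨k, hk⟩ := R.exists_orient_neg hg ⟨x, mem_sphere_zero_iff_norm.2 h1⟩
  exact absurd (Set.mem_iInter.1 hx.2 k) (not_le.2 hk)

theorem isClosed_F : IsClosed R.F := by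
  have : R.F = ⋂ k, {z | 0 ≤ orient (R.P k) (R.Q (k + 1)) (klein z)} := by
    ext z
    rw [mem_F, Set.mem_iInter]
    rfl
  rw [this]
  exact isClosed_iInter fun k =>
    isClosed_le continuous_const ((continuous_orient _ _).comp continuous_klein)

theorem isClosed_times (v : UnitTangent) : IsClosed {t : ℝ | (flow t v).base ∈ R.F} :=
  R.isClosed_F.preimage v.continuous_flow_base

theorem exists_eventually_notMem (hg : 2 ≤ g) (v : UnitTangent) :
    (∀ᶠ t in atBot, (flow t v).base ∉ R.F) ∧ ∀ᶠ t in atTop, (flow t v).base ∉ R.F := by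
  obtain ⟨r, hr, h⟩ := R.exists_norm_le hg
  constructor
  · have := v.tendsto_bwd.norm
    rw [Circle.norm_coe] at this
    filter_upwards [this.eventually (lt_mem_nhds hr)] with t ht hF
    exact absurd (h _ hF) (not_le.2 ht)
  · have := v.tendsto_fwd.norm
    rw [Circle.norm_coe] at this
    filter_upwards [this.eventually (lt_mem_nhds hr)] with t ht hF
    exact absurd (h _ hF) (not_le.2 ht)

theorem bddBelow_times (hg : 2 ≤ g) (v : UnitTangent) :
    BddBelow {t : ℝ | (flow t v).base ∈ R.F} := by
  obtain ⟨a, ha⟩ := eventually_atBot.1 (R.exists_eventually_notMem hg v).1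
  exact ⟨a, fun t ht => le_of_not_ge fun hta => ha t hta ht⟩

theorem bddAbove_times (hg : 2 ≤ g) (v : UnitTangent) :
    BddAbove {t : ℝ | (flow t v).base ∈ R.F} := by
  obtain ⟨a, ha⟩ := eventually_atTop.1 (R.exists_eventually_notMem hg v).2
  exact ⟨a, fun t ht => le_of_not_ge fun hta => ha t hta ht⟩

theorem ordConnected_times (v : UnitTangent) : {t : ℝ | (flow t v).base ∈ R.F}.OrdConnected := by
  refine ⟨fun s hs t ht m hm => ?_⟩
  have hs' := R.mem_F.1 hs
  have ht' := R.mem_F.1 ht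
  refine R.mem_F.2 fun k => ?_
  have h1 := (v.flow_mem_leftHalfPlane (R.P k) (R.Q (k + 1)) s).1 (hs' k)
  have h2 := (v.flow_mem_leftHalfPlane (R.P k) (R.Q (k + 1)) t).1 (ht' k)
  refine (v.flow_mem_leftHalfPlane (R.P k) (R.Q (k + 1)) m).2 ?_
  have r1 := v.ratio_strictMono.monotone hm.1
  have r2 := v.ratio_strictMono.monotone hm.2
  rcases le_total 0 (orient (R.P k) (R.Q (k + 1)) v.fwd) with h | h <;> nlinarith

/-- A geodesic that meets the polygon enters it. -/
theorem exists_enters (hg : 2 ≤ g) {u w : Circle} (h : (u, w) ∈ OmegaGeo R.F) :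
    ∃ v : UnitTangent, v.Joins u w ∧ v.Enters R.F := by
  obtain ⟨_, hz, v, rfl, hv⟩ := h
  refine ⟨flow (sInf {t : ℝ | (flow t v).base ∈ R.F}) v, hv.flow _, ?_⟩
  rw [enters_flow_iff]
  exact isGLB_csInf ⟨0, by rw [Set.mem_ofPred_eq, flow_zero]; exact hz⟩ (R.bddBelow_times hg v)

end FundamentalPolygon

theorem IsChart.mem_arc_of_lt {κ : Circle → ℝ} (h : IsChart κ) {x y z : Circle} (hxy : κ x < κ y) :
    z ∈ arc x y ↔ κ x ≤ κ z ∧ κ z ≤ κ y := by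
  rw [h.mem_arc]
  simp only [Cyc]
  grind

theorem IsChart.mem_arc_of_gt {κ : Circle → ℝ} (h : IsChart κ) {x y z : Circle} (hxy : κ y < κ x) :
    z ∈ arc x y ↔ κ x ≤ κ z ∨ κ z ≤ κ y := by
  rw [h.mem_arc]
  simp only [Cyc]
  grind

/-- Two functions linear in `r` with slopes of opposite weak signs can both be nonnegative at `r`
and both nonpositive at `r'` only if `r = r'`, unless one of them vanishes identically. -/
theorem eq_or_eq_zero_of_signs {A₁ B₁ A₂ B₂ r r' : ℝ}
    (h : (A₁ ≤ 0 ∧ 0 ≤ B₁ ∧ 0 ≤ A₂ ∧ B₂ ≤ 0) ∨ (0 ≤ A₁ ∧ B₁ ≤ 0 ∧ A₂ ≤ 0 ∧ 0 ≤ B₂))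
    (h1 : 0 ≤ A₁ + r * B₁) (h2 : 0 ≤ A₂ + r * B₂)
    (h1' : A₁ + r' * B₁ ≤ 0) (h2' : A₂ + r' * B₂ ≤ 0) :
    r = r' ∨ (A₁ = 0 ∧ B₁ = 0) ∨ (A₂ = 0 ∧ B₂ = 0) := by
  by_cases b1 : B₁ = 0
  · rw [b1, mul_zero, add_zero] at h1 h1'
    exact Or.inr (Or.inl ⟨le_antisymm h1' h1, b1⟩)
  by_cases b2 : B₂ = 0
  · rw [b2, mul_zero, add_zero] at h2 h2'
    exact Or.inr (Or.inr ⟨le_antisymm h2' h2, b2⟩)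
  left
  have e1 : 0 ≤ (r - r') * B₁ := by linarith
  have e2 : 0 ≤ (r - r') * B₂ := by linarith
  rcases h with ⟨-, hB1, -, hB2⟩ | ⟨-, hB1, -, hB2⟩
  · have := nonneg_of_mul_nonneg_left e1 (lt_of_le_of_ne hB1 (Ne.symm b1))
    have := nonpos_of_mul_nonneg_left e2 (lt_of_le_of_ne hB2 b2)
    linarith
  · have := nonpos_of_mul_nonneg_left e1 (lt_of_le_of_ne hB1 b1)
    have := nonneg_of_mul_nonneg_left e2 (lt_of_le_of_ne hB2 (Ne.symm b2))
    linarith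

theorem false_of_signs {A₁ B₁ A₂ B₂ r r' : ℝ}
    (h : (A₁ ≤ 0 ∧ 0 ≤ B₁ ∧ 0 ≤ A₂ ∧ B₂ ≤ 0) ∨ (0 ≤ A₁ ∧ B₁ ≤ 0 ∧ A₂ ≤ 0 ∧ 0 ≤ B₂))
    (h1 : 0 < A₁ + r * B₁) (h2 : 0 < A₂ + r * B₂)
    (h1' : A₁ + r' * B₁ ≤ 0) (h2' : A₂ + r' * B₂ ≤ 0) : False := by
  have e1 : 0 < (r - r') * B₁ := by linarith
  have e2 : 0 < (r - r') * B₂ := by linarith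
  rcases h with ⟨-, hB1, -, hB2⟩ | ⟨-, hB1, -, hB2⟩ <;> rcases le_total r r' with h | h <;>
    have h' := sub_nonneg.2 h
  · linarith [mul_nonneg h' hB1]
  · linarith [mul_nonpos_of_nonneg_of_nonpos h' hB2]
  · linarith [mul_nonneg h' hB2]
  · linarith [mul_nonpos_of_nonneg_of_nonpos h' hB1]

namespace FundamentalPolygon

variable {g : ℕ} {Γ : Subgroup SU11} (R : FundamentalPolygon g Γ)

/-! ### Geodesics that pass near a vertex -/

/-- The geodesics from the arc `[P (j - 1), P j]` to the arc `[Q j, Q (j + 1)]`, which pass near the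
vertex `V j`. -/
def NearVertex (j : SideIndex g) (u w : Circle) : Prop :=
  u ∈ arc (R.P (j - 1)) (R.P j) ∧ w ∈ arc (R.Q j) (R.Q (j + 1))

/-- `U (τ j)` carries the arc `[P (j - 1), P j]` onto `[Q (τ j), Q (τ j + 1)]` and `[Q j, Q (j +
1)]` onto `[P (τ j - 1), P (τ j)]`; hence the roles of the endpoints are exchanged. -/
theorem NearVertex.smul {R : FundamentalPolygon g Γ} (hg : 2 ≤ g) {j : SideIndex g} {u w : Circle}
    (h : R.NearVertex j u w) : R.NearVertex (tauIdx j) (R.U (tauIdx j) • w) (R.U (tauIdx j) • u) := by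
  have h1 := (R.U (tauIdx j)).smul_arc h.1
  have h2 := (R.U (tauIdx j)).smul_arc h.2
  have a := R.U_Q hg (tauIdx j)
  have b := R.U_P_prev hg (tauIdx j)
  have c := R.U_Q_next hg (tauIdx j)
  have d := R.U_P hg (tauIdx j)
  rw [tauIdx_tauIdx hg] at a b c d
  rw [b, d] at h1
  rw [a, c] at h2
  exact ⟨h2, h1⟩

theorem NearVertex.ne {R : FundamentalPolygon g Γ} (hg : 2 ≤ g) {j : SideIndex g} {u w : Circle}
    (h : R.NearVertex j u w) : u ≠ w := by
  obtain ⟨κ, hκ⟩ := R.exists_localChart hg j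
  have := hκ.p1
  have := hκ.q1
  have := hκ.p
  have := hκ.q
  have := hκ.p1'
  have h1 := (hκ.mem_arc_of_lt (by linarith)).1 h.1
  have h2 := (hκ.mem_arc_of_lt (by linarith)).1 h.2
  rw [ne_eq, hκ.eq_iff]
  grind

/-- `V (j + 3)` lies on the chord from `P (j + 2)` to `Q (j + 3)`, both of which come after `Q (j +
1)` and before `P (j - 1)`. It serves as a witness that part of the polygon is to the left of `uw`.
-/
theorem NearVertex.orient_far {R : FundamentalPolygon g Γ} (hg : 2 ≤ g) {j : SideIndex g}
    {u w : Circle} (h : R.NearVertex j u w) : 0 < orient u w (klein (R.V (j + 3))) := by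
  obtain ⟨κ, hκ⟩ := R.exists_localChart hg j
  have := hκ.p1
  have := hκ.q1
  have := hκ.p
  have := hκ.q
  have := hκ.p1'
  have := hκ.q1'
  have := hκ.p2'
  have := hκ.q2'
  have := hκ.p3'
  have h1 := (hκ.mem_arc_of_lt (by linarith)).1 h.1
  have h2 := (hκ.mem_arc_of_lt (by linarith)).1 h.2
  have hV := R.V_mem_right (j + 3)
  rw [show j + 3 - 1 = j + 2 by ring] at hV
  obtain ⟨s, t, hs, ht, -, -, hc⟩ := exists_combo_of_mem_geodesicLine hV
  rw [hc]
  have a := (hκ.pos u w (R.P (j + 2))).2 (by simp only [Cyc]; grind)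
  have b := (hκ.pos u w (R.Q (j + 3))).2 (by simp only [Cyc]; grind)
  positivity

/-- A geodesic near the vertex `V j` meets the polygon or its image under `U j`. -/
theorem NearVertex.smul_mem_OmegaGeo {R : FundamentalPolygon g Γ} (hg : 2 ≤ g) {j : SideIndex g}
    {u w : Circle} (h : R.NearVertex j u w) (hF : (u, w) ∉ OmegaGeo R.F) :
    (R.U (tauIdx j) • u, R.U (tauIdx j) • w) ∈ OmegaGeo R.F := by
  -- Since `V (j + 3)` is to the left, a geodesic missing the polygon must also have `V j` to its
  -- left.
  have hV : 0 < orient u w (klein (R.V j)) := by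
    by_contra hV
    exact hF (R.exists_mem_F_of_sides (h.ne hg) (R.V_mem_F hg (j + 3)) (R.V_mem_F hg j)
      (h.orient_far hg).le (not_lt.1 hV))
  obtain ⟨c, hc, e⟩ := (R.U (tauIdx j)).exists_orient_klein_smul u w (R.V j)
  have hU := R.U_V hg (tauIdx j)
  rw [tauIdx_tauIdx hg] at hU
  rw [hU] at e
  have h1 : 0 < orient (R.U (tauIdx j) • u : Circle) (R.U (tauIdx j) • w : Circle)
      (klein (R.V (tauIdx j))) := by rw [e]; positivity
  -- After `U (τ j)` the endpoints are exchanged, so `V (τ j + 3)` is to the right, while `V (τ j)`,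
  -- the image of `V j`, is still to the left.
  have h2 := (h.smul hg).orient_far hg
  rw [orient_swap] at h2
  exact R.exists_mem_F_of_sides ((h.smul hg).ne hg).symm (R.V_mem_F hg _) (R.V_mem_F hg (tauIdx j + 3))
    h1.le (by linarith)

/-- Along the geodesic the functions of sides `j - 1` and `j` change in opposite directions, and
either vanishes identically only if the geodesic is the line of that side. -/
theorem NearVertex.signs {R : FundamentalPolygon g Γ} (hg : 2 ≤ g) {j : SideIndex g} {u w : Circle}
    (h : R.NearVertex j u w) :
    (orient (R.P (j - 1)) (R.Q j) u ≤ 0 ∧ 0 ≤ orient (R.P (j - 1)) (R.Q j) w ∧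
      0 ≤ orient (R.P j) (R.Q (j + 1)) u ∧ orient (R.P j) (R.Q (j + 1)) w ≤ 0) ∧
    (orient (R.P (j - 1)) (R.Q j) u = 0 → orient (R.P (j - 1)) (R.Q j) w = 0 →
      u = R.P (j - 1) ∧ w = R.Q j) ∧
    (orient (R.P j) (R.Q (j + 1)) u = 0 → orient (R.P j) (R.Q (j + 1)) w = 0 →
      u = R.P j ∧ w = R.Q (j + 1)) := by
  obtain ⟨κ, hκ⟩ := R.exists_localChart hg j
  have := hκ.p1
  have := hκ.q1
  have := hκ.p
  have := hκ.q
  have := hκ.p1'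
  have h1 := (hκ.mem_arc_of_lt (by linarith)).1 h.1
  have h2 := (hκ.mem_arc_of_lt (by linarith)).1 h.2
  rw [hκ.nonneg, hκ.nonneg, hκ.nonpos, hκ.nonpos]
  simp only [orient_circle_eq_zero_iff, hκ.eq_iff, Cyc]
  grind

/-- The opposite tile lies in the vertically opposite angle at `V j`, to the right of both lines
through this vertex. -/
theorem orient_nonpos_of_U_smul_mem (hg : 2 ≤ g) {j : SideIndex g} {z : Complex.UnitDisc}
    (h : R.U (tauIdx j) • z ∈ R.F) :
    orient (R.P (j - 1)) (R.Q j) (klein z) ≤ 0 ∧ orient (R.P j) (R.Q (j + 1)) (klein z) ≤ 0 := by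
  have a := R.U_Q hg (tauIdx j)
  have b := R.U_P_prev hg (tauIdx j)
  have c := R.U_Q_next hg (tauIdx j)
  have d := R.U_P hg (tauIdx j)
  rw [tauIdx_tauIdx hg] at a b c d
  have h1 := R.mem_F.1 h (tauIdx j - 1)
  have h2 := R.mem_F.1 h (tauIdx j)
  rw [sub_add_cancel, ← a, ← b] at h1
  rw [← c, ← d] at h2
  have h1' := (SU11.smul_mem_leftHalfPlane _ _ _ _).1 h1
  have h2' := (SU11.smul_mem_leftHalfPlane _ _ _ _).1 h2
  simp only [leftHalfPlane, Set.mem_ofPred_eq] at h1' h2'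
  rw [orient_swap] at h1' h2'
  constructor <;> linarith

theorem NearVertex.signs_of_joins {R : FundamentalPolygon g Γ} (hg : 2 ≤ g) {j : SideIndex g}
    {u w : Circle} (h : R.NearVertex j u w) {v : UnitTangent} (hv : v.Joins u w ∨ v.Joins w u) :
    (orient (R.P (j - 1)) (R.Q j) v.bwd ≤ 0 ∧ 0 ≤ orient (R.P (j - 1)) (R.Q j) v.fwd ∧
      0 ≤ orient (R.P j) (R.Q (j + 1)) v.bwd ∧ orient (R.P j) (R.Q (j + 1)) v.fwd ≤ 0) ∨
    (0 ≤ orient (R.P (j - 1)) (R.Q j) v.bwd ∧ orient (R.P (j - 1)) (R.Q j) v.fwd ≤ 0 ∧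
      orient (R.P j) (R.Q (j + 1)) v.bwd ≤ 0 ∧ 0 ≤ orient (R.P j) (R.Q (j + 1)) v.fwd) := by
  obtain ⟨h1, h2, h3, h4⟩ := (h.signs hg).1
  rcases hv with hv | hv
  · obtain ⟨rfl, rfl⟩ := (v.joins_iff _ _).1 hv
    exact Or.inl ⟨h1, h2, h3, h4⟩
  · obtain ⟨rfl, rfl⟩ := (v.joins_iff _ _).1 hv
    exact Or.inr ⟨h2, h1, h4, h3⟩

/-- A geodesic near the vertex `V j` that is not on a side and meets both the polygon and its image
under `U j` meets them in the same point. -/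
theorem NearVertex.eq_of_mem {R : FundamentalPolygon g Γ} (hg : 2 ≤ g) {j : SideIndex g}
    {u w : Circle} (h : R.NearVertex j u w) (h1 : ¬ (u = R.P (j - 1) ∧ w = R.Q j))
    (h2 : ¬ (u = R.P j ∧ w = R.Q (j + 1))) {v : UnitTangent} (hv : v.Joins u w ∨ v.Joins w u)
    {s t : ℝ} (hs : (flow s v).base ∈ R.F) (ht : R.U (tauIdx j) • (flow t v).base ∈ R.F) :
    s = t := by
  have a1 := R.mem_F.1 hs (j - 1)
  have a2 := R.mem_F.1 hs j
  rw [sub_add_cancel] at a1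
  obtain ⟨b1, b2⟩ := R.orient_nonpos_of_U_smul_mem hg ht
  have c1 := (v.flow_mem_leftHalfPlane _ _ s).1 a1
  have c2 := (v.flow_mem_leftHalfPlane _ _ s).1 a2
  have d1 := mt (v.orient_flow_pos _ _ t).2 (not_lt.2 b1)
  have d2 := mt (v.orient_flow_pos _ _ t).2 (not_lt.2 b2)
  rcases eq_or_eq_zero_of_signs (h.signs_of_joins hg hv) c1 c2
    (not_lt.1 d1) (not_lt.1 d2) with e | ⟨e1, e2⟩ | ⟨e1, e2⟩
  · exact v.ratio_strictMono.injective e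
  · rcases hv with hv | hv <;> obtain ⟨rfl, rfl⟩ := (v.joins_iff _ _).1 hv
    · exact absurd ((h.signs hg).2.1 e1 e2) h1
    · exact absurd ((h.signs hg).2.1 e2 e1) h1
  · rcases hv with hv | hv <;> obtain ⟨rfl, rfl⟩ := (v.joins_iff _ _).1 hv
    · exact absurd ((h.signs hg).2.2 e1 e2) h2
    · exact absurd ((h.signs hg).2.2 e2 e1) h2

theorem NearVertex.not_mem_of_mem_interior {R : FundamentalPolygon g Γ} (hg : 2 ≤ g)
    {j : SideIndex g} {u w : Circle} (h : R.NearVertex j u w) {v : UnitTangent}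
    (hv : v.Joins u w ∨ v.Joins w u) {s t : ℝ} (hs : (flow s v).base ∈ interior R.F) :
    R.U (tauIdx j) • (flow t v).base ∉ R.F := by
  intro ht
  have a1 := (R.mem_interior_F hg).1 hs (j - 1)
  have a2 := (R.mem_interior_F hg).1 hs j
  rw [sub_add_cancel] at a1
  obtain ⟨b1, b2⟩ := R.orient_nonpos_of_U_smul_mem hg ht
  have c1 := (v.orient_flow_pos _ _ s).1 a1
  have c2 := (v.orient_flow_pos _ _ s).1 a2
  have d1 := mt (v.orient_flow_pos _ _ t).2 (not_lt.2 b1)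
  have d2 := mt (v.orient_flow_pos _ _ t).2 (not_lt.2 b2)
  exact false_of_signs (h.signs_of_joins hg hv) c1 c2 (not_lt.1 d1) (not_lt.1 d2)

/-! ### The position of a geodesic -/

theorem exists_mem_arc (hg : 2 ≤ g) (w : Circle) :
    ∃ i, w ∈ arc (R.P i) (R.Q i) ∨ w ∈ arc (R.Q i) (R.P (i + 1)) := by
  have := neZero_sideIndex hg
  obtain ⟨k, hk⟩ := Finite.exists_max fun k => angleFrom w (R.P k)
  obtain ⟨κ, h⟩ := R.exists_localChart hg k
  have hw := isChart_angleFrom w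
  have h0 := angleFrom_self w
  have hn := angleFrom_nonneg w
  have c1 := (hw.pos _ _ _).1 (R.Q_order k)
  have h1 := hn (R.P (k + 1))
  have h2 := hk (k + 1)
  have h3 := hn (R.Q k)
  refine ⟨k, ?_⟩
  rw [hw.mem_arc, hw.mem_arc]
  rw [h0]
  simp only [Cyc] at *
  grind

/-- A geodesic from the right of a side to the right of the same side that meets the polygon is on
the side. -/
theorem eq_of_mem_OmegaGeo {k : SideIndex g} {u w : Circle}
    (hu : orient (R.P k) (R.Q (k + 1)) u ≤ 0) (hw : orient (R.P k) (R.Q (k + 1)) w ≤ 0)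
    (h : (u, w) ∈ OmegaGeo R.F) :
    (u = R.P k ∧ w = R.Q (k + 1)) ∨ (u = R.Q (k + 1) ∧ w = R.P k) := by
  obtain ⟨z, hz, hzl⟩ := h
  have huw := (mem_geodesicLine_iff.1 hzl).1
  obtain ⟨s, t, hs, ht, -, -, hc⟩ := exists_combo_of_mem_geodesicLine hzl
  have h1 := R.mem_F.1 hz k
  rw [hc] at h1
  have h2 := mul_nonpos_of_nonneg_of_nonpos hs.le hu
  have h3 := mul_nonpos_of_nonneg_of_nonpos ht.le hw
  have h4 : s * orient (R.P k) (R.Q (k + 1)) u = 0 := by linarith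
  have h5 : t * orient (R.P k) (R.Q (k + 1)) w = 0 := by linarith
  rw [mul_eq_zero, or_iff_right hs.ne', orient_circle_eq_zero_iff] at h4
  rw [mul_eq_zero, or_iff_right ht.ne', orient_circle_eq_zero_iff] at h5
  have hne : R.P k ≠ R.Q (k + 1) := (mem_geodesicLine_iff.1 (R.V_left k)).1
  grind

variable {G : SideIndex g → Circle}

theorem mem_Omega {u w : Circle} : (u, w) ∈ R.Omega G ↔
    ∃ i, (u ∈ arc (R.H G (i + 1)) (G (i - 2)) ∧ w ∈ arc (R.P i) (R.Q i)) ∨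
      (u ∈ arc (R.H G (i + 1)) (G (i - 1)) ∧ w ∈ arc (R.Q i) (R.P (i + 1))) := by
  simp only [Omega, Set.mem_iUnion, Set.mem_union, Set.mem_prod]

theorem H_mem_arc (hg : 2 ≤ g) (hG : ∀ k, G k ∈ arc (R.P k) (R.P (k + 1))) (j : SideIndex g) :
    R.H G j ∈ arc (R.Q j) (R.Q (j + 1)) := by
  have h := (R.U j).smul_arc (hG (tauIdx j - 1))
  rwa [sub_add_cancel, R.U_P_prev hg, R.U_P hg] at h

end FundamentalPolygon

/-! ### The rectangles of `Omega` compared with the geodesics that meet the polygon -/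

namespace FundamentalPolygon

variable {g : ℕ} {Γ : Subgroup SU11} (R : FundamentalPolygon g Γ) {G : SideIndex g → Circle}

/-- The rectangles with index `j - 1` start at `H j` and extend beyond `Q (j + 1)`, because the
points `G (j - 3)` and `G (j - 2)` come later. -/
theorem mem_Omega_of_P (hg : 2 ≤ g) (hG : ∀ k, G k ∈ arc (R.P k) (R.P (k + 1))) {j : SideIndex g}
    {u w : Circle} (hu : u ∈ arc (R.H G j) (R.Q (j + 1))) (hw : w ∈ arc (R.P (j - 1)) (R.P j)) :
    (u, w) ∈ R.Omega G := by
  obtain ⟨κ, hκ⟩ := R.exists_localChart hg j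
  have := hκ.p3
  have := hκ.q3
  have := hκ.p2
  have := hκ.q2
  have := hκ.p1
  have := hκ.q1
  have := hκ.p
  have := hκ.q
  have := hκ.p1'
  have hH := (hκ.mem_arc_of_lt (by linarith)).1 (R.H_mem_arc hg hG j)
  have g3 := hG (j - 3)
  have g2 := hG (j - 2)
  rw [show j - 3 + 1 = j - 2 by ring, hκ.mem_arc_of_lt (by linarith)] at g3
  rw [show j - 2 + 1 = j - 1 by ring, hκ.mem_arc_of_lt (by linarith)] at g2
  rw [hκ.mem_arc_of_lt (by linarith)] at hw
  rw [mem_Omega]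
  refine ⟨j - 1, ?_⟩
  rw [sub_add_cancel, show j - 1 - 2 = j - 3 by ring, show j - 1 - 1 = j - 2 by ring,
    hκ.mem_arc_of_gt (by linarith), hκ.mem_arc_of_lt (by linarith),
    hκ.mem_arc_of_gt (by linarith), hκ.mem_arc_of_lt (by linarith)]
  rw [hκ.mem_arc] at hu
  simp only [Cyc] at hu
  grind

/-- According to the position of `w` relative to `P (j + 1)`, the second rectangle with index `j` or
the first with index `j + 1` applies; both end at `G (j - 1)`. -/
theorem mem_Omega_of_Q (hg : 2 ≤ g) (hG : ∀ k, G k ∈ arc (R.P k) (R.P (k + 1))) {j : SideIndex g}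
    {u w : Circle} (hu : u ∈ arc (R.P (j - 1)) (G (j - 1))) (hw : w ∈ arc (R.Q j) (R.Q (j + 1))) :
    (u, w) ∈ R.Omega G := by
  obtain ⟨κ, hκ⟩ := R.exists_localChart hg j
  have := hκ.p1
  have := hκ.q1
  have := hκ.p
  have := hκ.q
  have := hκ.p1'
  have := hκ.q1'
  have := hκ.p2'
  have := hκ.q2'
  have := hκ.p3'
  have h1 := R.H_mem_arc hg hG (j + 1)
  have h2 := R.H_mem_arc hg hG (j + 2)
  rw [show j + 1 + 1 = j + 2 by ring, hκ.mem_arc_of_lt (by linarith)] at h1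
  rw [show j + 2 + 1 = j + 3 by ring, hκ.mem_arc_of_lt (by linarith)] at h2
  have g1 := hG (j - 1)
  rw [sub_add_cancel, hκ.mem_arc_of_lt (by linarith)] at g1
  rw [hκ.mem_arc_of_lt (by linarith)] at hw
  rw [hκ.mem_arc] at hu
  simp only [Cyc] at hu
  rw [mem_Omega]
  rcases le_total (κ w) (κ (R.P (j + 1))) with hwP | hwP
  · refine ⟨j, Or.inr ?_⟩
    rw [hκ.mem_arc_of_gt (by linarith), hκ.mem_arc_of_lt (by linarith)]
    grind
  · refine ⟨j + 1, Or.inl ?_⟩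
    rw [show j + 1 + 1 = j + 2 by ring, show j + 1 - 2 = j - 1 by ring,
      hκ.mem_arc_of_gt (by linarith), hκ.mem_arc_of_lt (by linarith)]
    grind

/-- `U (τ j)` carries `G (j - 1)` to `H (τ j)`, so the part of the arc that `Omega` omits beyond `G
(j - 1)` becomes a part that it contains after `H (τ j)`. -/
theorem smul_mem_Omega_of_P (hg : 2 ≤ g) (hG : ∀ k, G k ∈ arc (R.P k) (R.P (k + 1)))
    {j : SideIndex g} {u w : Circle} (hu : u ∈ arc (G (j - 1)) (R.P j))
    (hw : w ∈ arc (R.Q j) (R.Q (j + 1))) :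
    (R.U (tauIdx j) • u, R.U (tauIdx j) • w) ∈ R.Omega G := by
  have h1 := (R.U (tauIdx j)).smul_arc hu
  have h2 := (R.U (tauIdx j)).smul_arc hw
  have a := R.U_Q hg (tauIdx j)
  have c := R.U_Q_next hg (tauIdx j)
  have d := R.U_P hg (tauIdx j)
  rw [tauIdx_tauIdx hg] at a c d
  have e : R.U (tauIdx j) • G (j - 1) = R.H G (tauIdx j) := by rw [H, tauIdx_tauIdx hg]
  rw [e, d] at h1
  rw [a, c] at h2
  exact R.mem_Omega_of_P hg hG h1 h2

/-- Likewise `U (τ j)` carries `H j` to `G (τ j - 1)`, and the omitted part before `H j` becomes a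
contained part before `G (τ j - 1)`. -/
theorem smul_mem_Omega_of_Q (hg : 2 ≤ g) (hG : ∀ k, G k ∈ arc (R.P k) (R.P (k + 1)))
    {j : SideIndex g} {u w : Circle} (hu : u ∈ arc (R.Q j) (R.H G j))
    (hw : w ∈ arc (R.P (j - 1)) (R.P j)) :
    (R.U (tauIdx j) • u, R.U (tauIdx j) • w) ∈ R.Omega G := by
  have h1 := (R.U (tauIdx j)).smul_arc hu
  have h2 := (R.U (tauIdx j)).smul_arc hw
  have a := R.U_Q hg (tauIdx j)
  have b := R.U_P_prev hg (tauIdx j)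
  have d := R.U_P hg (tauIdx j)
  rw [tauIdx_tauIdx hg] at a b d
  rw [a, H, R.U_U_circle hg] at h1
  rw [b, d] at h2
  exact R.mem_Omega_of_Q hg hG h1 h2

theorem side_mem_Omega (hg : 2 ≤ g) (hG : ∀ k, G k ∈ arc (R.P k) (R.P (k + 1))) (k : SideIndex g) :
    (R.P k, R.Q (k + 1)) ∈ R.Omega G ∧ (R.Q (k + 1), R.P k) ∈ R.Omega G := by
  constructor
  · apply R.mem_Omega_of_Q hg hG (j := k + 1)
    · rw [add_sub_cancel_right]; exact Or.inl rfl
    · exact Or.inl rfl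
  · exact R.mem_Omega_of_P hg hG (j := k) (Or.inr (Or.inl rfl)) (Or.inr (Or.inl rfl))

/-- The geodesics of `Omega` that do not meet the polygon pass near a vertex. -/
theorem exists_nearVertex (hg : 2 ≤ g) (hG : ∀ k, G k ∈ arc (R.P k) (R.P (k + 1))) {u w : Circle}
    (h : (u, w) ∈ R.Omega G) (hF : (u, w) ∉ OmegaGeo R.F) :
    (∃ j, R.NearVertex j u w) ∨ ∃ j, R.NearVertex j w u := by
  obtain ⟨i, hi⟩ := R.mem_Omega.1 h
  obtain ⟨κ, hκ⟩ := R.exists_localChart hg i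
  have := hκ.p3
  have := hκ.q3
  have := hκ.p2
  have := hκ.q2
  have := hκ.p1
  have := hκ.q1
  have := hκ.p
  have := hκ.q
  have := hκ.p1'
  have := hκ.q1'
  have := hκ.p2'
  have := hκ.q2'
  have := hκ.p3'
  have h1 := R.H_mem_arc hg hG (i + 1)
  rw [show i + 1 + 1 = i + 2 by ring, hκ.mem_arc_of_lt (by linarith)] at h1
  have g2 := hG (i - 2)
  have g1 := hG (i - 1)
  rw [show i - 2 + 1 = i - 1 by ring, hκ.mem_arc_of_lt (by linarith)] at g2
  rw [sub_add_cancel, hκ.mem_arc_of_lt (by linarith)] at g1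
  rw [hκ.mem_arc_of_gt (by linarith), hκ.mem_arc_of_lt (by linarith),
    hκ.mem_arc_of_gt (by linarith), hκ.mem_arc_of_lt (by linarith)] at hi
  by_cases lower : κ (R.Q (i + 1)) ≤ κ u ∧ κ u ≤ κ (R.Q (i + 2))
  · refine Or.inr ⟨i + 1, ?_, ?_⟩
    · rw [add_sub_cancel_right, hκ.mem_arc_of_lt (by linarith)]
      grind
    · rw [show i + 1 + 1 = i + 2 by ring, hκ.mem_arc_of_lt (by linarith)]
      exact lower
  have huw : u ≠ w := by
    rw [ne_eq, hκ.eq_iff]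
    grind
  have left : ∀ {x y : Circle} {z : Complex.UnitDisc}, z ∈ geodesicLine x y →
      ¬ Cyc (κ w) (κ u) (κ x) → ¬ Cyc (κ w) (κ u) (κ y) → 0 ≤ orient u w (klein z) := by
    intro x y z hz hx hy
    obtain ⟨s, t, hs, ht, -, -, hc⟩ := exists_combo_of_mem_geodesicLine hz
    rw [hc]
    rw [← hκ.nonneg] at hx hy
    positivity
  have right : ∀ {x y : Circle} {z : Complex.UnitDisc}, z ∈ geodesicLine x y →
      ¬ Cyc (κ u) (κ w) (κ x) → ¬ Cyc (κ u) (κ w) (κ y) → orient u w (klein z) ≤ 0 := by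
    intro x y z hz hx hy
    obtain ⟨s, t, hs, ht, -, -, hc⟩ := exists_combo_of_mem_geodesicLine hz
    rw [hc]
    rw [← hκ.nonpos] at hx hy
    have := mul_nonpos_of_nonneg_of_nonpos hs.le hx
    have := mul_nonpos_of_nonneg_of_nonpos ht.le hy
    linarith
  have v1 := R.V_mem_left (i + 1)
  have v0 := R.V_mem_right i
  have v' := R.V_mem_right (i - 1)
  rw [show i + 1 + 1 = i + 2 by ring] at v1
  rw [show i - 1 - 1 = i - 2 by ring] at v'
  -- Away from the corners, `V (i + 1)` is to the left of `uw`, and `V (i - 1)` in the first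
  -- rectangle or `V i` in the second is to the right, so the geodesic meets the polygon.
  rcases hi with ⟨hu, hw⟩ | ⟨hu, hw⟩
  · by_cases upper : κ (R.P (i - 2)) ≤ κ u ∧ κ u ≤ κ (R.P (i - 1))
    · refine Or.inl ⟨i - 1, ?_, ?_⟩
      · rw [show i - 1 - 1 = i - 2 by ring, hκ.mem_arc_of_lt (by linarith)]
        exact upper
      · rw [sub_add_cancel, hκ.mem_arc_of_lt (by linarith)]
        grind
    · exact absurd (R.exists_mem_F_of_sides huw (R.V_mem_F hg (i + 1)) (R.V_mem_F hg (i - 1))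
        (left v1 (by simp only [Cyc]; grind) (by simp only [Cyc]; grind))
        (right v' (by simp only [Cyc]; grind) (by simp only [Cyc]; grind))) hF
  · by_cases upper : κ (R.P (i - 1)) ≤ κ u ∧ κ u ≤ κ (R.P i)
    · refine Or.inl ⟨i, ?_, ?_⟩
      · rw [hκ.mem_arc_of_lt (by linarith)]
        exact upper
      · rw [hκ.mem_arc_of_lt (by linarith)]
        grind
    · exact absurd (R.exists_mem_F_of_sides huw (R.V_mem_F hg (i + 1)) (R.V_mem_F hg i)
        (left v1 (by simp only [Cyc]; grind) (by simp only [Cyc]; grind))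
        (right v0 (by simp only [Cyc]; grind) (by simp only [Cyc]; grind))) hF

/-- The geodesics that meet the polygon are in `Omega`, or pass near a vertex and have an image in
`Omega`. -/
theorem mem_Omega_or_smul_mem_Omega (hg : 2 ≤ g) (hG : ∀ k, G k ∈ arc (R.P k) (R.P (k + 1)))
    {u w : Circle} (hF : (u, w) ∈ OmegaGeo R.F) :
    (u, w) ∈ R.Omega G ∨ ∃ j, (R.NearVertex j u w ∨ R.NearVertex j w u) ∧
      (R.U (tauIdx j) • u, R.U (tauIdx j) • w) ∈ R.Omega G := by
  by_cases hΩ : (u, w) ∈ R.Omega G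
  · exact Or.inl hΩ
  right
  -- A geodesic with both endpoints to the right of side `k` that meets the polygon is the line of
  -- this side, which belongs to `Omega` in both directions.
  have side : ∀ k, ¬ (orient (R.P k) (R.Q (k + 1)) u ≤ 0 ∧ orient (R.P k) (R.Q (k + 1)) w ≤ 0) := by
    rintro k ⟨h1, h2⟩
    rcases R.eq_of_mem_OmegaGeo h1 h2 hF with ⟨rfl, rfl⟩ | ⟨rfl, rfl⟩
    · exact hΩ (R.side_mem_Omega hg hG k).1
    · exact hΩ (R.side_mem_Omega hg hG k).2
  obtain ⟨i, hi⟩ := R.exists_mem_arc hg w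
  have hΩi := not_exists.1 (mt R.mem_Omega.2 hΩ) i
  obtain ⟨κ, hκ⟩ := R.exists_localChart hg i
  have := hκ.p2
  have := hκ.q2
  have := hκ.p1
  have := hκ.q1
  have := hκ.p
  have := hκ.q
  have := hκ.p1'
  have := hκ.q1'
  have := hκ.p2'
  have h1 := R.H_mem_arc hg hG (i + 1)
  rw [show i + 1 + 1 = i + 2 by ring, hκ.mem_arc_of_lt (by linarith)] at h1
  have g2 := hG (i - 2)
  have g1 := hG (i - 1)
  rw [show i - 2 + 1 = i - 1 by ring, hκ.mem_arc_of_lt (by linarith)] at g2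
  rw [sub_add_cancel, hκ.mem_arc_of_lt (by linarith)] at g1
  rw [hκ.mem_arc_of_gt (by linarith), hκ.mem_arc_of_lt (by linarith),
    hκ.mem_arc_of_gt (by linarith), hκ.mem_arc_of_lt (by linarith)] at hΩi
  rw [hκ.mem_arc_of_lt (by linarith), hκ.mem_arc_of_lt (by linarith)] at hi
  have s1 := side (i - 1)
  have s0 := side i
  rw [sub_add_cancel, hκ.nonpos, hκ.nonpos] at s1
  rw [hκ.nonpos, hκ.nonpos] at s0
  simp only [Cyc] at s0 s1
  -- The geodesics missed by `Omega` at its lower boundary: `u` lies between `Q (i + 1)` and `H (i +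
  -- 1)`.
  by_cases lower : κ (R.Q (i + 1)) ≤ κ u ∧ κ u ≤ κ (R.H G (i + 1))
  · have hw : w ∈ arc (R.P (i + 1 - 1)) (R.P (i + 1)) := by
      rw [add_sub_cancel_right, hκ.mem_arc_of_lt (by linarith)]
      grind
    refine ⟨i + 1, Or.inr ⟨hw, ?_⟩, R.smul_mem_Omega_of_Q hg hG ?_ hw⟩
    · rw [show i + 1 + 1 = i + 2 by ring, hκ.mem_arc_of_lt (by linarith)]
      grind
    · rw [hκ.mem_arc]
      simp only [Cyc]
      grind
  -- What remains is missed at the upper boundary: `u` is beyond `G (i - 2)` or `G (i - 1)`, while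
  -- `side` keeps it from passing `P (i - 1)` or `P i`.
  rcases hi with hw | hw
  · have hu : κ (G (i - 2)) ≤ κ u ∧ κ u ≤ κ (R.P (i - 1)) := by grind
    have hw' : w ∈ arc (R.Q (i - 1)) (R.Q (i - 1 + 1)) := by
      rw [sub_add_cancel, hκ.mem_arc_of_lt (by linarith)]
      grind
    refine ⟨i - 1, Or.inl ⟨?_, hw'⟩, R.smul_mem_Omega_of_P hg hG ?_ hw'⟩
    · rw [show i - 1 - 1 = i - 2 by ring, hκ.mem_arc_of_lt (by linarith)]
      grind
    · rw [show i - 1 - 1 = i - 2 by ring, hκ.mem_arc]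
      simp only [Cyc]
      grind
  · have hu : κ (G (i - 1)) ≤ κ u ∧ κ u ≤ κ (R.P i) := by grind
    have hw' : w ∈ arc (R.Q i) (R.Q (i + 1)) := by
      rw [hκ.mem_arc_of_lt (by linarith)]
      grind
    refine ⟨i, Or.inl ⟨?_, hw'⟩, R.smul_mem_Omega_of_P hg hG ?_ hw'⟩
    · rw [hκ.mem_arc_of_lt (by linarith)]
      grind
    · rw [hκ.mem_arc]
      simp only [Cyc]
      grind

end FundamentalPolygon

theorem tangentProj_smul {Γ : Subgroup SU11} {γ : SU11} (hγ : γ ∈ Γ) (v : UnitTangent) :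
    tangentProj Γ (γ • v) = tangentProj Γ v :=
  Quotient.sound (s := MulAction.orbitRel Γ UnitTangent) ⟨⟨γ, hγ⟩, rfl⟩

/-- Two arcs between consecutive points of a cyclically ordered family have at most an endpoint in
common. -/
theorem eq_of_mem_arc_of_mem_arc {g : ℕ} (hg : 2 ≤ g) {X : SideIndex g → Circle}
    (hX : ∀ b, ∃ κ, IsChart κ ∧ ∀ m l : ℕ, m < l → l < 8 * g - 4 → κ (X (b + m)) < κ (X (b + l)))
    {i j : SideIndex g} {z : Circle} (hi : z ∈ arc (X i) (X (i + 1)))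
    (hj : z ∈ arc (X j) (X (j + 1))) :
    j = i ∨ (j = i + 1 ∧ z = X j) ∨ (i = j + 1 ∧ z = X i) := by
  have := neZero_sideIndex hg
  obtain ⟨m, hm, rfl⟩ : ∃ m : ℕ, m < 8 * g - 4 ∧ j = i + m :=
    ⟨(j - i).val, (j - i).val_lt, by rw [ZMod.natCast_val, ZMod.cast_id', id, add_sub_cancel]⟩
  obtain ⟨κ, hκ, h⟩ := hX i
  have e0 : i + ((0 : ℕ) : SideIndex g) = i := by simp
  have e1 : i + ((1 : ℕ) : SideIndex g) = i + 1 := by simp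
  have a01 := h 0 1 (by omega) (by omega)
  rw [e0, e1] at a01
  rw [hκ.mem_arc_of_lt a01] at hi
  rcases Nat.eq_zero_or_pos m with rfl | hm0
  · left; simp
  rcases Nat.eq_or_lt_of_le (Nat.succ_le_of_lt hm0) with rfl | hm1
  · rw [Nat.succ_eq_add_one, zero_add, e1] at hj ⊢
    have e2 : i + ((2 : ℕ) : SideIndex g) = i + 1 + 1 := by push_cast; ring
    have a12 := h 1 2 (by omega) (by omega)
    rw [e1, e2] at a12
    rw [hκ.mem_arc_of_lt a12] at hj
    exact Or.inr (Or.inl ⟨rfl, hκ.inj (le_antisymm hi.2 hj.1)⟩)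
  have am := h 1 m (by omega) hm
  rw [e1] at am
  rcases Nat.lt_or_ge (m + 1) (8 * g - 4) with hm2 | hm2
  · have a := h m (m + 1) (by omega) hm2
    rw [Nat.cast_add, Nat.cast_one, ← add_assoc] at a
    rw [hκ.mem_arc_of_lt a] at hj
    linarith
  · have e : i + (m : SideIndex g) + 1 = i := by
      have : m + 1 = 8 * g - 4 := by omega
      rw [add_assoc, ← Nat.cast_one, ← Nat.cast_add, this, ZMod.natCast_self, add_zero]
    rw [e] at hj ⊢
    rw [hκ.mem_arc_of_gt (by linarith)] at hj
    refine Or.inr (Or.inr ⟨rfl, hκ.inj ?_⟩)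
    rcases hj with hj | hj <;> linarith

/-! ### Equality of the arithmetic and the geometric cross-section -/

namespace FundamentalPolygon

variable {g : ℕ} {Γ : Subgroup SU11} (R : FundamentalPolygon g Γ) {G : SideIndex g → Circle}

theorem side_mem_OmegaGeo (hg : 2 ≤ g) (i : SideIndex g) :
    (R.P i, R.Q (i + 1)) ∈ OmegaGeo R.F := ⟨R.V i, R.V_mem_F hg i, R.V_left i⟩

/-- Neighbouring arcs share only an endpoint. If the indices differ, both `u` and `w` are such
common endpoints and the geodesic is the line of a side, which meets the polygon. -/
theorem NearVertex.index_eq {R : FundamentalPolygon g Γ} (hg : 2 ≤ g) {i j : SideIndex g}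
    {u w : Circle} (hi : R.NearVertex i u w) (hj : R.NearVertex j u w)
    (hF : (u, w) ∉ OmegaGeo R.F) : i = j := by
  have hP : ∀ b, ∃ κ, IsChart κ ∧ ∀ m l : ℕ, m < l → l < 8 * g - 4 →
      κ (R.P (b + m)) < κ (R.P (b + l)) := fun b => by
    obtain ⟨κ, hκ, h1, h2⟩ := R.exists_chart hg b
    exact ⟨κ, hκ, fun m l hml hl => (h1 m (by omega)).trans (h2 m l hml hl)⟩
  have hQ : ∀ b, ∃ κ, IsChart κ ∧ ∀ m l : ℕ, m < l → l < 8 * g - 4 →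
      κ (R.Q (b + m)) < κ (R.Q (b + l)) := fun b => by
    obtain ⟨κ, hκ, h1, h2⟩ := R.exists_chart hg b
    exact ⟨κ, hκ, fun m l hml hl => (h2 m l hml hl).trans (h1 l hl)⟩
  have hi1 := hi.1
  have hj1 := hj.1
  rw [← sub_add_cancel i 1, add_sub_cancel_right] at hi1
  rw [← sub_add_cancel j 1, add_sub_cancel_right] at hj1
  have two : (2 : SideIndex g) ≠ 0 := by
    intro h
    have h' : ((2 : ℕ) : SideIndex g) = 0 := by exact_mod_cast h
    rw [ZMod.natCast_eq_zero_iff] at h'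
    have := Nat.le_of_dvd (by omega) h'
    omega
  rcases eq_of_mem_arc_of_mem_arc hg hP hi1 hj1 with h | ⟨h, hu⟩ | ⟨h, hu⟩
  · exact (sub_left_injective h).symm
  · rw [sub_add_cancel] at h
    rcases eq_of_mem_arc_of_mem_arc hg hQ hi.2 hj.2 with h' | ⟨h', hw⟩ | ⟨h', hw⟩
    · exact h'.symm
    · rw [hu, hw, h, h'] at hF
      exact absurd (R.side_mem_OmegaGeo hg i) hF
    · exact absurd (by linear_combination -h - h') two
  · rw [sub_add_cancel] at h
    rcases eq_of_mem_arc_of_mem_arc hg hQ hi.2 hj.2 with h' | ⟨h', hw⟩ | ⟨h', hw⟩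
    · exact h'.symm
    · exact absurd (by linear_combination -h - h') two
    · rw [hu, hw, h, h'] at hF
      exact absurd (R.side_mem_OmegaGeo hg j) hF

theorem NearVertex.not_swap {R : FundamentalPolygon g Γ} (hg : 2 ≤ g) {i j : SideIndex g}
    {u w : Circle} (hi : R.NearVertex i u w) (hF : (u, w) ∉ OmegaGeo R.F) :
    ¬ R.NearVertex j w u := by
  intro hj
  have h1 := hi.orient_far hg
  have h2 := hj.orient_far hg
  rw [orient_swap] at h2
  exact hF (R.exists_mem_F_of_sides (hi.ne hg) (R.V_mem_F hg _) (R.V_mem_F hg (j + 3)) h1.le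
    (by linarith))

theorem index_eq_of_nearVertex (hg : 2 ≤ g) {i j : SideIndex g}
    {u w : Circle} (hi : R.NearVertex i u w ∨ R.NearVertex i w u)
    (hj : R.NearVertex j u w ∨ R.NearVertex j w u) (hF : (u, w) ∉ OmegaGeo R.F) : i = j := by
  have hF' := mt OmegaGeo_swap.1 hF
  rcases hi with hi | hi <;> rcases hj with hj | hj
  · exact hi.index_eq hg hj hF
  · exact absurd hj (hi.not_swap hg hF)
  · exact absurd hi (hj.not_swap hg hF)
  · exact hi.index_eq hg hj hF'

theorem U_U_tangent' (hg : 2 ≤ g) (i : SideIndex g) (v : UnitTangent) :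
    R.U i • R.U (tauIdx i) • v = v := by
  have := R.isCentral_U_U hg (tauIdx i)
  rw [tauIdx_tauIdx hg] at this
  rw [← mul_smul]
  exact this.smul_tangent v

theorem enters_U_image (hg : 2 ≤ g) (j : SideIndex g) (v : UnitTangent) (K : Set Complex.UnitDisc) :
    v.Enters ((fun z => R.U j • z) '' K) ↔ (R.U (tauIdx j) • v).Enters K := by
  have := SU11.smul_enters_image (R.U j) (R.U (tauIdx j) • v) K
  rwa [R.U_U_tangent' hg] at this

/-- Both kinds of corner become one condition up to exchanging endpoints: `C^j` consists of
geodesics near `V j`, and `C_i` of reversed geodesics near `V (i + 1)`. -/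
theorem isArithEntry_iff {K : Set Complex.UnitDisc} {u w : Circle} {v : UnitTangent} :
    R.IsArithEntry G K (u, w) v ↔ v.Joins u w ∧ (((u, w) ∈ OmegaGeo K ∧ v.Enters K) ∨
      ((u, w) ∈ R.Omega G ∧ (u, w) ∉ OmegaGeo K ∧ ∃ j, (R.NearVertex j u w ∨ R.NearVertex j w u) ∧
        v.Enters ((fun z => R.U j • z) '' K))) := by
  refine and_congr Iff.rfl (or_congr Iff.rfl ?_)
  constructor
  · rintro (⟨i, ⟨⟨h1, h2⟩, h3⟩, h4⟩ | ⟨i, ⟨⟨h1, h2⟩, h3, h3'⟩, h4⟩)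
    · exact ⟨h1, h2, i, Or.inl h3, h4⟩
    · refine ⟨h1, h2, i + 1, Or.inr ⟨?_, ?_⟩, h4⟩
      · rw [add_sub_cancel_right]; exact h3'
      · rw [add_assoc, one_add_one_eq_two]; exact h3
  · rintro ⟨h1, h2, j, h3 | ⟨h3, h3'⟩, h4⟩
    · exact Or.inl ⟨j, ⟨⟨h1, h2⟩, h3⟩, h4⟩
    · refine Or.inr ⟨j - 1, ⟨⟨h1, h2⟩, ?_, ?_⟩, ?_⟩
      · rw [sub_add_cancel, show j - 1 + 2 = j + 1 by ring]; exact h3'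
      · rw [sub_add_cancel]; exact h3
      · rw [sub_add_cancel]; exact h4

theorem existsUnique_isArithEntry (hg : 2 ≤ g) (hG : ∀ k, G k ∈ arc (R.P k) (R.P (k + 1)))
    {u w : Circle} (h : (u, w) ∈ R.Omega G) : ∃! v, R.IsArithEntry G R.F (u, w) v := by
  by_cases hF : (u, w) ∈ OmegaGeo R.F
  · obtain ⟨v, hv, hvF⟩ := R.exists_enters hg hF
    refine ⟨v, R.isArithEntry_iff.2 ⟨hv, Or.inl ⟨hF, hvF⟩⟩, fun v' hv' => ?_⟩
    obtain ⟨h1, ⟨-, h2⟩ | ⟨-, h2, -⟩⟩ := R.isArithEntry_iff.1 hv'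
    · exact h1.eq_of_enters hv h2 hvF
    · exact absurd hF h2
  · obtain ⟨j, hj⟩ : ∃ j, R.NearVertex j u w ∨ R.NearVertex j w u := by
      rcases R.exists_nearVertex hg hG h hF with ⟨j, hj⟩ | ⟨j, hj⟩
      · exact ⟨j, Or.inl hj⟩
      · exact ⟨j, Or.inr hj⟩
    have hU : (R.U (tauIdx j) • u, R.U (tauIdx j) • w) ∈ OmegaGeo R.F := by
      rcases hj with hj | hj
      · exact hj.smul_mem_OmegaGeo hg hF
      · exact OmegaGeo_swap.1 (hj.smul_mem_OmegaGeo hg (mt OmegaGeo_swap.1 hF))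
    obtain ⟨v, hv, hvF⟩ := R.exists_enters hg hU
    have hv1 := hv.smul (R.U j)
    rw [R.U_U_circle' hg, R.U_U_circle' hg] at hv1
    have hv2 := (SU11.smul_enters_image (R.U j) v R.F).2 hvF
    refine ⟨R.U j • v, R.isArithEntry_iff.2 ⟨hv1, Or.inr ⟨h, hF, j, hj, hv2⟩⟩, fun v' hv' => ?_⟩
    obtain ⟨h1, ⟨h2, -⟩ | ⟨-, -, i, hi, h2⟩⟩ := R.isArithEntry_iff.1 hv'
    · exact absurd h2 hF
    · obtain rfl := R.index_eq_of_nearVertex hg hi hj hF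
      exact h1.eq_of_enters hv1 h2 hv2

/-- A vector entering `U j K` becomes a vector entering `K` under `U (τ j)`, which lies in `Γ` and
does not change the projection. -/
theorem arithmeticCrossSection_subset (hg : 2 ≤ g) (K : Set Complex.UnitDisc) :
    R.arithmeticCrossSection G K ⊆ geometricCrossSection Γ K := by
  rintro _ ⟨v, ⟨⟨u, w⟩, -, hv⟩, rfl⟩
  obtain ⟨h1, ⟨h2, h3⟩ | ⟨-, -, j, -, h4⟩⟩ := R.isArithEntry_iff.1 hv
  · exact ⟨v, ⟨(u, w), h2, h1, h3⟩, rfl⟩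
  · rw [R.enters_U_image hg] at h4
    obtain ⟨t, ht⟩ := h4.exists_mem
    have h5 := h1.smul (R.U (tauIdx j))
    exact ⟨R.U (tauIdx j) • v, ⟨_, h5.mem_OmegaGeo ht, h5, h4⟩, tangentProj_smul (R.U_mem _) v⟩

theorem geometricCrossSection_subset (hg : 2 ≤ g) (hG : ∀ k, G k ∈ arc (R.P k) (R.P (k + 1)))
    {K : Set Complex.UnitDisc} (hK : K = R.F ∨ K = interior R.F) :
    geometricCrossSection Γ K ⊆ R.arithmeticCrossSection G K := by
  have hKF : K ⊆ R.F := by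
    rcases hK with rfl | rfl
    · exact subset_rfl
    · exact interior_subset
  rintro _ ⟨v, ⟨⟨u, w⟩, h1, hv, hvK⟩, rfl⟩
  by_cases hΩ : (u, w) ∈ R.Omega G
  · exact ⟨v, ⟨(u, w), hΩ, R.isArithEntry_iff.2 ⟨hv, Or.inl ⟨h1, hvK⟩⟩⟩, rfl⟩
  obtain ⟨z, hz, hzl⟩ := h1
  obtain ⟨j, hj, hΩj⟩ := (R.mem_Omega_or_smul_mem_Omega hg hG ⟨z, hKF hz, hzl⟩).resolve_left hΩ
  refine ⟨R.U (tauIdx j) • v, ⟨_, hΩj, R.isArithEntry_iff.2 ⟨hv.smul _, ?_⟩⟩,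
    tangentProj_smul (R.U_mem _) v⟩
  -- The image geodesic is in `Omega`. If it misses `K`, it is in a corner at `V (τ j)` and the
  -- transported vector enters `U (τ j) K` as required. If it meets `K`, the original geodesic meets
  -- both `K` and the opposite tile.
  by_cases hUK : (R.U (tauIdx j) • u, R.U (tauIdx j) • w) ∈ OmegaGeo K
  · refine Or.inl ⟨hUK, ?_⟩
    obtain ⟨t, ht⟩ := (hv.smul (R.U (tauIdx j))).exists_flow_mem hUK
    rw [flow_smul, smul_base] at ht
    have hside := R.side_mem_Omega hg hG
    rcases hK with rfl | rfl
    · have key : ∀ s t : ℝ, (flow s v).base ∈ R.F → R.U (tauIdx j) • (flow t v).base ∈ R.F →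
          s = t := by
        have e := sub_add_cancel j 1
        intro s t hs ht
        rcases hj with hj | hj
        · refine hj.eq_of_mem hg ?_ ?_ (Or.inl hv) hs ht
          · rintro ⟨rfl, rfl⟩
            have := (hside (j - 1)).1
            rw [e] at this
            exact hΩ this
          · rintro ⟨rfl, rfl⟩
            exact hΩ (hside j).1
        · refine hj.eq_of_mem hg ?_ ?_ (Or.inr hv) hs ht
          · rintro ⟨rfl, rfl⟩
            have := (hside (j - 1)).2
            rw [e] at this
            exact hΩ this
          · rintro ⟨rfl, rfl⟩
            exact hΩ (hside j).2
      obtain ⟨s, hs⟩ := hvK.exists_mem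
      -- Both time sets are the same single point, so entering `K` and entering `U (τ j) K` happen
      -- at the same vector.
      have e1 : {t : ℝ | (flow t v).base ∈ R.F} = {t} :=
        Set.eq_singleton_iff_unique_mem.2 ⟨key s t hs ht ▸ hs, fun r hr => key r t hr ht⟩
      have e2 : {t : ℝ | (flow t (R.U (tauIdx j) • v)).base ∈ R.F} = {t} := by
        simp only [flow_smul, smul_base]
        exact Set.eq_singleton_iff_unique_mem.2
          ⟨ht, fun r hr => (key s r hs hr).symm.trans (key s t hs ht)⟩
      rw [Enters, e1] at hvK
      rwa [Enters, e2]
    · obtain ⟨s, hs⟩ := hvK.exists_mem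
      refine absurd (interior_subset ht) ?_
      rcases hj with hj | hj
      · exact hj.not_mem_of_mem_interior hg (Or.inl hv) hs
      · exact hj.not_mem_of_mem_interior hg (Or.inr hv) hs
  · refine Or.inr ⟨hΩj, hUK, tauIdx j, ?_, ?_⟩
    · rcases hj with hj | hj
      · exact Or.inr (hj.smul hg)
      · exact Or.inl (hj.smul hg)
    · rwa [SU11.smul_enters_image]

theorem arithmeticCrossSection_eq (hg : 2 ≤ g) (hG : ∀ k, G k ∈ arc (R.P k) (R.P (k + 1)))
    {K : Set Complex.UnitDisc} (hK : K = R.F ∨ K = interior R.F) :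
    R.arithmeticCrossSection G K = geometricCrossSection Γ K :=
  (R.arithmeticCrossSection_subset hg K).antisymm (R.geometricCrossSection_subset hg hG hK)

end FundamentalPolygon

namespace FundamentalPolygon

variable {g : ℕ} {Γ : Subgroup SU11} (R : FundamentalPolygon g Γ)

/-! ### Inward vectors -/

theorem interior_times_eq (hg : 2 ≤ g) (v : UnitTangent) (t : ℝ) : (flow t v).base ∈ interior R.F ↔
    ∀ k, 0 < orient (R.P k) (R.Q (k + 1)) v.bwd + v.ratio t * orient (R.P k) (R.Q (k + 1)) v.fwd := by
  rw [R.mem_interior_F hg]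
  exact forall_congr' fun k => v.orient_flow_pos _ _ t

theorem ordConnected_interior_times (hg : 2 ≤ g) (v : UnitTangent) :
    {t : ℝ | (flow t v).base ∈ interior R.F}.OrdConnected := by
  refine ⟨fun s hs t ht m hm => ?_⟩
  rw [Set.mem_ofPred_eq, R.interior_times_eq hg] at hs ht ⊢
  intro k
  have h1 := hs k
  have h2 := ht k
  have r1 := v.ratio_strictMono.monotone hm.1
  have r2 := v.ratio_strictMono.monotone hm.2
  rcases le_total 0 (orient (R.P k) (R.Q (k + 1)) v.fwd) with h | h <;> nlinarith

theorem isOpen_interior_times (v : UnitTangent) :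
    IsOpen {t : ℝ | (flow t v).base ∈ interior R.F} :=
  isOpen_interior.preimage v.continuous_flow_base

/-- The vectors at which geodesics enter the interior of the polygon. -/
theorem enters_interior_iff (hg : 2 ≤ g) (v : UnitTangent) :
    v.Enters (interior R.F) ↔ v ∈ R.inwardVectors := by
  have hc := R.ordConnected_interior_times hg v
  have hfr : v.base ∈ frontier R.F ↔ v.base ∈ R.F ∧ v.base ∉ interior R.F := by
    rw [R.isClosed_F.frontier_eq]; rfl
  have h0 : (flow 0 v).base = v.base := by rw [flow_zero]
  constructor
  · intro h
    -- The set of times is open, so its infimum does not belong to it.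
    have hmem : ∀ t, (flow t v).base ∈ interior R.F → 0 < t := by
      intro t ht
      refine lt_of_le_of_ne (h.1 ht) ?_
      rintro rfl
      have hev : ∀ᶠ s in 𝓝[<] (0 : ℝ), (flow s v).base ∈ interior R.F :=
        nhdsWithin_le_nhds ((R.isOpen_interior_times v).mem_nhds ht)
      obtain ⟨s, hs, hs'⟩ := (hev.and self_mem_nhdsWithin).exists
      exact absurd (h.1 hs) (not_le.2 hs')
    refine ⟨hfr.2 ⟨?_, fun hb => lt_irrefl _ (hmem 0 (h0 ▸ hb))⟩, ?_⟩
    · have hcl := h.mem_closure h.exists_mem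
      have : (0 : ℝ) ∈ {t : ℝ | (flow t v).base ∈ R.F} :=
        closure_minimal (s := {t : ℝ | (flow t v).base ∈ interior R.F})
          (fun t ht => interior_subset (s := R.F) ht) (R.isClosed_times v) hcl
      rwa [Set.mem_ofPred_eq, h0] at this
    · obtain ⟨t, ht⟩ := h.exists_mem
      filter_upwards [Ioo_mem_nhdsGT (hmem t ht)] with s hs
      obtain ⟨r, hr, hrs⟩ := (isGLB_lt_iff h).1 hs.1
      exact hc.out hr ht ⟨hrs.le, hs.2.le⟩
  · rintro ⟨h1, h2⟩
    have hb := (hfr.1 h1).2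
    rw [← h0] at hb
    constructor
    · intro t ht
      by_contra hneg
      rw [not_le] at hneg
      obtain ⟨s, hs, hs'⟩ := (h2.and self_mem_nhdsWithin).exists
      exact hb (hc.out ht hs ⟨hneg.le, le_of_lt hs'⟩)
    · intro b hbd
      exact ge_of_tendsto (tendsto_id.mono_left nhdsWithin_le_nhds) (h2.mono fun t ht => hbd ht)

/-- The endpoints are determined by the vector, so only the entrance condition remains, for some
representative of the orbit. -/
theorem tangentProj_mem_geometricCrossSection {K : Set Complex.UnitDisc} {v : UnitTangent} :
    tangentProj Γ v ∈ geometricCrossSection Γ K ↔ ∃ γ ∈ Γ, (γ • v).Enters K := by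
  constructor
  · rintro ⟨v', ⟨p, -, -, h⟩, e⟩
    obtain ⟨γ, hγ⟩ := Quotient.exact (s := MulAction.orbitRel Γ UnitTangent) e
    refine ⟨γ, γ.2, ?_⟩
    have hγ' : (γ : SU11) • v = v' := hγ
    rwa [hγ']
  · rintro ⟨γ, hγ, h⟩
    obtain ⟨t, ht⟩ := h.exists_mem
    exact ⟨γ • v, ⟨_, (γ • v).joins_self.mem_OmegaGeo ht, (γ • v).joins_self, h⟩,
      tangentProj_smul hγ v⟩

theorem geometricCrossSection_interior (hg : 2 ≤ g) :
    geometricCrossSection Γ (interior R.F) = tangentProj Γ '' R.inwardVectors := by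
  refine congrArg (tangentProj Γ '' ·) (Set.ext fun v => ?_)
  rw [← R.enters_interior_iff hg]
  constructor
  · rintro ⟨p, -, -, h⟩
    exact h
  · intro h
    obtain ⟨t, ht⟩ := h.exists_mem
    exact ⟨_, v.joins_self.mem_OmegaGeo ht, v.joins_self, h⟩

end FundamentalPolygon

/-! ### Discrete subgroups -/

namespace SU11

theorem isClosedEmbedding_coe :
    Topology.IsClosedEmbedding fun M : SU11 => (M.a, M.b) := by
  refine ⟨⟨⟨rfl⟩, fun M N h => SU11.ext (congrArg Prod.fst h) (congrArg Prod.snd h)⟩, ?_⟩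
  have : Set.range (fun M : SU11 => (M.a, M.b)) =
      {p | Complex.normSq p.1 - Complex.normSq p.2 = 1} := by
    ext p
    exact ⟨fun ⟨M, hM⟩ => hM ▸ M.det, fun h => ⟨⟨p.1, p.2, h⟩, rfl⟩⟩
  rw [this]
  have := Complex.continuous_normSq
  exact isClosed_eq (by fun_prop) continuous_const

theorem continuous_a : Continuous SU11.a := continuous_fst.comp isClosedEmbedding_coe.continuous

theorem continuous_b : Continuous SU11.b := continuous_snd.comp isClosedEmbedding_coe.continuous

instance : T2Space SU11 := isClosedEmbedding_coe.isEmbedding.t2Space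

instance : IsTopologicalGroup SU11 where
  continuous_mul := by
    have ha := continuous_a
    have hb := continuous_b
    refine continuous_induced_rng.2 (Continuous.prodMk ?_ ?_)
    · change Continuous fun p : SU11 × SU11 => p.1.a * p.2.a + p.1.b * conj p.2.b
      have := Complex.continuous_conj
      fun_prop
    · change Continuous fun p : SU11 × SU11 => p.1.a * p.2.b + p.1.b * conj p.2.a
      have := Complex.continuous_conj
      fun_prop
  continuous_inv := by
    refine continuous_induced_rng.2 (Continuous.prodMk ?_ ?_)
    · exact Complex.continuous_conj.comp continuous_a
    · exact continuous_b.neg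

theorem isCompact_norm_le (C : ℝ) : IsCompact {M : SU11 | ‖M.a‖ ≤ C} := by
  have h := isClosedEmbedding_coe.isCompact_preimage
    ((isCompact_closedBall (0 : ℂ) C).prod (isCompact_closedBall (0 : ℂ) C))
  refine h.of_isClosed_subset (isClosed_le continuous_a.norm continuous_const) fun M hM => ?_
  have hM' : ‖M.a‖ ≤ C := hM
  have hd := M.det
  rw [Complex.normSq_eq_norm_sq, Complex.normSq_eq_norm_sq] at hd
  have hb : ‖M.b‖ ≤ ‖M.a‖ := by nlinarith [norm_nonneg M.a, norm_nonneg M.b]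
  exact ⟨mem_closedBall_zero_iff.2 hM', mem_closedBall_zero_iff.2 (hb.trans hM')⟩

/-- A discrete subgroup is closed, so it meets a compact set in a compact discrete set. -/
theorem finite_norm_le {Γ : Subgroup SU11} (hdisc : DiscreteTopology Γ) (C : ℝ) :
    {γ : SU11 | γ ∈ Γ ∧ ‖γ.a‖ ≤ C}.Finite := by
  have hcl : IsClosed (Γ : Set SU11) := Subgroup.isClosed_of_discrete
  have hd : IsDiscrete (Γ : Set SU11) := isDiscrete_iff_discreteTopology.mpr hdisc
  exact ((isCompact_norm_le C).inter_left hcl).finite (hd.mono Set.inter_subset_left)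

/-- The formula for `1 - |M z|²` bounds the denominator at `z` from above when `M z` stays away from
the circle, while `|b| ≤ |a|` bounds it from below by `|a| (1 - r)`. -/
theorem norm_a_le (M : SU11) {r s : ℝ} (hr : r < 1) (hs : s < 1) {z : Complex.UnitDisc}
    (hz : ‖(z : ℂ)‖ ≤ r) (hMz : ‖((M • z : Complex.UnitDisc) : ℂ)‖ ≤ s) :
    ‖M.a‖ ≤ 1 / (1 - s ^ 2) / (1 - r) + 1 / (1 - r) := by
  have hd := M.det
  rw [Complex.normSq_eq_norm_sq, Complex.normSq_eq_norm_sq] at hd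
  have ha := norm_nonneg M.a
  have hb := norm_nonneg M.b
  have hz0 := norm_nonneg (z : ℂ)
  have hs0 := norm_nonneg ((M • z : Complex.UnitDisc) : ℂ)
  have hba : ‖M.b‖ ≤ ‖M.a‖ := by nlinarith
  have h1 := M.normSq_mobius z.norm_lt_one.le
  rw [← coe_smul_disc, Complex.normSq_eq_norm_sq, Complex.normSq_eq_norm_sq,
    Complex.normSq_eq_norm_sq] at h1
  have hden : 0 < ‖M.den z‖ := norm_pos_iff.2 (M.den_ne_zero z.norm_lt_one.le)
  rw [eq_div_iff (by positivity)] at h1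
  have h2 : ‖M.a‖ * (1 - r) ≤ ‖M.den z‖ := by
    have h3 : ‖M.a‖ ≤ ‖M.den z‖ + ‖M.b‖ * ‖(z : ℂ)‖ := by
      have : conj M.a = M.den z - conj M.b * z := by rw [den]; ring
      rw [← RCLike.norm_conj M.a, this]
      refine (norm_sub_le _ _).trans ?_
      rw [norm_mul, RCLike.norm_conj]
    nlinarith [mul_le_mul hba hz hz0 ha]
  have hs2 : 0 < 1 - s ^ 2 := by nlinarith
  have h4 : ‖M.den z‖ ^ 2 * (1 - s ^ 2) ≤ 1 := by
    have : (1 - s ^ 2) * ‖M.den z‖ ^ 2 ≤ (1 - ‖((M • z : Complex.UnitDisc) : ℂ)‖ ^ 2) *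
        ‖M.den z‖ ^ 2 := mul_le_mul_of_nonneg_right (by nlinarith) (by positivity)
    nlinarith
  have h5 : ‖M.den z‖ ≤ 1 / (1 - s ^ 2) + 1 := by
    rw [← le_div_iff₀ hs2] at h4
    nlinarith [sq_nonneg (‖M.den z‖ - 1)]
  rw [← add_div, le_div_iff₀ (by linarith)]
  exact h2.trans h5

end SU11

namespace FundamentalPolygon

variable {g : ℕ} {Γ : Subgroup SU11} (R : FundamentalPolygon g Γ)

/-! ### The first return -/

/-- The tiling by the translates of the polygon is locally finite. -/
theorem finite_tiles (hg : 2 ≤ g) (hdisc : DiscreteTopology Γ) (v : UnitTangent) (a b : ℝ) :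
    {γ : SU11 | γ ∈ Γ ∧ ∃ t ∈ Set.Icc a b, γ • (flow t v).base ∈ R.F}.Finite := by
  obtain ⟨s, hs, hF⟩ := R.exists_norm_le hg
  obtain ⟨r, hr, hv⟩ : ∃ r : ℝ, r < 1 ∧ ∀ t ∈ Set.Icc a b, ‖((flow t v).base : ℂ)‖ ≤ r := by
    rcases Set.eq_empty_or_nonempty (Set.Icc a b) with he | hne
    · exact ⟨0, one_pos, fun t ht => by rw [he] at ht; exact ht.elim⟩
    · obtain ⟨t, -, hmax⟩ := isCompact_Icc.exists_isMaxOn hne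
        (Complex.UnitDisc.continuous_coe.comp v.continuous_flow_base).norm.continuousOn
      exact ⟨_, (flow t v).base.norm_lt_one, fun t ht => hmax ht⟩
  refine (SU11.finite_norm_le hdisc (1 / (1 - s ^ 2) / (1 - r) + 1 / (1 - r))).subset ?_
  rintro γ ⟨hγ, t, ht, hmem⟩
  exact ⟨hγ, γ.norm_a_le hr hs (hv t ht) (hF _ hmem)⟩

theorem cover_F (z : Complex.UnitDisc) : ∃ γ ∈ Γ, γ • z ∈ R.F := R.cover z

/-- A geodesic that meets the interior of the polygon meets the interior of a translate in every
interval of time. -/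
theorem exists_mem_interior (hg : 2 ≤ g) (hdisc : DiscreteTopology Γ) {v : UnitTangent} {t₀ : ℝ}
    (h : (flow t₀ v).base ∈ interior R.F) {a b : ℝ} (hab : a < b) :
    ∃ t ∈ Set.Icc a b, ∃ γ ∈ Γ, γ • (flow t v).base ∈ interior R.F := by
  have := neZero_sideIndex hg
  by_contra hne
  push Not at hne
  have hfin := (R.finite_tiles hg hdisc v a b).prod (Set.finite_univ (α := SideIndex g))
  refine (Set.Icc_infinite hab) ((hfin.biUnion (t := fun p => {t | orient (R.P p.2) (R.Q (p.2 + 1))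
    (klein (p.1 • (flow t v).base)) = 0}) ?_).subset ?_)
  · rintro ⟨γ, k⟩ ⟨⟨hγ, -⟩, -⟩
    refine Set.Subsingleton.finite fun s hs t ht => ?_
    have hs' : orient (R.P k) (R.Q (k + 1)) (klein (γ • (flow s v).base)) = 0 := hs
    have ht' : orient (R.P k) (R.Q (k + 1)) (klein (γ • (flow t v).base)) = 0 := ht
    rw [← smul_base, ← flow_smul, orient_flow_eq_zero] at hs' ht'
    -- The line of side `k`, pulled back by `γ`, cannot contain the geodesic, which has a point in
    -- the interior of the polygon; so each pair `(γ, k)` accounts for at most one time.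
    have hline : ¬ orient (R.P k) (R.Q (k + 1)) (klein (γ • (flow t₀ v).base)) = 0 := fun h0 =>
      R.extension k γ hγ _ h
        (mem_geodesicLine_iff.2 ⟨(mem_geodesicLine_iff.1 (R.V_left k)).1, h0⟩)
    rw [← smul_base, ← flow_smul, orient_flow_eq_zero] at hline
    have e : ((γ • v).ratio s - (γ • v).ratio t) * orient (R.P k) (R.Q (k + 1)) (γ • v).fwd = 0 := by
      linarith
    rcases mul_eq_zero.1 e with e | e
    · exact (γ • v).ratio_strictMono.injective (sub_eq_zero.1 e)
    · rw [e] at hline hs'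
      rw [mul_zero] at hline hs'
      exact absurd hs' hline
  · intro t ht
    obtain ⟨γ, hγ, hF⟩ := R.cover_F (flow t v).base
    have hF' := R.mem_F.1 hF
    have hint := hne t ht γ hγ
    rw [R.mem_interior_F hg] at hint
    push Not at hint
    obtain ⟨k, hk⟩ := hint
    exact Set.mem_biUnion (x := (γ, k)) ⟨⟨hγ, t, ht, hF⟩, Set.mem_univ _⟩ (le_antisymm hk (hF' k))

theorem exists_isFirstReturnTime (hg : 2 ≤ g) (hdisc : DiscreteTopology Γ)
    {K : Set Complex.UnitDisc} (hK : K = R.F ∨ K = interior R.F) {x : SurfaceTangent Γ}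
    (hx : x ∈ geometricCrossSection Γ K) :
    ∃ t, IsFirstReturnTime (geometricCrossSection Γ K) x t := by
  have hKF : K ⊆ R.F := by
    rcases hK with rfl | rfl
    · exact subset_rfl
    · exact interior_subset
  obtain ⟨v, ⟨p, -, -, hvK⟩, rfl⟩ := hx
  have hret : {s : ℝ | 0 < s ∧ surfaceFlow Γ s (tangentProj Γ v) ∈ geometricCrossSection Γ K} =
      {s | 0 < s ∧ ∃ γ ∈ Γ, IsGLB {t : ℝ | γ • (flow t v).base ∈ K} s} := by
    ext s
    have : surfaceFlow Γ s (tangentProj Γ v) = tangentProj Γ (flow s v) := rfl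
    simp only [Set.mem_ofPred_eq, this, tangentProj_mem_geometricCrossSection, ← flow_smul,
      enters_flow_iff]
    simp only [flow_smul, smul_base]
  have hfin : ∀ b, {s | (0 < s ∧ ∃ γ ∈ Γ, IsGLB {t : ℝ | γ • (flow t v).base ∈ K} s) ∧
      s ≤ b}.Finite := by
    intro b
    -- The infimum need not be attained, so a time in the set less than 1 above it is used; this is
    -- why the interval extends to `b + 1`.
    refine ((R.finite_tiles hg hdisc v 0 (b + 1)).biUnion
      (t := fun γ => {s | IsGLB {t : ℝ | γ • (flow t v).base ∈ K} s}) fun γ _ =>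
        Set.Subsingleton.finite fun s hs t ht => hs.unique ht).subset ?_
    rintro s ⟨⟨hs, γ, hγ, hglb⟩, hsb⟩
    obtain ⟨t, ht, hts⟩ := (isGLB_lt_iff hglb).1 (lt_add_one s)
    exact Set.mem_biUnion (x := γ) ⟨hγ, t, ⟨hs.le.trans (hglb.1 ht), by linarith⟩, hKF ht⟩ hglb
  have hne : ∃ s, 0 < s ∧ ∃ γ ∈ Γ, IsGLB {t : ℝ | γ • (flow t v).base ∈ K} s := by
    have times : ∀ γ : SU11, {t : ℝ | γ • (flow t v).base ∈ R.F} =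
        {t : ℝ | (flow t (γ • v)).base ∈ R.F} := fun γ => by simp only [flow_smul, smul_base]
    have hfin0 := R.finite_tiles hg hdisc v 0 0
    -- After time `T` the geodesic has left the finitely many tiles that contain its starting point,
    -- so a tile met later must be entered at a positive time.
    obtain ⟨T, hT0, hT⟩ : ∃ T : ℝ, 0 < T ∧ ∀ γ ∈ Γ, γ • (flow 0 v).base ∈ R.F →
        ∀ t, γ • (flow t v).base ∈ R.F → t < T := by
      have hbdd : BddAbove (⋃ γ ∈ {γ : SU11 | γ ∈ Γ ∧ ∃ t ∈ Set.Icc (0 : ℝ) 0,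
          γ • (flow t v).base ∈ R.F}, {t : ℝ | γ • (flow t v).base ∈ R.F}) := by
        rw [hfin0.bddAbove_biUnion]
        intro γ _
        rw [times]
        exact R.bddAbove_times hg _
      obtain ⟨B, hB⟩ := hbdd
      refine ⟨max B 0 + 1, by positivity, fun γ hγ h0 t ht => ?_⟩
      have := hB (Set.mem_biUnion (x := γ) ⟨hγ, 0, ⟨le_rfl, le_rfl⟩, h0⟩ ht)
      linarith [le_max_left B 0]
    obtain ⟨t, hTt, γ, hγ, ht⟩ : ∃ t, T ≤ t ∧ ∃ γ ∈ Γ, γ • (flow t v).base ∈ K := by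
      rcases hK with rfl | rfl
      · obtain ⟨γ, hγ, h⟩ := R.cover_F (flow T v).base
        exact ⟨T, le_rfl, γ, hγ, h⟩
      · obtain ⟨t₀, h0⟩ := hvK.exists_mem
        obtain ⟨t, ht, γ, hγ, h⟩ := R.exists_mem_interior hg hdisc h0 (lt_add_one T)
        exact ⟨t, ht.1, γ, hγ, h⟩
    have h0 : ¬ γ • (flow 0 v).base ∈ R.F := fun h0 =>
      absurd (hT γ hγ h0 t (hKF ht)) (not_lt.2 hTt)
    have hcl : IsClosed {t : ℝ | γ • (flow t v).base ∈ R.F} := by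
      rw [times]; exact R.isClosed_times _
    have hconn : {t : ℝ | γ • (flow t v).base ∈ R.F}.OrdConnected := by
      rw [times]; exact R.ordConnected_times _
    have hbdd : BddBelow {t : ℝ | γ • (flow t v).base ∈ R.F} := by
      rw [times]; exact R.bddBelow_times hg _
    have hsub : {t : ℝ | γ • (flow t v).base ∈ K} ⊆ {t : ℝ | γ • (flow t v).base ∈ R.F} :=
      fun t ht => hKF ht
    have hglb : IsGLB {t : ℝ | γ • (flow t v).base ∈ K} _ :=
      isGLB_csInf ⟨t, ht⟩ (hbdd.mono hsub)
    refine ⟨_, ?_, γ, hγ, hglb⟩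
    -- The entrance time belongs to the closed, convex set of times in the closed tile; if it were
    -- not positive, time 0 would belong to this set too.
    have hmem := hcl.closure_subset_iff.2 hsub (hglb.mem_closure ⟨t, ht⟩)
    refine lt_of_not_ge fun hle => h0 (hconn.out hmem (hKF ht) ⟨hle, by linarith⟩)
  obtain ⟨b, hb⟩ := hne
  obtain ⟨s, hs, hmin⟩ := Set.exists_min_image _ id (hfin b) ⟨b, hb, le_rfl⟩
  refine ⟨s, ?_⟩
  rw [IsFirstReturnTime, hret]
  refine ⟨hs.1, fun t ht => ?_⟩
  rcases le_total t b with htb | htb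
  · exact hmin t ⟨ht, htb⟩
  · exact hs.2.trans htb

end FundamentalPolygon

theorem mainTheorem7 (g : ℕ) (hg : 2 ≤ g) (Γ : Subgroup SU11) (hdisc : DiscreteTopology Γ)
    (hfree : ActsFreely Γ) (R : FundamentalPolygon g Γ) (A : SideIndex g → Circle)
    (hA : R.IsExtremal A) :
    ∃ G : SideIndex g → Circle,
      (R.IsSystemSolution A G ∧ ∀ G', R.IsSystemSolution A G' → G' = G) ∧
      (∀ p ∈ R.Omega G, ∃! v : UnitTangent, R.IsArithEntry G R.F p v) ∧
      FundamentalPolygon.geometricCrossSection Γ (interior R.F) =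
        tangentProj Γ '' R.inwardVectors ∧
      ∀ K : Set Complex.UnitDisc, (K = R.F ∨ K = interior R.F) →
        R.arithmeticCrossSection G K = FundamentalPolygon.geometricCrossSection Γ K ∧
        ∀ x ∈ FundamentalPolygon.geometricCrossSection Γ K, ∃ t : ℝ,
          IsFirstReturnTime (FundamentalPolygon.geometricCrossSection Γ K) x t ∧
          IsFirstReturnTime (R.arithmeticCrossSection G K) x t := by
  obtain ⟨G, hG, huniq⟩ := R.exists_systemSolution hg hA
  have hGm : ∀ k, G k ∈ arc (R.P k) (R.P (k + 1)) := fun k => (hG k).1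
  refine ⟨G, ⟨hG, huniq⟩, fun ⟨u, w⟩ h => R.existsUnique_isArithEntry hg hGm h,
    R.geometricCrossSection_interior hg, fun K hK => ?_⟩
  rw [R.arithmeticCrossSection_eq hg hGm hK]
  refine ⟨rfl, fun x hx => ?_⟩
  obtain ⟨t, ht⟩ := R.exists_isFirstReturnTime hg hdisc hK hx
  exact ⟨t, ht, ht⟩
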